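/- **Theorem A2.** Let $G$ be a (real, finite-dimensional, not necessarily connected) Lie group with Lie algebra $\mathfrak g$, let $\Gamma\subset G$ be a discrete subgroup, and let $X=G/\Gamma$. Let $F=\{g_t:t\in\mathbb R\}$ be a one-parameter subgroup of $G$, put $F^+=\{g_t:t\ge 0\}$, and let $Z$ be a non-empty $(F,G_{F^+}^{\max})$-transversal $C^1$ submanifold of $X$. Then the set $$E(F^+,Z)=\{x\in X:\overline{F^+x}\cap Z=\emptyset\}$$ is hyperplane absolute winning (HAW). Here the following notions are used. *Maximally expanding horospherical subgroup.* For a linear endomorphism $T$ of a finite-dimensional real vector space, let $\operatorname{Sp}(T)$ be the set of its complex eigenvalues, $\rho=\max_{\lambda\in\operatorname{Sp}(T)}|\lambda|$, $\prod_{\lambda\in\operatorname{Sp}(T)}(x-\lambda)^{s(\lambda)}$ its minimal polynomial, and $s=\max\{s(\lambda):\lambda\in\operatorname{Sp}(T),\ |\lambda|=\rho\}$. Let $p_T$ be the unique real polynomial of degree less than that of the minimal polynomial such that, for every $\lambda\in\operatorname{Sp}(T)$, modulo $(x-\lambda)^{s(\lambda)}$ it is congruent to $(x-\lambda)^{s-1}$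 if $|\lambda|=\rho$ and $s(\lambda)=s$, and to $0$ otherwise. With $T=\operatorname{Ad}g_1$, put $\mathfrak g_{F^+}^{\max}=\operatorname{Im}p_T(T)$ if $\rho>1$ and $\mathfrak g_{F^+}^{\max}=\{0\}$ if $\rho\le 1$; this is an abelian subalgebra of $\mathfrak g$, and $G_{F^+}^{\max}$ is the connected Lie subgroup of $G$ with Lie algebra $\mathfrak g_{F^+}^{\max}$. *Transversality.* For a Lie subgroup $H$ of $G$, a $C^1$ submanifold $Z\subset X$ is $(F,H)$-transversal if for every $z\in Z$ one has $T_z(Fz)\not\subset T_zZ$ and $T_z(Hz)\not\subset T_zZ\oplus T_z(Fz)$. *HAW.* Let $V$ be a Euclidean space, $U\subset V$ open, $S\subset U$ and $\beta\in(0,\frac13)$. In the $\beta$-hyperplane absolute game on $U$, Bob first chooses a closed ball $B_0\subset U$ of radius $r_0>0$; after Bob's ball $B_i$ of radius $r_i$, Alice chooses an affine hyperplane $L_i$ and $0<r_i'\le\beta r_i$, and then Bob chooses a closed ball $B_{i+1}\subset B_i\smallsetminus\{v\in V:\operatorname{dist}(v,L_i)<r_i'\}$ of radius $r_{i+1}\ge\beta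 r_i$. Alice wins if $\bigcap_iB_i\cap S\ne\emptyset$. The set $S$ is HAW on $U$ if Alice has a winning strategy for every $\beta\in(0,\frac13)$. A subset $S$ of a $C^1$ manifold $M$ is HAW if for every $C^1$ chart $\varphi$ of $M$ with domain $U_\varphi$, the set $\varphi(S\cap U_\varphi)$ is HAW on $\varphi(U_\varphi)$. -/

import Mathlib

open scoped Manifold ContDiff Topology Polynomial ComplexConjugate

namespace NondenseOrbits

noncomputable section

section Game

variable {V : Type*} [NormedAddCommGroup V] [InnerProductSpace ℝ V]

/-- An affine hyperplane of `V`. -/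
def IsAffineHyperplane (L : AffineSubspace ℝ V) : Prop :=
  (L : Set V).Nonempty ∧ Module.finrank ℝ L.direction + 1 = Module.finrank ℝ V

/-- A strategy of Alice in the hyperplane absolute game: after Bob has chosen the closed balls
`B_0, …, B_i`, given by their centers and radii, Alice answers with a subspace `L_i` and a radius
`r_i'`. -/
abbrev Strategy (V : Type*) [NormedAddCommGroup V] [InnerProductSpace ℝ V] : Type _ :=
  (i : ℕ) → (Fin (i + 1) → V × ℝ) → AffineSubspace ℝ V × ℝ

/-- A strategy is legal if `L_i` is always an affine hyperplane and `0 < r_i' ≤ β r_i`. -/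
def Strategy.IsLegal (σ : Strategy V) (β : ℝ) : Prop :=
  ∀ (i : ℕ) (B : Fin (i + 1) → V × ℝ), 0 < (B (Fin.last i)).2 →
    IsAffineHyperplane (σ i B).1 ∧ 0 < (σ i B).2 ∧ (σ i B).2 ≤ β * (B (Fin.last i)).2

/-- Bob's balls `B_i = closedBall (c i) (r i)` are a legal play on `U` against Alice's strategy `σ`:
`B_0 ⊆ U`, and `B_{i+1}` is contained in `B_i` minus the open `r_i'`-neighborhood of `L_i` and has
radius at least `β r_i`. -/
def Strategy.IsPlay (σ : Strategy V) (β : ℝ) (U : Set V) (c : ℕ → V) (r : ℕ → ℝ) : Prop :=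
  0 < r 0 ∧ Metric.closedBall (c 0) (r 0) ⊆ U ∧
    ∀ i : ℕ, β * r i ≤ r (i + 1) ∧
      Metric.closedBall (c (i + 1)) (r (i + 1)) ⊆
        Metric.closedBall (c i) (r i) \
          Metric.thickening (σ i fun j => (c j, r j)).2 ((σ i fun j => (c j, r j)).1 : Set V)

/-- `S` is `β`-hyperplane absolute winning on `U`: Alice has a strategy such that the intersection
of Bob's balls always meets `S`. -/
def IsBetaHAWOn (β : ℝ) (S U : Set V) : Prop :=
  ∃ σ : Strategy V, σ.IsLegal β ∧ ∀ (c : ℕ → V) (r : ℕ → ℝ), σ.IsPlay β U c r →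
    ((⋂ i, Metric.closedBall (c i) (r i)) ∩ S).Nonempty

/-- `S` is hyperplane absolute winning on `U`. -/
def IsHAWOn (S U : Set V) : Prop :=
  ∀ β : ℝ, 0 < β → β < 1 / 3 → IsBetaHAWOn β S U

/-- A subset `S` of a `C¹` manifold `M` modelled on the Euclidean space `V` is hyperplane absolute
winning if, in every `C¹` chart `φ` of `M`, the image of `S` is hyperplane absolute winning on the
image of `φ`. -/
def IsHAW (V : Type*) [NormedAddCommGroup V] [InnerProductSpace ℝ V]
    {M : Type*} [TopologicalSpace M] [ChartedSpace V M] (S : Set M) : Prop :=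
  ∀ φ ∈ IsManifold.maximalAtlas 𝓘(ℝ, V) 1 M, IsHAWOn (φ '' (S ∩ φ.source)) φ.target

end Game

section LinearAlgebra

variable {V : Type*} [AddCommGroup V] [Module ℝ V]

/-- `Sp(T)`: the set of eigenvalues of the complexification of `T`. -/
def complexSpectrum (T : V →ₗ[ℝ] V) : Set ℂ :=
  {z | Module.End.HasEigenvalue (LinearMap.baseChange ℂ T) z}

/-- `ρ(T)`: the largest modulus of an element of `Sp(T)`. -/
def specRadius (T : V →ₗ[ℝ] V) : ℝ :=
  sSup ((fun z : ℂ => ‖z‖) '' complexSpectrum T)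

/-- `s(z)`: the exponent of `X - z` in the minimal polynomial of `T` over `ℂ`. -/
def minpolyExponent (T : V →ₗ[ℝ] V) (z : ℂ) : ℕ :=
  ((minpoly ℝ T).map (algebraMap ℝ ℂ)).rootMultiplicity z

/-- `s(T)`: the largest exponent `s(z)` over the eigenvalues `z` of maximal modulus. -/
def topExponent (T : V →ₗ[ℝ] V) : ℕ :=
  sSup (minpolyExponent T '' {z | z ∈ complexSpectrum T ∧ ‖z‖ = specRadius T})

open Classical in
/-- The residue prescribed at the eigenvalue `z`: `(X - z) ^ (s - 1)` if `z` has maximal modulus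
and maximal exponent, and `0` otherwise. -/
def prescribedResidue (T : V →ₗ[ℝ] V) (z : ℂ) : ℂ[X] :=
  if ‖z‖ = specRadius T ∧ minpolyExponent T z = topExponent T then
    (Polynomial.X - Polynomial.C z) ^ (topExponent T - 1)
  else 0

/-- The defining property of the polynomial `p_T`: its degree is less than that of the minimal
polynomial of `T`, and it has the prescribed residue modulo `(X - z) ^ s(z)` for each
eigenvalue `z`. -/
def IsTopPolynomial (T : V →ₗ[ℝ] V) (p : ℝ[X]) : Prop :=
  p.degree < (minpoly ℝ T).degree ∧
    ∀ z ∈ complexSpectrum T, (Polynomial.X - Polynomial.C z) ^ minpolyExponent T z ∣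
      p.map (algebraMap ℝ ℂ) - prescribedResidue T z

section Existence

theorem finite_complexSpectrum [FiniteDimensional ℝ V] (T : V →ₗ[ℝ] V) :
    (complexSpectrum T).Finite :=
  Module.End.finite_hasEigenvalue _

theorem mem_complexSpectrum_iff [FiniteDimensional ℝ V] (T : V →ₗ[ℝ] V) (z : ℂ) :
    z ∈ complexSpectrum T ↔ Polynomial.aeval z T.charpoly = 0 := by
  rw [complexSpectrum, Set.mem_ofPred_eq, Module.End.hasEigenvalue_iff_isRoot_charpoly,
    LinearMap.charpoly_baseChange, Polynomial.IsRoot, Polynomial.eval_map_algebraMap]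

theorem conj_mem_complexSpectrum [FiniteDimensional ℝ V] {T : V →ₗ[ℝ] V} {z : ℂ}
    (hz : z ∈ complexSpectrum T) :
    conj z ∈ complexSpectrum T := by
  rw [mem_complexSpectrum_iff] at hz ⊢
  rw [Polynomial.aeval_conj, hz, map_zero]

theorem map_conj_map (p : ℝ[X]) :
    (p.map (algebraMap ℝ ℂ)).map (starRingEnd ℂ) = p.map (algebraMap ℝ ℂ) := by
  rw [Polynomial.map_map]
  congr 1
  ext x
  simp

theorem minpolyExponent_conj (T : V →ₗ[ℝ] V) (z : ℂ) :
    minpolyExponent T (conj z) = minpolyExponent T z := by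
  unfold minpolyExponent
  conv_lhs => rw [← map_conj_map]
  exact (Polynomial.eq_rootMultiplicity_map (starRingEnd ℂ).injective z).symm

theorem prescribedResidue_conj (T : V →ₗ[ℝ] V) (z : ℂ) :
    (prescribedResidue T (conj z)).map (starRingEnd ℂ) = prescribedResidue T z := by
  unfold prescribedResidue
  rw [minpolyExponent_conj, RCLike.norm_conj]
  split_ifs <;> simp

theorem prod_eq_minpoly [FiniteDimensional ℝ V] (T : V →ₗ[ℝ] V) :
    (minpoly ℝ T).map (algebraMap ℝ ℂ) = ∏ z ∈ (finite_complexSpectrum T).toFinset,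
      (Polynomial.X - Polynomial.C z) ^ minpolyExponent T z := by
  classical
  set P := (minpoly ℝ T).map (algebraMap ℝ ℂ) with hP
  have hm : P.Monic := (minpoly.monic (Algebra.IsIntegral.isIntegral T)).map _
  have h1 := (IsAlgClosed.splits P).eq_prod_roots
  rw [hm.leadingCoeff, Polynomial.C_1, one_mul] at h1
  rw [h1, Finset.prod_multiset_map_count]
  have hcount : ∀ z, P.roots.count z = minpolyExponent T z := fun z => by
    rw [Polynomial.count_roots]; rfl
  simp only [hcount]
  apply Finset.prod_subset
  · intro z hz
    rw [Multiset.mem_toFinset, Polynomial.mem_roots hm.ne_zero] at hz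
    rw [Set.Finite.mem_toFinset, mem_complexSpectrum_iff]
    have := (Polynomial.map_dvd (algebraMap ℝ ℂ) (LinearMap.minpoly_dvd_charpoly T))
    have := hz.dvd this
    rwa [Polynomial.IsRoot, Polynomial.eval_map_algebraMap] at this
  · intro z _ hz
    rw [Multiset.mem_toFinset, ← Multiset.count_eq_zero, hcount] at hz
    rw [hz, pow_zero]

theorem pairwise_coprime (T : V →ₗ[ℝ] V) (s : Set ℂ) :
    s.Pairwise (Function.onFun IsCoprime
      fun z => (Polynomial.X - Polynomial.C z) ^ minpolyExponent T z) := fun _ _ _ _ hab =>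
  (Polynomial.isCoprime_X_sub_C_of_isUnit_sub (sub_ne_zero.2 hab).isUnit).pow

theorem IsTopPolynomial.unique [FiniteDimensional ℝ V] {T : V →ₗ[ℝ] V} {p q : ℝ[X]}
    (hp : IsTopPolynomial T p)
    (hq : IsTopPolynomial T q) : p = q := by
  have hdvd : (minpoly ℝ T).map (algebraMap ℝ ℂ) ∣ (p - q).map (algebraMap ℝ ℂ) := by
    rw [prod_eq_minpoly]
    refine Finset.prod_dvd_of_coprime (pairwise_coprime T _) fun z hz => ?_
    rw [Set.Finite.mem_toFinset] at hz
    rw [Polynomial.map_sub]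
    simpa using dvd_sub (hp.2 z hz) (hq.2 z hz)
  rw [Polynomial.map_dvd_map' (algebraMap ℝ ℂ)] at hdvd
  by_contra hne
  exact absurd (Polynomial.degree_le_of_dvd hdvd (sub_ne_zero.2 hne))
    (not_le.2 ((Polynomial.degree_sub_le p q).trans_lt (max_lt hp.1 hq.1)))

/-- There is exactly one polynomial with the defining property of `p_T`. -/
theorem existsUnique_isTopPolynomial [FiniteDimensional ℝ V] (T : V →ₗ[ℝ] V) :
    ∃! p : ℝ[X], IsTopPolynomial T p := by
  classical
  set m := minpoly ℝ T with hm
  have hmon : m.Monic := minpoly.monic (Algebra.IsIntegral.isIntegral T)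
  have hinj : Function.Injective (algebraMap ℝ ℂ) := (algebraMap ℝ ℂ).injective
  obtain ⟨q, hq⟩ : ∃ q : ℂ[X], ∀ z ∈ complexSpectrum T,
      (Polynomial.X - Polynomial.C z) ^ minpolyExponent T z ∣ q - prescribedResidue T z := by
    have : Finite (complexSpectrum T) := finite_complexSpectrum T
    obtain ⟨q, hq⟩ := Ideal.exists_forall_sub_mem_ideal
      (I := fun z : complexSpectrum T => Ideal.span
        {(Polynomial.X - Polynomial.C (z : ℂ)) ^ minpolyExponent T (z : ℂ)})
      (fun a b hab => (Ideal.isCoprime_span_singleton_iff _ _).2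
        (pairwise_coprime T Set.univ (Set.mem_univ _) (Set.mem_univ _)
          (fun h => hab (Subtype.ext h))))
      (fun z => prescribedResidue T z)
    exact ⟨q, fun z hz => Ideal.mem_span_singleton.1 (hq ⟨z, hz⟩)⟩
  have hq' : ∀ z ∈ complexSpectrum T, (Polynomial.X - Polynomial.C z) ^ minpolyExponent T z ∣
      q.map (starRingEnd ℂ) - prescribedResidue T z := by
    intro z hz
    have := Polynomial.map_dvd (starRingEnd ℂ) (hq _ (conj_mem_complexSpectrum hz))
    simpa [minpolyExponent_conj, prescribedResidue_conj] using this
  set r : ℝ[X] := ∑ i ∈ Finset.range (q.natDegree + 1), Polynomial.monomial i (q.coeff i).re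
    with hr
  have hrc : r.map (algebraMap ℝ ℂ) =
      Polynomial.C (1 / 2) * (q + q.map (starRingEnd ℂ)) := by
    ext1 i
    have hri : r.coeff i = (q.coeff i).re := by
      rw [hr, Polynomial.finsetSum_coeff]
      simp only [Polynomial.coeff_monomial, Finset.sum_ite_eq', Finset.mem_range]
      split_ifs with h
      · rfl
      · rw [Polynomial.coeff_eq_zero_of_natDegree_lt (by omega), Complex.zero_re]
    rw [Polynomial.coeff_map, hri, Polynomial.coeff_C_mul, Polynomial.coeff_add,
      Polynomial.coeff_map, Complex.add_conj]
    simp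
  have hmain : ∀ z ∈ complexSpectrum T, (Polynomial.X - Polynomial.C z) ^ minpolyExponent T z ∣
      (r %ₘ m).map (algebraMap ℝ ℂ) - prescribedResidue T z := by
    intro z hz
    have h1 : (r %ₘ m).map (algebraMap ℝ ℂ) - prescribedResidue T z =
        Polynomial.C (1 / 2) * ((q - prescribedResidue T z) +
          (q.map (starRingEnd ℂ) - prescribedResidue T z)) -
          m.map (algebraMap ℝ ℂ) * (r /ₘ m).map (algebraMap ℝ ℂ) := by
      have h2 := congrArg (Polynomial.map (algebraMap ℝ ℂ)) (Polynomial.modByMonic_add_div r m)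
      rw [Polynomial.map_add, Polynomial.map_mul, hrc] at h2
      have h3 : (Polynomial.C (1 / 2) : ℂ[X]) * 2 = 1 := by
        rw [← Polynomial.C_ofNat, ← Polynomial.C_mul]; norm_num
      linear_combination h2 + prescribedResidue T z * h3
    rw [h1]
    exact dvd_sub (((dvd_add (hq z hz) (hq' z hz))).mul_left _)
      ((Polynomial.pow_rootMultiplicity_dvd _ _).mul_right _)
  exact ⟨r %ₘ m, ⟨Polynomial.degree_modByMonic_lt _ hmon, hmain⟩, fun p hp => 
    hp.unique ⟨Polynomial.degree_modByMonic_lt _ hmon, hmain⟩⟩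

end Existence

/-- The polynomial `p_T`. -/
def topPolynomial [FiniteDimensional ℝ V] (T : V →ₗ[ℝ] V) : ℝ[X] :=
  (existsUnique_isTopPolynomial T).choose

open Classical in
/-- The image of `p_T(T)` if `ρ(T) > 1`, and `0` otherwise. -/
def maxExpanding [FiniteDimensional ℝ V] (T : V →ₗ[ℝ] V) : Submodule ℝ V :=
  if specRadius T ≤ 1 then ⊥ else LinearMap.range (Polynomial.aeval T (topPolynomial T))

end LinearAlgebra

section HomogeneousSpace

variable {E : Type*} [NormedAddCommGroup E] [NormedSpace ℝ E]
  {G : Type*} [TopologicalSpace G] [ChartedSpace E G] [Group G]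

variable (E) in
theorem isLocalHomeomorph_mk [LieGroup 𝓘(ℝ, E) ∞ G] (Γ : Subgroup G) [DiscreteTopology Γ] :
    IsLocalHomeomorph (QuotientGroup.mk : G → G ⧸ Γ) := by
  have := topologicalGroup_of_lieGroup 𝓘(ℝ, E) ∞ (G := G)
  exact (Γ.isQuotientCoveringMap
    (isDiscrete_iff_discreteTopology.2 inferInstance)).isCoveringMap.isLocalHomeomorph

/-- The charts of `G ⧸ Γ` are the charts of `G` composed with local inverses of the projection
`G → G ⧸ Γ`. -/
instance chartedSpaceQuotient [LieGroup 𝓘(ℝ, E) ∞ G] (Γ : Subgroup G) [DiscreteTopology Γ] :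
    ChartedSpace E (G ⧸ Γ) :=
  (isLocalHomeomorph_mk E Γ).chartedSpace QuotientGroup.mk_surjective

theorem localInverse_eventuallyEq [LieGroup 𝓘(ℝ, E) ∞ G] (Γ : Subgroup G) [DiscreteTopology Γ]
    (b a : G) (hb : (a : G ⧸ Γ) ∈ ((isLocalHomeomorph_mk E Γ).localInverseAt b).source) :
    ∃ γ : G, ∀ᶠ y : G in 𝓝 a, (isLocalHomeomorph_mk E Γ).localInverseAt b (y : G ⧸ Γ) = y * γ := by
  have := topologicalGroup_of_lieGroup 𝓘(ℝ, E) ∞ (G := G)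
  set hf := isLocalHomeomorph_mk E Γ
  have h1 := hf.apply_localInverseAt_of_mem hb
  rw [eq_comm, QuotientGroup.eq] at h1
  refine ⟨a⁻¹ * hf.localInverseAt b (a : G ⧸ Γ), ?_⟩
  have h2 : ∀ᶠ y in 𝓝 a, y * (a⁻¹ * hf.localInverseAt b (a : G ⧸ Γ)) ∈
      (hf.localInverseAt b).target := by
    apply (continuous_mul_const _).continuousAt.eventually_mem
    rw [mul_inv_cancel_left]
    exact (hf.localInverseAt b).open_target.mem_nhds ((hf.localInverseAt b).map_source hb)
  filter_upwards [h2] with y hy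
  have h3 := (hf.localInverseAt b).right_inv hy
  rw [hf.localInverseAt_symm, QuotientGroup.mk_mul_of_mem _ h1] at h3
  exact h3

/-- The transition maps of these charts are smooth. -/
instance isManifoldQuotient [LieGroup 𝓘(ℝ, E) ∞ G] (Γ : Subgroup G) [DiscreteTopology Γ] :
    IsManifold 𝓘(ℝ, E) ∞ (G ⧸ Γ) := by
  apply isManifold_of_contDiffOn
  rintro _ _ ⟨p, rfl⟩ ⟨q, rfl⟩ u hu
  set hf := isLocalHomeomorph_mk E Γ
  set c : G ⧸ Γ → G := (QuotientGroup.mk_surjective (s := Γ)).hasRightInverse.choose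
  obtain ⟨⟨hu1, hu2⟩, hu3, hu4⟩ := hu.1
  set s := hf.localInverseAt (c p)
  set s' := hf.localInverseAt (c q)
  set φ := chartAt E (c p)
  set φ' := chartAt E (c q)
  have hs (y : G) : s.symm y = (y : G ⧸ Γ) := congrFun (hf.localInverseAt_symm (c p)) y
  replace hu1 : u ∈ φ.target := hu1
  replace hu3 : s.symm (φ.symm u) ∈ s'.source := hu3
  replace hu4 : s' (s.symm (φ.symm u)) ∈ φ'.source := hu4
  rw [hs] at hu3 hu4
  obtain ⟨γ, hγ⟩ := localInverse_eventuallyEq (E := E) Γ (c q) (φ.symm u) hu3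
  have hcont : ContinuousAt φ.symm u := φ.continuousAt_symm hu1
  have hev : (fun v => φ' (s' (s.symm (φ.symm v)))) =ᶠ[𝓝 u] fun v => φ' (φ.symm v * γ) := by
    filter_upwards [hcont.eventually hγ] with v hv
    rw [hs]
    exact congrArg φ' hv
  have hγu : φ.symm u * γ ∈ φ'.source := by
    rw [← hγ.self_of_nhds]
    exact hu4
  have hsm : ContMDiffAt 𝓘(ℝ, E) 𝓘(ℝ, E) ∞ (fun v => φ' (φ.symm v * γ)) u := by
    have h1 : ContMDiffAt 𝓘(ℝ, E) 𝓘(ℝ, E) ∞ φ.symm u :=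
      (contMDiffOn_chart_symm (x := c p)).contMDiffAt (φ.open_target.mem_nhds hu1)
    have h2 : ContMDiffAt 𝓘(ℝ, E) 𝓘(ℝ, E) ∞ φ' (φ.symm u * γ) :=
      (contMDiffOn_chart (x := c q)).contMDiffAt (φ'.open_source.mem_nhds hγu)
    exact h2.comp u ((contMDiffAt_mul_right (a := γ)).comp u h1)
  exact (contMDiffAt_iff_contDiffAt.1 (hsm.congr_of_eventuallyEq hev)).contDiffWithinAt

/-- The tangent spaces of `G` are finite-dimensional. -/
instance finiteDimensional_groupLieAlgebra [FiniteDimensional ℝ E] :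
    FiniteDimensional ℝ (GroupLieAlgebra 𝓘(ℝ, E) G) :=
  inferInstanceAs (FiniteDimensional ℝ E)

/-- The adjoint representation: `Ad a` is the derivative at `1` of `h ↦ a * h * a⁻¹`. -/
def Ad (a : G) : GroupLieAlgebra 𝓘(ℝ, E) G →ₗ[ℝ] GroupLieAlgebra 𝓘(ℝ, E) G :=
  let A : GroupLieAlgebra 𝓘(ℝ, E) G →L[ℝ] GroupLieAlgebra 𝓘(ℝ, E) G :=
    mfderiv 𝓘(ℝ, E) 𝓘(ℝ, E) (fun h : G => a * h * a⁻¹) 1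
  A.toLinearMap

variable (E) in
/-- The Lie algebra of the maximally expanding horospherical subgroup `G_a^max` of `G` relative to
`a`. The group itself is the connected Lie subgroup of `G` with this Lie algebra. -/
def maxHorosphericalLieAlgebra [FiniteDimensional ℝ E] (a : G) :
    Submodule ℝ (GroupLieAlgebra 𝓘(ℝ, E) G) :=
  maxExpanding (Ad a)

variable (E) in
/-- The Lie algebra of the one-parameter subgroup `{g t : t ∈ ℝ}`, the line (or `0`) spanned by the
velocity of `g` at `0`, where `g 0 = 1`. -/
def flowLieAlgebra (g : ℝ → G) : Submodule ℝ (GroupLieAlgebra 𝓘(ℝ, E) G) :=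
  let A : ℝ →L[ℝ] GroupLieAlgebra 𝓘(ℝ, E) G := mfderiv 𝓘(ℝ, ℝ) 𝓘(ℝ, E) g 0
  LinearMap.range A.toLinearMap

variable [LieGroup 𝓘(ℝ, E) ∞ G] {Γ : Subgroup G} [DiscreteTopology Γ]

/-- The tangent space `T_z(Hz)` at `z` of the orbit `Hz` of a Lie subgroup `H` of `G` with Lie
algebra `𝔥`: the image of `𝔥` under the derivative at `1` of the orbit map `h ↦ h • z`. -/
def orbitTangentSpace (𝔥 : Submodule ℝ (GroupLieAlgebra 𝓘(ℝ, E) G)) (z : G ⧸ Γ) :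
    Submodule ℝ (TangentSpace 𝓘(ℝ, E) z) :=
  let A : GroupLieAlgebra 𝓘(ℝ, E) G →L[ℝ] TangentSpace 𝓘(ℝ, E) z :=
    mfderiv 𝓘(ℝ, E) 𝓘(ℝ, E) (fun h : G => h • z) 1
  𝔥.map A.toLinearMap

/-- Let `F`, `H` be Lie subgroups of `G` with Lie algebras `𝔣`, `𝔥`, and let `Z` be the submanifold
of `G ⧸ Γ` that is the image of an embedding `ι : N → G ⧸ Γ`, so that the tangent space of `Z` at
`ι y` is the range of the derivative of `ι` at `y`. Then `Z` is `(F, H)`-transversal if, at each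
point `z` of `Z`, `T_z(Fz)` is not contained in `T_z Z`, and `T_z(Hz)` is not contained in
`T_z Z + T_z(Fz)`. -/
structure IsTransversal {E' : Type*} [NormedAddCommGroup E'] [NormedSpace ℝ E']
    {N : Type*} [TopologicalSpace N] [ChartedSpace E' N]
    (𝔣 𝔥 : Submodule ℝ (GroupLieAlgebra 𝓘(ℝ, E) G)) (ι : N → G ⧸ Γ) : Prop where
  left (y : N) : ¬ orbitTangentSpace 𝔣 (ι y) ≤
    LinearMap.range (mfderiv 𝓘(ℝ, E') 𝓘(ℝ, E) ι y).toLinearMap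
  right (y : N) : ¬ orbitTangentSpace 𝔥 (ι y) ≤
    LinearMap.range (mfderiv 𝓘(ℝ, E') 𝓘(ℝ, E) ι y).toLinearMap ⊔ orbitTangentSpace 𝔣 (ι y)

/-- `E(F⁺, Z)`: the points `x` such that the closure of `{g t • x : t ≥ 0}` misses `Z`. -/
def exceptionalSet (g : ℝ → G) (Z : Set (G ⧸ Γ)) : Set (G ⧸ Γ) :=
  {x | closure ((fun t : ℝ => g t • x) '' Set.Ici 0) ∩ Z = ∅}

end HomogeneousSpace

end

end NondenseOrbits

open NondenseOrbits

/-! Transversality at a point z of Z yields a functional μ that kills T_zZ and T_z(Fz) but not the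
maximally expanded directions (`IsTransversal.exists_functional`). Since the flow is not tangent to
Z, the translates of Z under short flow times sweep out an immersed submanifold near z. It lies in a
set f = 0 with df = μ at z (`exists_flow_invariant_function`).

Write T = Ad g_1. As μ, pulled back to the Lie algebra, does not vanish on Im p_T(T), its
compositions with T^n grow at the same rate ρ^n (n+1)^(s-1) that bounds ‖T^n‖ (`exists_norm_pow_le`,
`exists_le_norm_comp_pow`). The iterates of conjugation by g_1 differ from T^n only by a quadratic
error (`exists_iterate_bound`). So in a ball whose radius times that rate lies in a fixed small
window, the points carried by g_1^n to the vicinity of the hypersurface fill only a slab that is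
thin compared with the ball (`isShrinkHAWOn_eventually_avoid`).

Such families of slabs can be avoided in the game (`exists_isShrinkHAWOn_of_slabs`). At each scale
only boundedly many n matter. By pigeonhole over a net of slabs, one hyperplane neighborhood absorbs
a fixed proportion of them, so a fixed number k of turns removes them all. The number of slabs in a
window grows linearly in k while the surviving proportion decays exponentially.

The passage to continuous time is `notMem_closure_of_eventually_avoid`. If z is in the closure of
the forward orbit of x, rounding times up to integers and shifting by a rational q makes points
g_1^n g_{-q} x approach a point g_s z with s small, at which f = 0. Unbounded times contradict
eventual avoidance. Bounded times would put some g_1^n g_{-q} x on the hypersurface itself, which is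
excluded by winning against a single hypersurface (`isShrinkHAWOn_compl_hypersurface`). Only
countably many charts, rationals and integers enter, so stability under countable intersection
(`IsShrinkHAWOn.iInter`) concludes. -/

namespace NondenseOrbits

open Set Filter Metric

/-! ### The hyperplane absolute game: shrinking plays, countable intersections, locality. -/

section Game

variable {V : Type*} [NormedAddCommGroup V] [InnerProductSpace ℝ V]

/-- The hyperplane `{x | ⟪e, x⟫ = t}`, for a unit vector `e`. -/
noncomputable def normalHyperplane (e : V) (t : ℝ) : AffineSubspace ℝ V :=
  AffineSubspace.mk' (t • e) (ℝ ∙ e)ᗮ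

theorem isAffineHyperplane_normalHyperplane [FiniteDimensional ℝ V] {e : V} (he : ‖e‖ = 1)
    (t : ℝ) : IsAffineHyperplane (normalHyperplane e t) := by
  refine ⟨AffineSubspace.mk'_nonempty _ _, ?_⟩
  rw [normalHyperplane, AffineSubspace.direction_mk', add_comm,
    ← Submodule.finrank_add_finrank_orthogonal (ℝ ∙ e),
    finrank_span_singleton (by rintro rfl; simp at he)]

theorem mem_thickening_normalHyperplane {e : V} (he : ‖e‖ = 1) {t δ : ℝ} {x : V}
    (h : |inner ℝ e x - t| < δ) : x ∈ thickening δ (normalHyperplane e t : Set V) := by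
  have hee : inner ℝ e e = (1 : ℝ) := by rw [real_inner_self_eq_norm_sq, he]; norm_num
  refine mem_thickening_iff.2 ⟨x - (inner ℝ e x - t) • e, ?_, ?_⟩
  · rw [SetLike.mem_coe, normalHyperplane, AffineSubspace.mem_mk',
      Submodule.mem_orthogonal_singleton_iff_inner_right, vsub_eq_sub, inner_sub_right,
      inner_sub_right, inner_smul_right, inner_smul_right, hee]
    ring
  · rw [dist_eq_norm, sub_sub_cancel, norm_smul, he, mul_one]
    exact h

theorem exists_normal [FiniteDimensional ℝ V] {L : AffineSubspace ℝ V}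
    (hL : IsAffineHyperplane L) :
    ∃ e : V, ‖e‖ = 1 ∧ ∃ t : ℝ, ∀ x ∈ L, inner ℝ e x = t := by
  obtain ⟨⟨p, hp⟩, hd⟩ := hL
  have hne : L.directionᗮ ≠ ⊥ := by
    intro h
    have := Submodule.finrank_add_finrank_orthogonal L.direction
    rw [h, finrank_bot] at this
    omega
  obtain ⟨v, hv, hv0⟩ := Submodule.exists_mem_ne_zero_of_ne_bot hne
  refine ⟨(‖v‖⁻¹ : ℝ) • v, by rw [norm_smul, norm_inv, norm_norm, inv_mul_cancel₀ (by simpa)],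
    inner ℝ ((‖v‖⁻¹ : ℝ) • v) p, fun x hx => ?_⟩
  have h1 : inner ℝ v (x - p) = (0 : ℝ) := by
    rw [real_inner_comm]
    exact (Submodule.mem_orthogonal _ _).1 hv _ (AffineSubspace.vsub_mem_direction hx hp)
  rw [inner_smul_left, inner_smul_left, ← sub_eq_zero, ← mul_sub, ← inner_sub_right, h1, mul_zero]

/-- Bob can always answer with a ball of the smallest allowed radius. -/
theorem exists_reply [FiniteDimensional ℝ V] {β r r' : ℝ} (hβ' : β < 1 / 3) (hr : 0 < r)
    (hr' : r' ≤ β * r) {L : AffineSubspace ℝ V} (hL : IsAffineHyperplane L) (c : V) :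
    ∃ c' : V, closedBall c' (β * r) ⊆ closedBall c r \ thickening r' (L : Set V) := by
  obtain ⟨e, he, t, ht⟩ := exists_normal hL
  have hee : inner ℝ e e = (1 : ℝ) := by rw [real_inner_self_eq_norm_sq, he]; norm_num
  -- Bob shifts the centre along the normal, away from the hyperplane, as far as the ball allows.
  -- The new ball keeps distance at least (1 - 2β) r from it, which exceeds β r because β < 1/3.
  obtain ⟨s, hs, hst⟩ : ∃ s : ℝ, |s| = (1 - β) * r ∧ (1 - β) * r ≤ |inner ℝ e (c + s • e) - t| := by
    have h0 : 0 ≤ (1 - β) * r := by nlinarith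
    rcases le_total 0 (inner ℝ e c - t) with h | h
    · refine ⟨(1 - β) * r, abs_of_nonneg h0, ?_⟩
      rw [inner_add_right, inner_smul_right, hee]
      exact le_trans (by linarith) (le_abs_self _)
    · refine ⟨-((1 - β) * r), by rw [abs_neg, abs_of_nonneg h0], ?_⟩
      rw [inner_add_right, inner_smul_right, hee]
      exact le_trans (by linarith) (neg_le_abs _)
  refine ⟨c + s • e, fun x hx => ⟨?_, fun hxt => ?_⟩⟩
  · rw [mem_closedBall] at hx ⊢
    have h1 : dist (c + s • e) c = (1 - β) * r := by
      rw [dist_eq_norm, add_sub_cancel_left, norm_smul, he, mul_one, Real.norm_eq_abs, hs]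
    have := dist_triangle x (c + s • e) c
    rw [h1] at this
    linarith
  · obtain ⟨z, hz, hxz⟩ := mem_thickening_iff.1 hxt
    rw [mem_closedBall] at hx
    have h1 : |inner ℝ e (c + s • e) - t| ≤ dist (c + s • e) z := by
      rw [← ht z hz, ← inner_sub_right, dist_eq_norm]
      simpa [he] using abs_real_inner_le_norm e (c + s • e - z)
    have h2 := dist_triangle (c + s • e) x z
    rw [dist_comm (c + s • e) x] at h2
    nlinarith

/-- Test the inclusion on the point of the inner ball farthest out in the direction from `c` to
`c'`. Nontriviality supplies a direction when the centres coincide; in the zero space radii are not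
determined by balls. -/
theorem dist_le_of_closedBall_subset [Nontrivial V] {c c' : V} {r r' : ℝ} (hr' : 0 ≤ r')
    (h : closedBall c' r' ⊆ closedBall c r) : dist c' c ≤ r - r' := by
  obtain ⟨e, he, hce⟩ : ∃ e : V, ‖e‖ = 1 ∧ c' - c = dist c' c • e := by
    rcases eq_or_ne c' c with rfl | hne
    · obtain ⟨e, he⟩ := exists_norm_eq V (zero_le_one (α := ℝ))
      exact ⟨e, he, by simp⟩
    · have h0 : ‖c' - c‖ ≠ 0 := norm_ne_zero_iff.2 (sub_ne_zero.2 hne)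
      refine ⟨(‖c' - c‖⁻¹ : ℝ) • (c' - c), ?_, ?_⟩
      · rw [norm_smul, norm_inv, norm_norm, inv_mul_cancel₀ h0]
      · rw [dist_eq_norm, smul_smul, mul_inv_cancel₀ h0, one_smul]
  have h1 : c' + r' • e ∈ closedBall c r := h (by
    rw [mem_closedBall, dist_eq_norm, add_sub_cancel_left, norm_smul, he, mul_one,
      Real.norm_of_nonneg hr'])
  rw [mem_closedBall, dist_eq_norm, add_sub_right_comm, hce, ← add_smul, norm_smul, he, mul_one,
    Real.norm_of_nonneg (add_nonneg dist_nonneg hr')] at h1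
  linarith

namespace Strategy

section IsPlay

variable {σ : Strategy V} {β : ℝ} {U : Set V} {c : ℕ → V} {r : ℕ → ℝ}

theorem IsPlay.radius_pos (h : σ.IsPlay β U c r) (hβ : 0 < β) (i : ℕ) : 0 < r i := by
  induction i with
  | zero => exact h.1
  | succ i ih => exact (mul_pos hβ ih).trans_le (h.2.2 i).1

theorem IsPlay.pow_mul_le (h : σ.IsPlay β U c r) (hβ : 0 < β) (i j : ℕ) :
    β ^ j * r i ≤ r (i + j) := by
  induction j with
  | zero => simp
  | succ j ih =>
    refine le_trans ?_ (h.2.2 (i + j)).1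
    rw [pow_succ', mul_assoc]
    exact mul_le_mul_of_nonneg_left ih hβ.le

theorem IsPlay.antitone_ball (h : σ.IsPlay β U c r) :
    Antitone fun i => closedBall (c i) (r i) :=
  antitone_nat_of_succ_le fun i => (h.2.2 i).2.trans sdiff_subset

theorem IsPlay.ball_subset (h : σ.IsPlay β U c r) (i : ℕ) : closedBall (c i) (r i) ⊆ U :=
  (h.antitone_ball (Nat.zero_le i)).trans h.2.1

theorem IsPlay.antitone_radius [Nontrivial V] (h : σ.IsPlay β U c r) (hβ : 0 < β) :
    Antitone r := fun i j hij => by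
  have := dist_le_of_closedBall_subset (h.radius_pos hβ j).le (h.antitone_ball hij)
  have := dist_nonneg (x := c j) (y := c i)
  linarith

/-- A strategy given by a function of infinite sequences of balls. -/
def ofSeq (s : ℕ → (ℕ → V × ℝ) → AffineSubspace ℝ V × ℝ) : Strategy V :=
  -- The finite history is prolonged by repeating its last ball, so that strategies can be written
  -- with natural number indices.
  fun i B => s i fun m => B ⟨min m i, by omega⟩

end IsPlay

end Strategy

/-- The variant of `IsBetaHAWOn` in which only plays with radii tending to `0` are considered. -/
def IsShrinkHAWOn (β : ℝ) (S U : Set V) : Prop :=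
  ∃ σ : Strategy V, σ.IsLegal β ∧ ∀ (c : ℕ → V) (r : ℕ → ℝ), σ.IsPlay β U c r →
    Tendsto r atTop (𝓝 0) → ∀ x, (∀ i, x ∈ closedBall (c i) (r i)) → x ∈ S

theorem IsShrinkHAWOn.mono {β : ℝ} {S S' U : Set V} (h : IsShrinkHAWOn β S U) 
    (hS : ∀ x ∈ U, x ∈ S → x ∈ S') : IsShrinkHAWOn β S' U := by
  obtain ⟨σ, hσ, hw⟩ := h
  exact ⟨σ, hσ, fun c r hp hr x hx => hS x (hp.2.1 (hx 0)) (hw c r hp hr x hx)⟩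

/-- Recursion in which each term depends on the whole past. It is used to let Bob answer a given
strategy of Alice forever; `good` is the invariant (positive radius) under which an answer exists.
-/
theorem exists_seq_of_history {α : Type*} (good : α → Prop)
    (P : (i : ℕ) → (Fin (i + 1) → α) → α → Prop)
    (h : ∀ i B, good (B (Fin.last i)) → ∃ b, good b ∧ P i B b) (a : α) (ha : good a) :
    ∃ f : ℕ → α, f 0 = a ∧ ∀ i, P i (fun j => f j) (f (i + 1)) := by
  have h' : ∀ i (B : Fin (i + 1) → α), ∃ b, good (B (Fin.last i)) → good b ∧ P i B b := fun i B => by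
    by_cases hg : good (B (Fin.last i))
    · obtain ⟨b, hb⟩ := h i B hg
      exact ⟨b, fun _ => hb⟩
    · exact ⟨a, fun hh => absurd hh hg⟩
  choose N hN using h'
  -- Stage `i` is a full sequence of which only the entries up to `i` are final; the result is the
  -- diagonal.
  let H : ℕ → ℕ → α := fun i => Nat.rec (fun _ => a)
    (fun i Hi => Function.update Hi (i + 1) (N i fun j => Hi j)) i
  have hH : ∀ i, H (i + 1) = Function.update (H i) (i + 1) (N i fun j => H i j) := fun i => rfl
  have hst : ∀ m i, m ≤ i → H i m = H m m := by
    intro m i hmi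
    induction i, hmi using Nat.le_induction with
    | base => rfl
    | succ i hi ih => rw [hH, Function.update_of_ne (by omega), ih]
  have hrec : ∀ i, H (i + 1) (i + 1) = N i fun j => H j j := fun i => by
    rw [hH, Function.update_self]
    congr 1
    funext j
    exact hst _ _ (by omega)
  have hgood : ∀ i, good (H i i) := fun i => by
    induction i with
    | zero => exact ha
    | succ i ih => rw [hrec]; exact (hN i _ (by simpa using ih)).1
  refine ⟨fun i => H i i, rfl, fun i => ?_⟩
  simp only [hrec]
  exact (hN i _ (by simpa using hgood i)).2

/-- If the radii have a positive limit ρ, all of Bob's balls contain a common ball of radius ρ. Let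
a fictitious Bob start there and always reply with the smallest legal radius. This play shrinks, so
the winning strategy places a point of `S` in the common ball, hence in every ball of the original
play. -/
theorem IsShrinkHAWOn.isBetaHAWOn [FiniteDimensional ℝ V] [Nontrivial V] {β : ℝ} {S U : Set V}
    (h : IsShrinkHAWOn β S U) (hβ : 0 < β) (hβ' : β < 1 / 3) : IsBetaHAWOn β S U := by
  obtain ⟨σ, hσ, hw⟩ := h
  refine ⟨σ, hσ, fun c r hp => ?_⟩
  have hanti := hp.antitone_radius hβ
  have hbdd : BddBelow (range r) := ⟨0, by rintro _ ⟨i, rfl⟩; exact (hp.radius_pos hβ i).le⟩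
  have hlim := tendsto_atTop_ciInf hanti hbdd
  have hle : ∀ i, (⨅ i, r i) ≤ r i := fun i => ciInf_le hbdd i
  have hnn : 0 ≤ ⨅ i, r i := le_ciInf fun i => (hp.radius_pos hβ i).le
  set ρ := ⨅ i, r i
  obtain ⟨p, hpm⟩ : (⋂ i, closedBall (c i) (r i - ρ)).Nonempty := by
    refine IsCompact.nonempty_iInter_of_sequence_nonempty_isCompact_isClosed _ (fun i => ?_)
      (fun i => nonempty_closedBall.2 (sub_nonneg.2 (hle i))) (isCompact_closedBall _ _)
      fun i => isClosed_closedBall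
    refine closedBall_subset_closedBall' ?_
    have := dist_le_of_closedBall_subset (hp.radius_pos hβ (i + 1)).le
      (hp.antitone_ball (Nat.le_succ i))
    linarith
  rw [mem_iInter] at hpm
  have hsub : ∀ i, closedBall p ρ ⊆ closedBall (c i) (r i) := fun i => by
    refine closedBall_subset_closedBall' ?_
    have := mem_closedBall.1 (hpm i)
    linarith
  rcases hnn.eq_or_lt with h0 | h0
  · have hmem : ∀ i, p ∈ closedBall (c i) (r i) := fun i => hsub i (mem_closedBall_self hnn)
    exact ⟨p, mem_iInter.2 hmem, hw c r hp (by rwa [← h0] at hlim) p hmem⟩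
  · obtain ⟨f, hf0, hf⟩ := exists_seq_of_history (fun b : V × ℝ => 0 < b.2)
      (fun i B b => b.2 = β * (B (Fin.last i)).2 ∧ closedBall b.1 b.2 ⊆
        closedBall (B (Fin.last i)).1 (B (Fin.last i)).2 \
          thickening (σ i B).2 ((σ i B).1 : Set V))
      (fun i B hB => by
        obtain ⟨c', hc'⟩ := exists_reply hβ' hB (hσ i B hB).2.2 (hσ i B hB).1 (B (Fin.last i)).1
        exact ⟨(c', β * (B (Fin.last i)).2), mul_pos hβ hB, rfl, hc'⟩) (p, ρ) h0
    have hplay : σ.IsPlay β U (fun i => (f i).1) fun i => (f i).2 := by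
      refine ⟨by simpa [hf0] using h0, ?_, fun i => ⟨(hf i).1.ge, (hf i).2⟩⟩
      simp only [hf0]
      exact (hsub 0).trans hp.2.1
    have hrad : ∀ i, (f i).2 = β ^ i * ρ := fun i => by
      induction i with
      | zero => simp [hf0]
      | succ i ih =>
        rw [(hf i).1]
        simp only [Fin.val_last]
        rw [ih, pow_succ']
        ring
    have hten : Tendsto (fun i => (f i).2) atTop (𝓝 0) := by
      simp only [hrad]
      simpa using (tendsto_pow_atTop_nhds_zero_of_lt_one hβ.le (by linarith)).mul_const ρ
    obtain ⟨q, hq⟩ : (⋂ i, closedBall (f i).1 (f i).2).Nonempty :=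
      IsCompact.nonempty_iInter_of_sequence_nonempty_isCompact_isClosed _
        (fun i => hplay.antitone_ball (Nat.le_succ i))
        (fun i => nonempty_closedBall.2 (hplay.radius_pos hβ i).le) (isCompact_closedBall _ _)
        fun i => isClosed_closedBall
    rw [mem_iInter] at hq
    refine ⟨q, mem_iInter.2 fun i => hsub i ?_, hw _ _ hplay hten q hq⟩
    simpa [hf0] using hq 0

/-- Countable intersections. -/
theorem IsShrinkHAWOn.iInter {U : Set V} {S : ℕ → Set V}
    (h : ∀ j, ∀ β : ℝ, 0 < β → β < 1 / 3 → IsShrinkHAWOn β (S j) U) {β : ℝ} (hβ : 0 < β)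
    (hβ' : β < 1 / 3) : IsShrinkHAWOn β (⋂ j, S j) U := by
  have hb : ∀ n, β ^ (n + 1) ≤ β := fun n => by
    rw [pow_succ']
    exact mul_le_of_le_one_right hβ.le (pow_le_one₀ hβ.le (by linarith))
  have hpow : ∀ j, β ^ 2 ^ (j + 1) ≤ β := fun j => by
    obtain ⟨n, hn⟩ := Nat.exists_eq_succ_of_ne_zero (n := 2 ^ (j + 1)) (by positivity)
    rw [hn]; exact hb n
  -- The j-th subgame uses every 2^(j+1)-th turn, so between its turns the radius may shrink by
  -- β^(2^(j+1)).
  choose σ hσ hw using fun j => h j (β ^ 2 ^ (j + 1)) (by positivity) ((hpow j).trans_lt hβ')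
  -- Turn `i` belongs to the subgame given by the 2-adic valuation of `i + 1`; `l i` is its position
  -- there, and `idx` is the inverse enumeration.
  let v : ℕ → ℕ := fun i => padicValNat 2 (i + 1)
  let l : ℕ → ℕ := fun i => (i + 1) / 2 ^ (v i + 1)
  let idx : ℕ → ℕ → ℕ := fun j m => 2 ^ j * (2 * m + 1) - 1
  have hidx1 : ∀ j m, idx j m + 1 = 2 ^ j * (2 * m + 1) := fun j m =>
    Nat.sub_add_cancel (Nat.mul_pos (by positivity) (by omega))
  have hv : ∀ j m, v (idx j m) = j := fun j m => by
    simp only [v, hidx1]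
    rw [padicValNat.mul (by positivity) (by omega), padicValNat.prime_pow,
      padicValNat.eq_zero_of_not_dvd (by omega), add_zero]
  have hl : ∀ j m, l (idx j m) = m := fun j m => by
    simp only [l, hv, hidx1, pow_succ]
    rw [Nat.mul_div_mul_left _ _ (by positivity)]
    omega
  have hidx : ∀ i, idx (v i) (l i) = i := fun i => by
    have h1 : i + 1 ≠ 0 := by omega
    obtain ⟨k, hk⟩ := pow_padicValNat_dvd (p := 2) (n := i + 1)
    have hodd : ¬ 2 ∣ k := fun ⟨q, hq⟩ => by
      apply pow_succ_padicValNat_not_dvd (p := 2) h1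
      exact ⟨q, by rw [pow_succ, mul_assoc, ← hq]; exact hk⟩
    have h2 : k = 2 * (k / 2) + 1 := by omega
    have h3 : i = idx (v i) (k / 2) := by
      have h4 := hidx1 (v i) (k / 2)
      rw [← h2, ← hk] at h4
      omega
    have h5 : l i = k / 2 := by
      have := hl (v i) (k / 2)
      rwa [← h3] at this
    rw [h5, ← h3]
  have hmono : ∀ j, Monotone (idx j) := fun j m m' hm =>
    Nat.sub_le_sub_right (Nat.mul_le_mul_left _ (by omega)) _
  have hstep : ∀ j m, idx j (m + 1) = idx j m + 2 ^ (j + 1) := fun j m => by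
    have h1 := hidx1 j (m + 1)
    have h2 := hidx1 j m
    have : 2 ^ j * (2 * (m + 1) + 1) = 2 ^ j * (2 * m + 1) + 2 ^ (j + 1) := by ring
    omega
  let s : ℕ → (ℕ → V × ℝ) → AffineSubspace ℝ V × ℝ := fun i b =>
    σ (v i) (l i) fun m => b (idx (v i) m)
  refine ⟨Strategy.ofSeq s, fun i B hB => ?_, fun c r hp hr x hx => mem_iInter.2 fun j => ?_⟩
  · have hlast : (fun m : Fin (l i + 1) => B ⟨min (idx (v i) m) i, by omega⟩) (Fin.last (l i)) =
        B (Fin.last i) := by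
      simp only [Fin.val_last, hidx, min_self]
      rfl
    obtain ⟨h1, h2, h3⟩ := hσ (v i) (l i)
      (fun m => B ⟨min (idx (v i) m) i, by omega⟩) (hlast ▸ hB)
    exact ⟨h1, h2, (h3.trans_eq (congrArg (fun b : V × ℝ => _ * b.2) hlast)).trans
      (mul_le_mul_of_nonneg_right (hpow _) hB.le)⟩
  · refine hw j (fun m => c (idx j m)) (fun m => r (idx j m)) ⟨hp.radius_pos hβ _,
      hp.ball_subset _, fun m => ⟨?_, ?_⟩⟩ (hr.comp ?_) x fun m => hx _
    · simp only [hstep]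
      exact hp.pow_mul_le hβ _ _
    -- The next ball of the subgame is contained in Bob's immediate reply, which already avoids
    -- Alice's neighborhood.
    · have h1 : closedBall (c (idx j (m + 1))) (r (idx j (m + 1))) ⊆
          closedBall (c (idx j m + 1)) (r (idx j m + 1)) := by
        rw [hstep]
        exact hp.antitone_ball (Nat.add_le_add_left Nat.one_le_two_pow _)
      refine h1.trans ((hp.2.2 (idx j m)).2.trans (le_of_eq ?_))
      have h2 : ∀ j' m', j' = j → m' = m → (σ j' m' fun q : Fin (m' + 1) =>
          (c (min (idx j' q) (idx j m)), r (min (idx j' q) (idx j m)))) =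
          σ j m fun q => (c (idx j q), r (idx j q)) := by
        rintro _ _ rfl rfl
        congr 1
        funext q
        rw [min_eq_left (hmono _ (by omega))]
      have h3 : (Strategy.ofSeq s (idx j m) fun q => (c q, r q)) =
          σ j m fun q => (c (idx j q), r (idx j q)) := h2 _ _ (hv j m) (hl j m)
      rw [h3]
    · refine tendsto_atTop_mono (fun m => ?_) tendsto_id
      have h1 := hidx1 j m
      have h2 : 2 * m + 1 ≤ 2 ^ j * (2 * m + 1) := Nat.le_mul_of_pos_left _ (by positivity)
      simp only [id]
      omega

/-- Being winning is a local property. -/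
theorem IsShrinkHAWOn.of_local [FiniteDimensional ℝ V] [Nontrivial V] {β : ℝ} {S U : Set V}
    (hβ : 0 < β) (h : ∀ u ∈ U, ∃ O ∈ 𝓝 u, IsShrinkHAWOn β S O) : IsShrinkHAWOn β S U := by
  classical
  choose! O hO σ hσ hw using h
  obtain ⟨e, he⟩ := exists_norm_eq V (zero_le_one (α := ℝ))
  let P : V × ℝ → V → Prop := fun b u => u ∈ U ∧ closedBall b.1 b.2 ⊆ O u
  -- Alice makes dummy moves until the first ball that fits into some `O u`, then starts the local
  -- strategy there. The infimum of the empty set is 0, so the condition tests whether such a ball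
  -- has occurred.
  let s : ℕ → (ℕ → V × ℝ) → AffineSubspace ℝ V × ℝ := fun i b =>
    if hb : ∃ u, P (b (sInf {m | ∃ u, P (b m) u})) u then
      σ hb.choose (i - sInf {m | ∃ u, P (b m) u}) fun m => b (sInf {m | ∃ u, P (b m) u} + m)
    else (normalHyperplane e 0, β * (b i).2)
  refine ⟨Strategy.ofSeq s, fun i B hB => ?_, fun c r hp hr x hx => ?_⟩
  · set b : ℕ → V × ℝ := fun m => B ⟨min m i, by omega⟩ with hbdef
    have hlast : ∀ m, i ≤ m → b m = B (Fin.last i) := fun m hm => by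
      simp only [hbdef, min_eq_right hm]
      rfl
    change IsAffineHyperplane (s i b).1 ∧ 0 < (s i b).2 ∧ (s i b).2 ≤ β * (B (Fin.last i)).2
    by_cases hb : ∃ u, P (b (sInf {m | ∃ u, P (b m) u})) u
    · simp only [s, dif_pos hb]
      have hl := hlast (sInf {m | ∃ u, P (b m) u} + (i - sInf {m | ∃ u, P (b m) u})) (by omega)
      have := hσ hb.choose hb.choose_spec.1 (i - sInf {m | ∃ u, P (b m) u})
        (fun m => b (sInf {m | ∃ u, P (b m) u} + m)) (by simpa [hl] using hB)
      simpa [hl] using this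
    · simp only [s, dif_neg hb, hlast i le_rfl]
      exact ⟨isAffineHyperplane_normalHyperplane he _, mul_pos hβ hB, le_rfl⟩
  · have hxU : x ∈ U := hp.2.1 (hx 0)
    have hex : ∃ m, ∃ u, P (c m, r m) u := by
      obtain ⟨ε, hε, hεO⟩ := Metric.mem_nhds_iff.1 (hO x hxU)
      obtain ⟨m, hm⟩ := (hr.eventually (gt_mem_nhds (half_pos hε))).exists
      refine ⟨m, x, hxU, fun y hy => hεO ?_⟩
      rw [mem_closedBall] at hy
      have h1 := mem_closedBall'.1 (hx m)
      have := dist_triangle y (c m) x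
      rw [mem_ball]
      linarith
    set i₀ := sInf {m | ∃ u, P (c m, r m) u} with hi₀
    have hP : ∃ u, P (c i₀, r i₀) u := Nat.sInf_mem (s := {m | ∃ u, P (c m, r m) u}) hex
    -- From turn `i₀` on, the truncated history already reveals the correct starting turn.
    have hfirst : ∀ i, i₀ ≤ i → sInf {m | ∃ u, P (c (min m i), r (min m i)) u} = i₀ := by
      intro i hi
      apply le_antisymm
      · apply Nat.sInf_le
        simpa only [mem_ofPred_eq, min_eq_left hi] using hP
      · have h1 : ∃ u, P (c (min (sInf {m | ∃ u, P (c (min m i), r (min m i)) u}) i),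
            r (min (sInf {m | ∃ u, P (c (min m i), r (min m i)) u}) i)) u :=
          Nat.sInf_mem (s := {m | ∃ u, P (c (min m i), r (min m i)) u})
            ⟨i₀, by simpa only [mem_ofPred_eq, min_eq_left hi] using hP⟩
        exact (Nat.sInf_le (s := {m | ∃ u, P (c m, r m) u}) h1).trans (min_le_left _ _)
    have hs : ∀ i, (Strategy.ofSeq s (i₀ + i) fun j => (c j, r j)) =
        σ hP.choose i fun j => (c (i₀ + j), r (i₀ + j)) := fun i => by
      have hf := hfirst (i₀ + i) (by omega)
      have key : ∀ i₁ i', i₁ = i₀ → i' = i₀ + i →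
          (if hb : ∃ u, P (c (min i₁ i'), r (min i₁ i')) u then
            σ hb.choose (i' - i₁) fun m => (c (min (i₁ + m) i'), r (min (i₁ + m) i'))
          else (normalHyperplane e 0, β * r (min i' i'))) =
          σ hP.choose i fun j => (c (i₀ + j), r (i₀ + j)) := by
        rintro i₁ i' h1 h2
        have h3 : min i₁ i' = i₀ := by omega
        simp only [h3]
        rw [dif_pos hP]
        obtain rfl : i = i' - i₁ := by omega
        congr 1
        funext m
        have : min (i₁ + (m : ℕ)) i' = i₀ + m := by omega
        simp only [this]
      exact key _ _ hf rfl
    refine hw hP.choose hP.choose_spec.1 (fun i => c (i₀ + i)) (fun i => r (i₀ + i))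
      ⟨hp.radius_pos hβ _, hP.choose_spec.2, fun i => ⟨(hp.2.2 _).1, ?_⟩⟩
      (hr.comp (tendsto_atTop_mono (fun i => Nat.le_add_left i i₀) tendsto_id)) x fun i => hx _
    rw [← hs i]
    exact (hp.2.2 (i₀ + i)).2

end Game

end NondenseOrbits


namespace NondenseOrbits

open Set Filter Metric

/-! ### Winning against families of thin slabs. -/

section Slabs

variable {V : Type*} [NormedAddCommGroup V] [InnerProductSpace ℝ V]

/-- Among finitely many thin slabs that meet a ball, a fixed proportion is swallowed by the
`β r`-neighborhood of one hyperplane. -/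
theorem exists_popular_slab [FiniteDimensional ℝ V] [Nontrivial V] {β : ℝ} (hβ : 0 < β)
    (hβ' : β < 1 / 3) : ∃ κ : ℝ, 0 ≤ κ ∧ κ < 1 ∧ ∀ (u : V) (r : ℝ), 0 < r →
      ∀ (I : Set ℕ), I.Finite → ∀ A : ℕ → Set V, (∀ n ∈ I, (A n).Nonempty ∧ A n ⊆ closedBall u r ∧
        ∃ e : V, ‖e‖ = 1 ∧ ∃ t : ℝ, ∀ x ∈ A n, |inner ℝ e x - t| ≤ β / 4 * r) →
      ∃ p : V × ℝ, ‖p.1‖ = 1 ∧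
        ((I ∩ {n | ∃ x ∈ A n, β * r ≤ |inner ℝ p.1 x - p.2|}).ncard : ℝ) ≤ κ * I.ncard := by
  classical
  obtain ⟨e₀, he₀⟩ := exists_norm_eq V (zero_le_one (α := ℝ))
  -- Normalized slabs: a unit normal and the offset from the centre in units of `r`. The offset is
  -- at most 1 + β/4 because the slab meets the ball.
  have hK : IsCompact (sphere (0 : V) 1 ×ˢ Icc (-2 : ℝ) 2) := (isCompact_sphere _ _).prod isCompact_Icc
  obtain ⟨F', hF'K, hF'fin, hF'⟩ := hK.finite_cover_balls (e := β / 8) (by positivity)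
  lift F' to Finset (V × ℝ) using hF'fin
  rename' F' => F
  have hFne : F.Nonempty := by
    have h0 : (e₀, (0 : ℝ)) ∈ sphere (0 : V) 1 ×ˢ Icc (-2 : ℝ) 2 := by
      simp [he₀]
    obtain ⟨y, hy, -⟩ := mem_iUnion₂.1 (hF' h0)
    exact ⟨y, hy⟩
  have hFpos : (0 : ℝ) < F.card := by exact_mod_cast hFne.card_pos
  have hF1 : (1 : ℝ) ≤ F.card := by exact_mod_cast hFne.card_pos
  refine ⟨1 - 1 / F.card, by rw [sub_nonneg, div_le_one hFpos]; exact hF1,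
    by linarith [one_div_pos.2 hFpos], fun u r hr I hI A hA => ?_⟩
  lift I to Finset ℕ using hI
  have hcls : ∀ n, ∃ y : V × ℝ, n ∈ I → y ∈ F ∧ ∀ x ∈ A n,
      |inner ℝ y.1 x - (inner ℝ y.1 u + y.2 * r)| < β * r := fun n => by
    by_cases hn : n ∈ I
    swap
    · exact ⟨(0, 0), fun h => absurd h hn⟩
    obtain ⟨⟨x₀, hx₀⟩, hsub, e, he, t, ht⟩ := hA n hn
    have hin : ∀ x ∈ A n, ∀ v : V, |inner ℝ v (x - u)| ≤ ‖v‖ * r := fun x hx v => by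
      refine (abs_real_inner_le_norm _ _).trans (mul_le_mul_of_nonneg_left ?_ (norm_nonneg _))
      rw [← dist_eq_norm]
      exact hsub hx
    set τ := (t - inner ℝ e u) / r with hτ
    have hτr : τ * r = t - inner ℝ e u := div_mul_cancel₀ _ hr.ne'
    have hmem : (e, τ) ∈ sphere (0 : V) 1 ×ˢ Icc (-2 : ℝ) 2 := by
      refine ⟨by simpa using he, ?_⟩
      have h1 := hin x₀ hx₀ e
      have h2 := ht x₀ hx₀
      rw [inner_sub_right, he, one_mul] at h1
      have h3 : |τ * r| ≤ 2 * r := by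
        rw [hτr]
        refine (abs_sub_le t (inner ℝ e x₀) (inner ℝ e u)).trans ?_
        rw [abs_sub_comm t]
        nlinarith
      rw [abs_mul, abs_of_pos hr] at h3
      exact abs_le.1 (le_of_mul_le_mul_right h3 hr)
    obtain ⟨y, hy, hyb⟩ := mem_iUnion₂.1 (hF' hmem)
    refine ⟨y, fun _ => ⟨hy, fun x hx => ?_⟩⟩
    rw [mem_ball, Prod.dist_eq, max_lt_iff, dist_eq_norm, Real.dist_eq] at hyb
    obtain ⟨hy1, hy2⟩ := hyb
    have h1 := ht x hx
    have h2 : |inner ℝ (e - y.1) (x - u)| ≤ β / 8 * r := (hin x hx _).trans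
      (mul_le_mul_of_nonneg_right hy1.le hr.le)
    have h3 : |(τ - y.2) * r| ≤ β / 8 * r := by
      rw [abs_mul, abs_of_pos hr]
      exact mul_le_mul_of_nonneg_right hy2.le hr.le
    -- The width of the slab contributes β/4, replacing its normal and its offset by the net point
    -- β/8 each; the sum β/2 is below β.
    have h4 : inner ℝ y.1 x - (inner ℝ y.1 u + y.2 * r) =
        (inner ℝ e x - t) - inner ℝ (e - y.1) (x - u) + (τ - y.2) * r := by
      rw [sub_mul, hτr, inner_sub_left, inner_sub_right, inner_sub_right]
      ring
    rw [h4]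
    rw [abs_le] at h1 h2 h3
    rw [abs_lt]
    have := mul_pos hβ hr
    constructor <;> linarith [h1.1, h1.2, h2.1, h2.2, h3.1, h3.2]
  choose f hf using hcls
  -- Pigeonhole: some net point serves at least the proportion 1/|F| of the slabs.
  obtain ⟨y, hyF, hy⟩ := Finset.exists_le_card_fiber_of_nsmul_le_card_of_maps_to
    (s := I) (t := F) (f := f) (b := (I.card : ℝ) / F.card) (fun n hn => (hf n hn).1) hFne
    (by rw [nsmul_eq_mul, mul_div_cancel₀ _ hFpos.ne'])
  refine ⟨(y.1, inner ℝ y.1 u + y.2 * r), by simpa using (hF'K hyF).1, ?_⟩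
  have hsub : ((I : Set ℕ) ∩ {n | ∃ x ∈ A n, β * r ≤ |inner ℝ y.1 x - (inner ℝ y.1 u + y.2 * r)|}) ⊆
      ((I.filter fun n => ¬ f n = y : Finset ℕ) : Set ℕ) := by
    rintro n ⟨hn, x, hx, hxn⟩
    rw [Finset.coe_filter]
    refine ⟨hn, fun hfn => ?_⟩
    have := (hf n hn).2 x hx
    rw [hfn] at this
    exact absurd this (not_lt.2 hxn)
  have h1 := Set.ncard_le_ncard hsub (Finset.finite_toSet _)
  rw [Set.ncard_coe_finset] at h1
  rw [Set.ncard_coe_finset]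
  have h2 : ((I.filter fun n => f n = y).card : ℝ) + (I.filter fun n => ¬ f n = y).card = I.card := by
    exact_mod_cast Finset.card_filter_add_card_filter_not (s := I) (fun n => f n = y)
  have h3 : (((I : Set ℕ) ∩ {n | ∃ x ∈ A n,
      β * r ≤ |inner ℝ y.1 x - (inner ℝ y.1 u + y.2 * r)|}).ncard : ℝ) ≤
      (I.filter fun n => ¬ f n = y).card := by exact_mod_cast h1
  have h4 : (1 - 1 / (F.card : ℝ)) * I.card = I.card - I.card / F.card := by ring
  rw [h4]
  linarith

theorem mul_pow_le_of_growth {τ : ℕ → ℝ} {ρ : ℝ} (hρ : 0 ≤ ρ)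
    (h : ∀ n, ρ * τ n ≤ τ (n + 1)) (n m : ℕ) : ρ ^ m * τ n ≤ τ (n + m) := by
  induction m with
  | zero => simp
  | succ m ih =>
    refine le_trans ?_ (h (n + m))
    rw [pow_succ', mul_assoc]
    exact mul_le_mul_of_nonneg_left ih hρ

/-- Alice wins if at each scale the relevant part of the forbidden set is a union of thin slabs,
one for each `n`, where `n` is relevant at the scale `r` if `τ n * r` lies in a fixed window. -/
theorem exists_isShrinkHAWOn_of_slabs (V : Type*) [NormedAddCommGroup V] [InnerProductSpace ℝ V]
    [FiniteDimensional ℝ V] [Nontrivial V] {β ρ : ℝ}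
    (hβ : 0 < β) (hβ' : β < 1 / 3) (hρ : 1 < ρ) :
    ∃ k : ℕ, ∀ (O : Set V) (D : ℕ → Set V) (τ : ℕ → ℝ) (δ rs : ℝ) (n₀ : ℕ), 0 < δ → 0 < rs →
      (∀ n, 0 < τ n) → (∀ n, ρ * τ n ≤ τ (n + 1)) →
      (∀ u r n, 0 < r → r ≤ rs → closedBall u r ⊆ O → n₀ ≤ n → β ^ k * δ < τ n * r → τ n * r ≤ δ →
        ∃ e : V, ‖e‖ = 1 ∧ ∃ t : ℝ, ∀ x ∈ D n ∩ closedBall u r,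
          |inner ℝ e x - t| ≤ β / 4 * (β ^ k * r)) →
      IsShrinkHAWOn β {x | ∀ᶠ n in atTop, x ∉ D n} O := by
  obtain ⟨κ, hκ0, hκ1, hκ⟩ := exists_popular_slab (V := V) hβ hβ'
  obtain ⟨e₀, he₀⟩ := exists_norm_eq V (zero_le_one (α := ℝ))
  obtain ⟨q, hq⟩ := pow_unbounded_of_one_lt (1 / β) hρ
  have hq' : 1 ≤ β * ρ ^ q := by
    rw [div_lt_iff₀ hβ] at hq
    linarith
  -- Over q·k steps `τ` gains at least ρ^(qk) ≥ β^(-k), so a window contains at most q·k indices.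
  -- After k turns fewer than one survives.
  obtain ⟨k, hk0, hk⟩ : ∃ k : ℕ, 0 < k ∧ κ ^ k * (q * k : ℕ) < 1 := by
    have h1 : Tendsto (fun n : ℕ => (q : ℝ) * (n * κ ^ n)) atTop (𝓝 0) := by
      simpa using (tendsto_self_mul_const_pow_of_lt_one hκ0 hκ1).const_mul (q : ℝ)
    obtain ⟨k, hk, hk0⟩ := ((h1.eventually (gt_mem_nhds zero_lt_one)).and
      (eventually_gt_atTop 0)).exists
    refine ⟨k, hk0, lt_of_eq_of_lt ?_ hk⟩
    push_cast
    ring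
  refine ⟨k, fun O D τ δ rs n₀ hδ hrs hτ hτρ hslab => ?_⟩
  have hgrow := mul_pow_le_of_growth (by linarith) hτρ
  have hτlim : Tendsto τ atTop atTop := by
    refine tendsto_atTop_mono (fun n => ?_)
      ((tendsto_pow_atTop_atTop_of_one_lt hρ).atTop_mul_const (hτ 0))
    simpa using hgrow 0 n
  let W : ℝ → Set ℕ := fun r => {n | n₀ ≤ n ∧ β ^ k * δ < τ n * r ∧ τ n * r ≤ δ}
  have hW : ∀ r, 0 < r → ∃ a, W r ⊆ Ico a (a + q * k) := fun r hr => by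
    rcases (W r).eq_empty_or_nonempty with h | h
    · exact ⟨0, by simp [h]⟩
    refine ⟨sInf (W r), fun n hn => ⟨Nat.sInf_le hn, ?_⟩⟩
    have ha := Nat.sInf_mem h
    set a := sInf (W r)
    by_contra! hlt
    have h1 : ρ ^ (q * k) * τ a ≤ τ n := by
      refine (hgrow a (q * k)).trans ?_
      obtain ⟨m, rfl⟩ := Nat.exists_eq_add_of_le hlt
      refine le_trans ?_ (hgrow _ m)
      exact le_mul_of_one_le_left (hτ _).le (one_le_pow₀ hρ.le)
    have h2 : 1 ≤ β ^ k * ρ ^ (q * k) := by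
      rw [pow_mul, ← mul_pow]
      exact one_le_pow₀ hq'
    have h3 := ha.2.1
    have h4 := hn.2.2
    have h5 : β ^ k * (ρ ^ (q * k) * τ a * r) ≤ β ^ k * δ := mul_le_mul_of_nonneg_left
      ((mul_le_mul_of_nonneg_right h1 hr.le).trans h4) (by positivity)
    have h6 : τ a * r ≤ (β ^ k * ρ ^ (q * k)) * (τ a * r) :=
      le_mul_of_one_le_left (mul_pos (hτ a) hr).le h2
    nlinarith
  -- The window is frozen at the turn `st` that opens a group of k turns; only the condition of
  -- meeting the current ball evolves within the group.
  let alive : (ℕ → V × ℝ) → ℕ → ℕ → Set ℕ := fun b st i =>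
    W (b st).2 ∩ {n | (D n ∩ closedBall (b i).1 (b i).2).Nonempty}
  let Q : ℕ → (ℕ → V × ℝ) → V × ℝ → Prop := fun i b p => ‖p.1‖ = 1 ∧
    ((alive b (k * (i / k)) i ∩ {n | ∃ x ∈ D n ∩ closedBall (b i).1 (b i).2,
      β * (b i).2 ≤ |inner ℝ p.1 x - p.2|}).ncard : ℝ) ≤ κ * (alive b (k * (i / k)) i).ncard
  classical
  let s : ℕ → (ℕ → V × ℝ) → AffineSubspace ℝ V × ℝ := fun i b =>
    if h : ∃ p, Q i b p then (normalHyperplane h.choose.1 h.choose.2, β * (b i).2)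
    else (normalHyperplane e₀ 0, β * (b i).2)
  refine ⟨Strategy.ofSeq s, fun i B hB => ?_, fun c r hp hr x hx => ?_⟩
  · have hlast : B ⟨min i i, by omega⟩ = B (Fin.last i) := by
      simp only [min_self]
      rfl
    simp only [Strategy.ofSeq, s]
    split_ifs with h
    · exact ⟨isAffineHyperplane_normalHyperplane h.choose_spec.1 _, mul_pos hβ (hlast ▸ hB),
        (congrArg (fun b : V × ℝ => β * b.2) hlast).le⟩
    · exact ⟨isAffineHyperplane_normalHyperplane he₀ _, mul_pos hβ (hlast ▸ hB),
        (congrArg (fun b : V × ℝ => β * b.2) hlast).le⟩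
  · have hrpos := hp.radius_pos hβ
    have hanti := hp.antitone_radius hβ
    let b : ℕ → V × ℝ := fun i => (c i, r i)
    have hs : ∀ i, (Strategy.ofSeq s i fun j => (c j, r j)) = s i b := fun i => by
      have h1 : k * (i / k) ≤ i := Nat.mul_div_le i k
      simp only [Strategy.ofSeq, s, Q, alive, b, min_eq_left h1, min_self]
    have hfin : ∀ st i, (alive b st i).Finite := fun st i => by
      obtain ⟨a, ha⟩ := hW (r st) (hrpos st)
      exact ((finite_Ico _ _).subset ha).subset inter_subset_left
    have hstep : ∀ i, r (k * (i / k)) ≤ rs →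
        ((alive b (k * (i / k)) (i + 1)).ncard : ℝ) ≤ κ * (alive b (k * (i / k)) i).ncard := by
      intro i hi
      set st := k * (i / k) with hst
      have hsti : st ≤ i := Nat.mul_div_le i k
      have hlt : i - st ≤ k := by
        have := Nat.div_add_mod i k
        have := Nat.mod_lt i hk0
        omega
      -- This is why the slabs are required to be thin by the extra factor β^k: they stay thin
      -- relative to every ball of the group.
      have hrad : β ^ k * r st ≤ r i := by
        have h1 := hp.pow_mul_le hβ st (i - st)
        rw [Nat.add_sub_cancel' hsti] at h1
        exact (mul_le_mul_of_nonneg_right (pow_le_pow_of_le_one hβ.le (by linarith) hlt)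
          (hrpos st).le).trans h1
      have hex : ∃ p, Q i b p := by
        refine hκ (c i) (r i) (hrpos i) _ (hfin st i) (fun n => D n ∩ closedBall (c i) (r i))
          fun n hn => ⟨hn.2, inter_subset_right, ?_⟩
        obtain ⟨e, he, t, ht⟩ := hslab (c st) (r st) n (hrpos st) hi (hp.ball_subset st) hn.1.1
          hn.1.2.1 hn.1.2.2
        exact ⟨e, he, t, fun y hy => (ht y ⟨hy.1, hp.antitone_ball hsti hy.2⟩).trans
          (mul_le_mul_of_nonneg_left hrad (by positivity))⟩
      obtain ⟨hQ1, hQ2⟩ := hex.choose_spec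
      refine le_trans ?_ hQ2
      norm_cast
      refine ncard_le_ncard ?_ ((hfin st i).subset inter_subset_left)
      rintro n ⟨hn, y, hy, hyB⟩
      have hplay := (hp.2.2 i).2 hyB
      rw [hs i] at hplay
      simp only [s, dif_pos hex] at hplay
      refine ⟨⟨hn, y, hy, hplay.1⟩, y, ⟨hy, hplay.1⟩, ?_⟩
      by_contra! hcon
      exact hplay.2 (mem_thickening_normalHyperplane hQ1 hcon)
    have hgroup : ∀ j, r (k * j) ≤ rs → alive b (k * j) (k * j + k) = ∅ := by
      intro j hj
      have h1 : ∀ m ≤ k, ((alive b (k * j) (k * j + m)).ncard : ℝ) ≤ κ ^ m * (q * k : ℕ) := by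
        intro m hm
        induction m with
        | zero =>
          rw [pow_zero, one_mul, Nat.cast_le]
          obtain ⟨a, ha⟩ := hW (r (k * j)) (hrpos _)
          refine (ncard_le_ncard (inter_subset_left.trans ha) (finite_Ico _ _)).trans ?_
          rw [← Finset.coe_Ico, ncard_coe_finset, Nat.card_Ico]
          omega
        | succ m ih =>
          have h2 : (k * j + m) / k = j := by
            rw [Nat.mul_add_div hk0, Nat.div_eq_of_lt (by omega), add_zero]
          have h3 := hstep (k * j + m)
          rw [h2] at h3
          refine (h3 hj).trans ?_
          rw [pow_succ', mul_assoc]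
          exact mul_le_mul_of_nonneg_left (ih (by omega)) hκ0
      have h2 : ((alive b (k * j) (k * j + k)).ncard : ℝ) < 1 := (h1 k le_rfl).trans_lt hk
      exact (ncard_eq_zero (hfin _ _)).1 (Nat.lt_one_iff.1 (by exact_mod_cast h2))
    have hr0 : 0 < min rs (r 0) := lt_min hrs (hrpos 0)
    filter_upwards [hτlim.eventually_gt_atTop (δ / min rs (r 0)), eventually_ge_atTop n₀]
      with n hn hn₀ hxD
    rw [div_lt_iff₀ hr0] at hn
    -- Take the first group at whose opening `n` has fallen below the top of the window. The radius
    -- shrank by at most β^k since the previous opening, so `n` is also above the bottom. For large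
    -- `n` this group is not the initial one and its radius is at most `rs`.
    have hex : ∃ j, τ n * r (k * j) ≤ δ := by
      have h1 : Tendsto (fun j => τ n * r (k * j)) atTop (𝓝 0) := by
        simpa using (hr.comp (tendsto_atTop_mono
          (fun j => Nat.le_mul_of_pos_left j hk0) tendsto_id)).const_mul (τ n)
      exact (h1.eventually (ge_mem_nhds hδ)).exists
    have hj := Nat.find_spec hex
    have hjmin := fun {m} => Nat.find_min (H := hex) (m := m)
    set j := Nat.find hex
    have hjrs : r (k * j) ≤ min rs (r 0) := by
      by_contra! hcon
      have := mul_lt_mul_of_pos_left hcon (hτ n)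
      linarith
    have hj0 : j ≠ 0 := fun h0 => by
      rw [h0, mul_zero] at hj
      have := mul_le_mul_of_nonneg_left (min_le_right rs (r 0)) (hτ n).le
      linarith
    obtain ⟨j', hj'⟩ := Nat.exists_eq_succ_of_ne_zero hj0
    have hjw : β ^ k * δ < τ n * r (k * j) := by
      have h1 := hjmin (m := j') (by omega)
      push Not at h1
      have h2 := hp.pow_mul_le hβ (k * j') k
      rw [show k * j' + k = k * j by rw [hj', Nat.mul_succ]] at h2
      have h3 := mul_le_mul_of_nonneg_left h2 (hτ n).le
      have h4 := mul_lt_mul_of_pos_left h1 (pow_pos hβ k)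
      linarith
    have hempty := hgroup j (hjrs.trans (min_le_left _ _))
    have : n ∈ alive b (k * j) (k * j + k) := ⟨⟨hn₀, hjw, hj⟩, x, hxD, hx _⟩
    rw [hempty] at this
    exact this

end Slabs

end NondenseOrbits


namespace NondenseOrbits

open Set Filter Asymptotics

/-! ### Growth of the scalars occurring in powers of Jordan blocks. -/

section PowerGrowth

/-- The order of growth of the powers of a matrix of spectral radius `ρ` whose largest Jordan block
to an eigenvalue of modulus `ρ` has size `p + 1`. -/
noncomputable def growthRate (ρ : ℝ) (p n : ℕ) : ℝ := ρ ^ n * (n + 1) ^ p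

theorem growthRate_pos {ρ : ℝ} (hρ : 0 < ρ) (p n : ℕ) : 0 < growthRate ρ p n := by
  unfold growthRate; positivity

theorem mul_growthRate_le {ρ : ℝ} (hρ : 0 < ρ) (p n : ℕ) :
    ρ * growthRate ρ p n ≤ growthRate ρ p (n + 1) := by
  unfold growthRate
  rw [pow_succ', mul_assoc]
  push_cast
  gcongr
  linarith

/-- On the circle ‖z‖ = ρ, a lower binomial degree gains a factor 1/(n+1). Inside it, ‖z‖ ≤ qρ for
some q < 1, and q^n beats the polynomial n^i. -/
theorem isLittleO_choose_mul_pow {ρ : ℝ} (hρ : 0 < ρ) {p i : ℕ} {z : ℂ} (hz : ‖z‖ ≤ ρ)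
    (h : ‖z‖ = ρ → i < p) :
    (fun n : ℕ => (n.choose i : ℂ) * z ^ (n - i)) =o[atTop] growthRate ρ p := by
  have key : ∃ u : ℕ → ℝ, Tendsto u atTop (𝓝 0) ∧
      ∀ n : ℕ, ‖(n.choose i : ℂ) * z ^ (n - i)‖ ≤ u n * growthRate ρ p n := by
    rcases hz.eq_or_lt with h1 | h1
    · refine ⟨fun n => (1 / ((n : ℝ) + 1)) * (1 / ρ ^ i),
        by simpa using tendsto_one_div_add_atTop_nhds_zero_nat.mul_const (1 / ρ ^ i), fun n => ?_⟩
      rw [norm_mul, norm_pow, h1, Complex.norm_natCast]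
      rcases lt_or_ge n i with hn | hn
      · rw [Nat.choose_eq_zero_of_lt hn, Nat.cast_zero, zero_mul]
        exact mul_nonneg (by positivity) (growthRate_pos hρ _ _).le
      · obtain ⟨m, rfl⟩ := Nat.exists_eq_add_of_le hn
        obtain ⟨d, rfl⟩ := Nat.exists_eq_add_of_lt (h h1)
        have h2 : ((i + m).choose i : ℝ) ≤ (((i + m : ℕ) : ℝ) + 1) ^ i := by
          refine (by exact_mod_cast Nat.choose_le_pow (i + m) i :
            ((i + m).choose i : ℝ) ≤ ((i + m : ℕ) : ℝ) ^ i).trans ?_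
          gcongr
          linarith
        have h3 : (1 / (((i + m : ℕ) : ℝ) + 1)) * (1 / ρ ^ i) * growthRate ρ (i + d + 1) (i + m) =
            (((i + m : ℕ) : ℝ) + 1) ^ i * ρ ^ m * (((i + m : ℕ) : ℝ) + 1) ^ d := by
          unfold growthRate
          field_simp
          ring
        rw [h3, Nat.add_sub_cancel_left]
        refine (mul_le_mul_of_nonneg_right h2 (by positivity)).trans
          (le_mul_of_one_le_right (by positivity) (one_le_pow₀ ?_))
        have : (0 : ℝ) ≤ (i + m : ℕ) := Nat.cast_nonneg _
        linarith
    · obtain ⟨q, hq1, hq2⟩ := exists_between (max_lt ((div_lt_one hρ).2 h1) one_half_lt_one)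
      have hq0 : 0 < q := lt_trans one_half_pos ((le_max_right _ _).trans_lt hq1)
      have hzq : ‖z‖ ≤ q * ρ := ((div_lt_iff₀ hρ).1 ((le_max_left _ _).trans_lt hq1)).le
      refine ⟨fun n => ((n : ℝ) ^ i * q ^ n) * (1 / (q * ρ) ^ i), ?_, fun n => ?_⟩
      · simpa using (tendsto_pow_const_mul_const_pow_of_abs_lt_one i
          (by rwa [abs_of_pos hq0])).mul_const (1 / (q * ρ) ^ i)
      rw [norm_mul, norm_pow, Complex.norm_natCast]
      rcases lt_or_ge n i with hn | hn
      · rw [Nat.choose_eq_zero_of_lt hn, Nat.cast_zero, zero_mul]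
        exact mul_nonneg (by positivity) (growthRate_pos hρ _ _).le
      · obtain ⟨m, rfl⟩ := Nat.exists_eq_add_of_le hn
        have h2 : ((i + m).choose i : ℝ) ≤ ((i + m : ℕ) : ℝ) ^ i := by
          exact_mod_cast Nat.choose_le_pow (i + m) i
        have h3 : ‖z‖ ^ m ≤ (q * ρ) ^ m := by gcongr
        rw [Nat.add_sub_cancel_left]
        have h4 : ((i + m : ℕ) : ℝ) ^ i * q ^ (i + m) * (1 / (q * ρ) ^ i) * growthRate ρ p (i + m) =
            (((i + m : ℕ) : ℝ) ^ i * (q * ρ) ^ m) * (((i + m : ℕ) : ℝ) + 1) ^ p := by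
          unfold growthRate
          field_simp
          ring
        rw [h4]
        refine (mul_le_mul h2 h3 (by positivity) (by positivity)).trans
          (le_mul_of_one_le_right (by positivity) (one_le_pow₀ ?_))
        have : (0 : ℝ) ≤ (i + m : ℕ) := Nat.cast_nonneg _
        linarith
  obtain ⟨u, hu, hle⟩ := key
  have h1 : (fun n => u n * growthRate ρ p n) =o[atTop] growthRate ρ p := by
    simpa using ((isLittleO_one_iff ℝ).2 hu).mul_isBigO (isBigO_refl (growthRate ρ p) atTop)
  refine (IsBigO.of_bound 1 (Eventually.of_forall fun n => ?_)).trans_isLittleO h1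
  rw [one_mul]
  exact (hle n).trans (le_abs_self _)

theorem isBigO_choose_mul_pow {ρ : ℝ} (hρ : 0 < ρ) {p i : ℕ} {z : ℂ} (hz : ‖z‖ ≤ ρ)
    (h : ‖z‖ = ρ → i ≤ p) :
    (fun n : ℕ => (n.choose i : ℂ) * z ^ (n - i)) =O[atTop] growthRate ρ p := by
  by_cases h1 : ‖z‖ = ρ ∧ i = p
  · obtain ⟨h1, rfl⟩ := h1
    refine IsBigO.of_bound (1 / ρ ^ i) ((eventually_ge_atTop i).mono fun n hn => ?_)
    rw [Real.norm_of_nonneg (growthRate_pos hρ _ _).le, norm_mul, norm_pow, h1,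
      Complex.norm_natCast]
    obtain ⟨m, rfl⟩ := Nat.exists_eq_add_of_le hn
    have h2 : ((i + m).choose i : ℝ) ≤ (((i + m : ℕ) : ℝ) + 1) ^ i := by
      refine (by exact_mod_cast Nat.choose_le_pow (i + m) i :
        ((i + m).choose i : ℝ) ≤ ((i + m : ℕ) : ℝ) ^ i).trans ?_
      gcongr
      linarith
    have h3 : (1 / ρ ^ i) * growthRate ρ i (i + m) = (((i + m : ℕ) : ℝ) + 1) ^ i * ρ ^ m := by
      unfold growthRate
      field_simp
      ring
    rw [h3, Nat.add_sub_cancel_left]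
    exact mul_le_mul_of_nonneg_right h2 (by positivity)
  · exact (isLittleO_choose_mul_pow hρ hz fun h2 => lt_of_le_of_ne (h h2)
      fun h3 => h1 ⟨h2, h3⟩).isBigO

/-- The leading coefficient has the full order of growth, since (m+1)^p ≤ p! · C(p+m, p). Its
reciprocal can therefore serve as a bounded normalization. -/
theorem isBigO_growthRate_div {ρ : ℝ} (hρ : 0 < ρ) {p : ℕ} {z : ℂ} (hz : ‖z‖ = ρ) :
    (fun n : ℕ => (growthRate ρ p n : ℂ) / ((n.choose p : ℂ) * z ^ (n - p))) =O[atTop]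
      fun _ => (1 : ℝ) := by
  refine IsBigO.of_bound (ρ ^ p * ((p + 1) ^ p * p.factorial))
    ((eventually_ge_atTop p).mono fun n hn => ?_)
  obtain ⟨m, rfl⟩ := Nat.exists_eq_add_of_le hn
  have hc : (0 : ℝ) < (p + m).choose p := by
    exact_mod_cast Nat.choose_pos (Nat.le_add_right p m)
  rw [norm_div, norm_mul, norm_pow, hz, Complex.norm_natCast, Complex.norm_real,
    Real.norm_of_nonneg (growthRate_pos hρ _ _).le, norm_one, mul_one, Nat.add_sub_cancel_left,
    div_le_iff₀ (by positivity)]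
  have h1 : ((m : ℝ) + 1) ^ p ≤ p.factorial * (p + m).choose p := by
    have h1 := Nat.pow_succ_le_ascFactorial (m + 1) p
    rw [Nat.ascFactorial_eq_factorial_mul_choose] at h1
    have h2 : (m + p).choose p = (p + m).choose p := by rw [add_comm]
    have h3 : (m + 1) ^ p ≤ p.factorial * (p + m).choose p := by
      rw [← h2]
      exact h1
    exact_mod_cast h3
  have h2 : (((p + m : ℕ) : ℝ) + 1) ^ p ≤ (p + 1) ^ p * (m + 1) ^ p := by
    rw [← mul_pow]
    refine pow_le_pow_left₀ (by positivity) ?_ _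
    push_cast
    nlinarith [mul_nonneg (Nat.cast_nonneg (α := ℝ) p) (Nat.cast_nonneg (α := ℝ) m)]
  calc growthRate ρ p (p + m) = ρ ^ p * ρ ^ m * (((p + m : ℕ) : ℝ) + 1) ^ p := by
        unfold growthRate; rw [pow_add]
    _ ≤ ρ ^ p * ρ ^ m * ((p + 1) ^ p * (p.factorial * (p + m).choose p)) := by
        gcongr
        exact h2.trans (by gcongr)
    _ = _ := by ring

end PowerGrowth

/-! ### Asymptotics of powers through spectral projections. -/

section Spectral

open Polynomial

variable {A : Type*} [NormedRing A] [NormedAlgebra ℂ A]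

theorem exists_crt (S : Finset ℂ) (m : ℂ → ℕ) (f : ℂ → ℂ[X]) :
    ∃ q : ℂ[X], ∀ z ∈ S, (X - C z) ^ m z ∣ q - f z := by
  obtain ⟨q, hq⟩ := Ideal.exists_forall_sub_mem_ideal
    (I := fun z : S => Ideal.span {(X - C (z : ℂ)) ^ m (z : ℂ)})
    (fun a b hab => (Ideal.isCoprime_span_singleton_iff _ _).2
      (isCoprime_X_sub_C_of_isUnit_sub (sub_ne_zero.2 fun h => hab (Subtype.ext h)).isUnit).pow)
    fun z => f z
  exact ⟨q, fun z hz => Ideal.mem_span_singleton.1 (hq ⟨z, hz⟩)⟩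

theorem aeval_eq_zero_of_forall_dvd {M : A} {S : Finset ℂ} {m : ℂ → ℕ}
    (hM : aeval M (∏ z ∈ S, (X - C z) ^ m z) = 0) {q : ℂ[X]}
    (hq : ∀ z ∈ S, (X - C z) ^ m z ∣ q) : aeval M q = 0 := by
  obtain ⟨q', rfl⟩ := Finset.prod_dvd_of_coprime (fun a _ b _ hab =>
    (isCoprime_X_sub_C_of_isUnit_sub (sub_ne_zero.2 hab).isUnit).pow) hq
  rw [map_mul, hM, zero_mul]

/-- The asymptotics of the powers of an element that is annihilated by a polynomial. -/
theorem pow_asymptotics {M : A} {S : Finset ℂ} {m : ℂ → ℕ}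
    (hM : aeval M (∏ z ∈ S, (X - C z) ^ m z) = 0) {ρ : ℝ} (hρ : 0 < ρ) {p : ℕ}
    (hS : ∀ z ∈ S, ‖z‖ ≤ ρ) (hm : ∀ z ∈ S, ‖z‖ = ρ → m z ≤ p + 1) {P : ℂ[X]}
    (hP : ∀ z ∈ S, ‖z‖ = ρ → m z = p + 1 → (X - C z) ^ m z ∣ P - (X - C z) ^ p)
    (hP' : ∀ z ∈ S, ¬ (‖z‖ = ρ ∧ m z = p + 1) → (X - C z) ^ m z ∣ P) :
    (fun n => M ^ n) =O[atTop] growthRate ρ p ∧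
    ∃ Q : ℕ → A, Q =O[atTop] (fun _ => (1 : ℝ)) ∧
      (fun n => Q n * M ^ n - (growthRate ρ p n : ℂ) • aeval M P) =o[atTop] growthRate ρ p := by
  classical
  -- The elements `e z` evaluated at `M` are the spectral projections.
  choose e he using fun z : ℂ => exists_crt S m fun w => if w = z then 1 else 0
  have h1 : ∑ z ∈ S, aeval M (e z) = 1 := by
    rw [← map_sum, ← sub_eq_zero, ← map_one (aeval (R := ℂ) M), ← map_sub]
    refine aeval_eq_zero_of_forall_dvd hM fun w hw => ?_
    have : ∑ z ∈ S, e z - 1 = ∑ z ∈ S, (e z - if w = z then 1 else 0) := by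
      rw [Finset.sum_sub_distrib, Finset.sum_ite_eq, if_pos hw]
    rw [this]
    exact Finset.dvd_sum fun z _ => he z w hw
  have h2 : ∀ z i, m z ≤ i → aeval M ((X - C z) ^ i * e z) = 0 := fun z i hi => by
    refine aeval_eq_zero_of_forall_dvd hM fun w hw => ?_
    have h3 := he z w hw
    rcases eq_or_ne w z with rfl | hne
    · exact (pow_dvd_pow _ hi).mul_right _
    · rw [if_neg hne, sub_zero] at h3
      exact h3.mul_left _
  -- Binomial expansion of ((M - z) + z)^n on one generalized eigenspace; the terms with i ≥ m z are
  -- annihilated. Both sums are compared with a longer common range because n + 1 and m z are not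
  -- ordered.
  have h3 : ∀ z ∈ S, ∀ n, aeval M (e z) * M ^ n = ∑ i ∈ Finset.range (m z),
      ((n.choose i : ℂ) * z ^ (n - i)) • aeval M ((X - C z) ^ i * e z) := fun z _ n => by
    have h4 : (X : ℂ[X]) ^ n * e z = ∑ i ∈ Finset.range (n + 1),
        C ((n.choose i : ℂ) * z ^ (n - i)) * ((X - C z) ^ i * e z) := by
      conv_lhs => rw [← sub_add_cancel X (C z), add_pow, Finset.sum_mul]
      refine Finset.sum_congr rfl fun i _ => ?_
      rw [C_mul, C_pow, map_natCast]
      ring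
    have h5 : aeval M (e z) * M ^ n = ∑ i ∈ Finset.range (n + 1),
        ((n.choose i : ℂ) * z ^ (n - i)) • aeval M ((X - C z) ^ i * e z) := by
      have := congrArg (aeval M) h4
      rw [mul_comm, map_mul, map_pow, aeval_X, map_sum] at this
      rw [this]
      refine Finset.sum_congr rfl fun i _ => ?_
      rw [map_mul, aeval_C, Algebra.smul_def]
    rw [h5]
    have h6 : ∀ N, n + 1 ≤ N → ∑ i ∈ Finset.range (n + 1),
        ((n.choose i : ℂ) * z ^ (n - i)) • aeval M ((X - C z) ^ i * e z) =
        ∑ i ∈ Finset.range N,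
        ((n.choose i : ℂ) * z ^ (n - i)) • aeval M ((X - C z) ^ i * e z) := fun N hN => by
      refine Finset.sum_subset (by simpa using hN) fun i _ hi => ?_
      rw [Finset.mem_range, not_lt] at hi
      rw [Nat.choose_eq_zero_of_lt (by omega), Nat.cast_zero, zero_mul, zero_smul]
    have h7 : ∀ N, m z ≤ N → ∑ i ∈ Finset.range (m z),
        ((n.choose i : ℂ) * z ^ (n - i)) • aeval M ((X - C z) ^ i * e z) =
        ∑ i ∈ Finset.range N,
        ((n.choose i : ℂ) * z ^ (n - i)) • aeval M ((X - C z) ^ i * e z) := fun N hN => by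
      refine Finset.sum_subset (by simpa using hN) fun i _ hi => ?_
      rw [Finset.mem_range, not_lt] at hi
      rw [h2 z i hi, smul_zero]
    rw [h6 (n + 1 + m z) (by omega), h7 (n + 1 + m z) (by omega)]
  refine ⟨?_, ?_⟩
  · have h4 : (fun n => M ^ n) = fun n => ∑ z ∈ S, ∑ i ∈ Finset.range (m z),
        ((n.choose i : ℂ) * z ^ (n - i)) • aeval M ((X - C z) ^ i * e z) := by
      funext n
      rw [← one_mul (M ^ n), ← h1, Finset.sum_mul]
      exact Finset.sum_congr rfl fun z hz => h3 z hz n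
    rw [h4]
    refine IsBigO.fun_sum fun z hz => IsBigO.fun_sum fun i hi => ?_
    rw [Finset.mem_range] at hi
    have h5 := (isBigO_choose_mul_pow hρ (hS z hz) (i := i) (p := p)
      fun h => by have := hm z hz h; omega).smul
      (isBigO_const_const (aeval M ((X - C z) ^ i * e z)) (one_ne_zero (α := ℝ)) atTop)
    simpa using h5
  · set S' := S.filter fun z => ‖z‖ = ρ ∧ m z = p + 1 with hS'
    have h4 : aeval M P = ∑ z ∈ S', aeval M ((X - C z) ^ p * e z) := by
      rw [← map_sum, ← sub_eq_zero, ← map_sub]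
      refine aeval_eq_zero_of_forall_dvd hM fun w hw => ?_
      have h5 : P - ∑ z ∈ S', (X - C z) ^ p * e z =
          (P - if w ∈ S' then (X - C w) ^ p else 0) -
          ∑ z ∈ S', (X - C z) ^ p * (e z - if w = z then 1 else 0) := by
        simp_rw [mul_sub, Finset.sum_sub_distrib, mul_ite, mul_one, mul_zero, Finset.sum_ite_eq]
        ring
      rw [h5]
      refine dvd_sub ?_ (Finset.dvd_sum fun z _ => (he z w hw).mul_left _)
      by_cases hwS : ‖w‖ = ρ ∧ m w = p + 1
      · rw [if_pos (Finset.mem_filter.2 ⟨hw, hwS⟩)]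
        exact hP w hw hwS.1 hwS.2
      · rw [if_neg (fun h : w ∈ S' => hwS (Finset.mem_filter.1 h).2), sub_zero]
        exact hP' w hw hwS
    have h5 : ∀ z ∈ S', (fun n : ℕ => (growthRate ρ p n : ℂ) / ((n.choose p : ℂ) * z ^ (n - p)))
        =O[atTop] fun _ => (1 : ℝ) := fun z hz =>
      isBigO_growthRate_div hρ (Finset.mem_filter.1 hz).2.1
    -- Multiplication by this bounded factor removes the rotating phases: on each dominant block the
    -- term of degree p becomes exactly `growthRate` times (M - z)^p e_z, and the lower terms are
    -- negligible.
    refine ⟨fun n => ∑ z ∈ S', ((growthRate ρ p n : ℂ) / ((n.choose p : ℂ) * z ^ (n - p))) •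
      aeval M (e z), IsBigO.fun_sum fun z hz => ?_, ?_⟩
    · simpa using (h5 z hz).smul
        (isBigO_const_const (aeval M (e z)) (one_ne_zero (α := ℝ)) atTop)
    have h6 : (fun n => ∑ z ∈ S', ∑ i ∈ Finset.range p,
        (((growthRate ρ p n : ℂ) / ((n.choose p : ℂ) * z ^ (n - p))) *
          ((n.choose i : ℂ) * z ^ (n - i))) • aeval M ((X - C z) ^ i * e z)) =o[atTop]
        growthRate ρ p := by
      refine IsLittleO.fun_sum fun z hz => IsLittleO.fun_sum fun i hi => ?_
      obtain ⟨hzS, hzρ, hzm⟩ := Finset.mem_filter.1 hz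
      have h7 := ((h5 z hz).mul_isLittleO (isLittleO_choose_mul_pow hρ hzρ.le (i := i) (p := p)
        fun _ => Finset.mem_range.1 hi)).smul_isBigO
        (isBigO_const_const (aeval M ((X - C z) ^ i * e z)) (one_ne_zero (α := ℝ)) atTop)
      simpa using h7
    refine h6.congr' ((eventually_ge_atTop p).mono fun n hn => ?_) EventuallyEq.rfl
    simp only
    rw [h4, Finset.smul_sum, Finset.sum_mul, ← Finset.sum_sub_distrib]
    refine Finset.sum_congr rfl fun z hz => ?_
    obtain ⟨hzS, hzρ, hzm⟩ := Finset.mem_filter.1 hz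
    have hz0 : z ≠ 0 := by
      rintro rfl
      rw [norm_zero] at hzρ
      exact hρ.ne hzρ
    have hα : ((n.choose p : ℂ) * z ^ (n - p)) ≠ 0 :=
      mul_ne_zero (by exact_mod_cast (Nat.choose_pos hn).ne') (pow_ne_zero _ hz0)
    rw [smul_mul_assoc, h3 z hzS, hzm, Finset.sum_range_succ, smul_add, Finset.smul_sum, smul_smul,
      div_mul_cancel₀ _ hα, add_sub_cancel_right]
    exact Finset.sum_congr rfl fun i _ => (smul_smul _ _ _).symm

end Spectral

/-! ### Two-sided growth bounds for the adjoint operator. -/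

section Dual

set_option linter.unusedSectionVars false

variable {E : Type*} [NormedAddCommGroup E] [NormedSpace ℝ E]

/-- Precomposition with `T` on complex-valued functionals. -/
noncomputable def precompCLM (T : E →L[ℝ] E) : (E →L[ℝ] ℂ) →L[ℂ] (E →L[ℝ] ℂ) :=
  LinearMap.mkContinuous
    { toFun := fun Λ => Λ.comp T
      map_add' := fun _ _ => rfl
      map_smul' := fun _ _ => rfl } ‖T‖ fun Λ => by
    rw [mul_comm]
    exact Λ.opNorm_comp_le T

theorem precompCLM_apply (T : E →L[ℝ] E) (Λ : E →L[ℝ] ℂ) : precompCLM T Λ = Λ.comp T := rfl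

theorem precompCLM_pow_apply (T : E →L[ℝ] E) (n : ℕ) (Λ : E →L[ℝ] ℂ) :
    (precompCLM T ^ n) Λ = Λ.comp (T ^ n) := by
  induction n generalizing Λ with
  | zero => rfl
  | succ n ih =>
    rw [pow_succ, mul_apply_eq_comp, ih, precompCLM_apply, pow_succ']
    rfl

theorem aeval_precompCLM_apply (T : E →L[ℝ] E) (q : Polynomial ℝ) (Λ : E →L[ℝ] ℂ) (v : E) :
    Polynomial.aeval (precompCLM T) (q.map (algebraMap ℝ ℂ)) Λ v =
      Λ (Polynomial.aeval (T : E →ₗ[ℝ] E) q v) := by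
  induction q using Polynomial.induction_on' with
  | add q q' hq hq' => rw [Polynomial.map_add, map_add, map_add, _root_.add_apply, _root_.add_apply, hq, hq',
    LinearMap.add_apply, map_add]
  | monomial n a =>
    rw [Polynomial.map_monomial, Polynomial.aeval_monomial, Polynomial.aeval_monomial,
      ← Algebra.smul_def, ← Algebra.smul_def, _root_.smul_apply,
      precompCLM_pow_apply, LinearMap.smul_apply, map_smul]
    rw [_root_.smul_apply, ContinuousLinearMap.comp_apply]
    have : ∀ w, (T ^ n) w = ((T : E →ₗ[ℝ] E) ^ n) w := fun w => by
      induction n generalizing w with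
      | zero => rfl
      | succ n ih => rw [pow_succ, pow_succ]; exact ih _
    rw [this]
    simp

variable [FiniteDimensional ℝ E]

theorem topPolynomial_spec (T : E →ₗ[ℝ] E) : IsTopPolynomial T (topPolynomial T) :=
  (existsUnique_isTopPolynomial T).choose_spec.1

/-- Complex-valued functionals on the real space `E` form a complex space on which `T` acts by
precomposition and is annihilated by its minimal polynomial. Thus complex spectral theory applies
without a norm on the complexification of `E`. -/
theorem precompCLM_pow_asymptotics (T : E →L[ℝ] E) {T' : E →ₗ[ℝ] E} (hTT' : (T : E →ₗ[ℝ] E) = T')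
    (hT : 0 < specRadius T') :
    (fun n => precompCLM T ^ n) =O[atTop] growthRate (specRadius T') (topExponent T' - 1) ∧
    ∃ Q : ℕ → (E →L[ℝ] ℂ) →L[ℂ] (E →L[ℝ] ℂ), Q =O[atTop] (fun _ => (1 : ℝ)) ∧
      (fun n => Q n * precompCLM T ^ n - (growthRate (specRadius T') (topExponent T' - 1) n : ℂ) •
        Polynomial.aeval (precompCLM T) ((topPolynomial T').map (algebraMap ℝ ℂ))) =o[atTop]
        growthRate (specRadius T') (topExponent T' - 1) := by
  have hfin := finite_complexSpectrum T'
  have hmemS : ∀ z, z ∈ hfin.toFinset ↔ z ∈ complexSpectrum T' := fun z => hfin.mem_toFinset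
  have hM : Polynomial.aeval (precompCLM T)
      (∏ z ∈ hfin.toFinset, (Polynomial.X - Polynomial.C z) ^ minpolyExponent T' z) = 0 := by
    rw [← prod_eq_minpoly]
    ext Λ v
    rw [aeval_precompCLM_apply, hTT', minpoly.aeval, LinearMap.zero_apply, map_zero]
    rfl
  have hle : ∀ z ∈ hfin.toFinset, ‖z‖ ≤ specRadius T' := fun z hz =>
    le_csSup (hfin.image fun z : ℂ => ‖z‖).bddAbove (mem_image_of_mem _ ((hmemS z).1 hz))
  have hexp : ∀ z ∈ hfin.toFinset, ‖z‖ = specRadius T' →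
      minpolyExponent T' z ≤ topExponent T' := fun z hz h =>
    le_csSup ((hfin.subset fun _ h => h.1 : {z | z ∈ complexSpectrum T' ∧
      ‖z‖ = specRadius T'}.Finite).image (minpolyExponent T')).bddAbove
      (mem_image_of_mem _ ⟨(hmemS z).1 hz, h⟩)
  have hres := (topPolynomial_spec T').2
  have key := pow_asymptotics (M := precompCLM T) (S := hfin.toFinset) (m := minpolyExponent T')
    (ρ := specRadius T') (p := topExponent T' - 1) (P := (topPolynomial T').map (algebraMap ℝ ℂ))
  refine key hM hT hle (fun z hz h => (hexp z hz h).trans (by omega)) (fun z hz h h' => ?_)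
    fun z hz h => ?_
  · have h1 := hres z ((hmemS z).1 hz)
    have h2 : minpolyExponent T' z = topExponent T' := by have := hexp z hz h; omega
    rwa [prescribedResidue, if_pos ⟨h, h2⟩] at h1
  · have h1 := hres z ((hmemS z).1 hz)
    by_cases h2 : ‖z‖ = specRadius T' ∧ minpolyExponent T' z = topExponent T'
    -- Only the truncated subtraction leads here: if the top exponent is 0, then p + 1 = 1 differs
    -- from it and the divisibility is trivial.
    · have h3 : minpolyExponent T' z = 0 := by
        by_contra h3
        exact h ⟨h2.1, by omega⟩
      rw [h3, pow_zero]
      exact one_dvd _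
    · rwa [prescribedResidue, if_neg h2, sub_zero] at h1

theorem norm_ofReal_comp (ℓ : E →L[ℝ] ℝ) : ‖Complex.ofRealCLM.comp ℓ‖ = ‖ℓ‖ := by
  apply le_antisymm
  · refine ContinuousLinearMap.opNorm_le_bound _ (norm_nonneg _) fun v => ?_
    simpa using ℓ.le_opNorm v
  · refine ContinuousLinearMap.opNorm_le_bound _ (norm_nonneg _) fun v => ?_
    simpa using (Complex.ofRealCLM.comp ℓ).le_opNorm v

/-- The powers of `T` grow at most at the rate `growthRate ρ (s - 1)`. -/
theorem exists_norm_pow_le (T : E →L[ℝ] E) {T' : E →ₗ[ℝ] E} (hTT' : (T : E →ₗ[ℝ] E) = T')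
    (hT : 0 < specRadius T') :
    ∃ C : ℝ, 0 < C ∧ ∀ n, ‖T ^ n‖ ≤ C * growthRate (specRadius T') (topExponent T' - 1) n := by
  obtain ⟨C, hC, hCb⟩ := bound_of_isBigO_nat_atTop (precompCLM_pow_asymptotics T hTT' hT).1
  refine ⟨C, hC, fun n => ContinuousLinearMap.opNorm_le_bound _
    (mul_nonneg hC.le (growthRate_pos hT _ _).le) fun w => ?_⟩
  obtain ⟨ℓ, hℓ, hℓw⟩ := exists_dual_vector'' ℝ ((T ^ n) w)
  have h1 := hCb (growthRate_pos hT (topExponent T' - 1) n).ne'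
  rw [Real.norm_of_nonneg (growthRate_pos hT _ _).le] at h1
  have h2 : ‖(T ^ n) w‖ ≤ ‖ℓ.comp (T ^ n)‖ * ‖w‖ := by
    refine le_trans (le_of_eq ?_) ((ℓ.comp (T ^ n)).le_opNorm w)
    rw [ContinuousLinearMap.comp_apply, hℓw]
    simp
  have h3 : ‖ℓ.comp (T ^ n)‖ ≤ ‖precompCLM T ^ n‖ := by
    rw [← norm_ofReal_comp, ← ContinuousLinearMap.comp_assoc, ← precompCLM_pow_apply]
    refine ((precompCLM T ^ n).le_opNorm _).trans (mul_le_of_le_one_right (norm_nonneg _) ?_)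
    rwa [norm_ofReal_comp]
  exact h2.trans (mul_le_mul_of_nonneg_right (h3.trans h1) (norm_nonneg _))

/-- The compositions of the powers of `T` with a functional that does not vanish on the image of
`p_T(T)` grow at the rate `growthRate ρ (s - 1)`. -/
theorem exists_le_norm_comp_pow (T : E →L[ℝ] E) {T' : E →ₗ[ℝ] E} (hTT' : (T : E →ₗ[ℝ] E) = T')
    (hT : 0 < specRadius T') {ℓ : E →L[ℝ] ℝ} {v : E}
    (hv : ℓ (Polynomial.aeval T' (topPolynomial T') v) ≠ 0) :
    ∃ c : ℝ, 0 < c ∧ ∀ᶠ n in atTop,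
      c * growthRate (specRadius T') (topExponent T' - 1) n ≤ ‖ℓ.comp (T ^ n)‖ := by
  obtain ⟨-, Q, hQ, hQo⟩ := precompCLM_pow_asymptotics T hTT' hT
  obtain ⟨C, hC, hCb⟩ := hQ.exists_pos
  rw [isBigOWith_iff] at hCb
  set ρ := specRadius T'
  set p := topExponent T' - 1
  set P := Polynomial.aeval (precompCLM T) ((topPolynomial T').map (algebraMap ℝ ℂ)) with hP
  set Λ := Complex.ofRealCLM.comp ℓ with hΛdef
  have hd0 : 0 < ‖P Λ‖ := by
    rw [norm_pos_iff]
    intro h0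
    have h1 := aeval_precompCLM_apply T (topPolynomial T') Λ v
    rw [← hP, h0, hTT'] at h1
    apply hv
    have h2 : ((ℓ (Polynomial.aeval T' (topPolynomial T') v) : ℝ) : ℂ) = 0 := h1.symm
    exact_mod_cast h2
  have hΛ : 0 < ‖Λ‖ + 1 := by positivity
  refine ⟨‖P Λ‖ / 2 / C, by positivity, ?_⟩
  filter_upwards [hCb, (isLittleO_iff.1 hQo) (c := ‖P Λ‖ / 2 / (‖Λ‖ + 1)) (by positivity)]
    with n h1 h2
  have hg := growthRate_pos hT p n
  set R := Q n * precompCLM T ^ n - (growthRate ρ p n : ℂ) • P with hR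
  rw [Real.norm_of_nonneg hg.le] at h2
  rw [norm_one, mul_one] at h1
  -- `Q n` is bounded and `R Λ` is at most half of the left side, so ℓ ∘ T^n must carry the growth.
  have h3 : (growthRate ρ p n : ℂ) • P Λ = Q n (Λ.comp (T ^ n)) - R Λ := by
    rw [← precompCLM_pow_apply, hR]
    simp
  have h4 : ‖(growthRate ρ p n : ℂ) • P Λ‖ = growthRate ρ p n * ‖P Λ‖ := by
    rw [norm_smul, Complex.norm_real, Real.norm_of_nonneg hg.le]
  have h5 : ‖Q n (Λ.comp (T ^ n))‖ ≤ C * ‖ℓ.comp (T ^ n)‖ := by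
    refine ((Q n).le_opNorm _).trans ?_
    rw [hΛdef, ContinuousLinearMap.comp_assoc, norm_ofReal_comp]
    exact mul_le_mul_of_nonneg_right h1 (norm_nonneg _)
  have h6 : ‖R Λ‖ ≤ ‖P Λ‖ / 2 * growthRate ρ p n := by
    refine (R.le_opNorm _).trans ((mul_le_mul_of_nonneg_right h2 (norm_nonneg _)).trans ?_)
    have h7 : ‖P Λ‖ / 2 / (‖Λ‖ + 1) * growthRate ρ p n * ‖Λ‖ =
        ‖P Λ‖ / 2 * growthRate ρ p n * (‖Λ‖ / (‖Λ‖ + 1)) := by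
      field_simp
    rw [h7]
    exact mul_le_of_le_one_right (by positivity) ((div_le_one hΛ).2 (by linarith))
  have h7 := norm_sub_le (Q n (Λ.comp (T ^ n))) (R Λ)
  rw [← h3, h4] at h7
  rw [div_mul_eq_mul_div, div_le_iff₀ hC]
  linarith

end Dual

end NondenseOrbits


namespace NondenseOrbits

open Set Filter

/-! ### Iterates of a map with an expanding linear part. -/

section Iteration

theorem growthRate_mono {ρ : ℝ} (hρ : 1 ≤ ρ) (p : ℕ) : Monotone (growthRate ρ p) :=
  monotone_nat_of_le_succ fun n =>
    (le_mul_of_one_le_left (growthRate_pos (by linarith) p n).le hρ).trans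
      (mul_growthRate_le (by linarith) p n)

/-- Relative to the right side, the term with i = n - 1 - j is at most (i+1)^p ρ^(-(i+1)), which is
summable because ρ > 1. This controls the accumulation of quadratic errors. -/
theorem exists_sum_growthRate_le {ρ : ℝ} (hρ : 1 < ρ) (p : ℕ) : ∃ K : ℝ, 0 < K ∧ ∀ n,
    ∑ j ∈ Finset.range n, growthRate ρ p (n - 1 - j) * growthRate ρ p j ^ 2 ≤
      K * growthRate ρ p n ^ 2 := by
  have hρ0 : 0 < ρ := by linarith
  let f : ℕ → ℝ := fun j => ((j + 1 : ℕ) : ℝ) ^ p * (1 / ρ) ^ (j + 1)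
  have hf0 : ∀ j, 0 ≤ f j := fun j => by positivity
  have hf : Summable f := by
    have h1 : Summable fun j : ℕ => (j : ℝ) ^ p * (1 / ρ) ^ j :=
      summable_pow_mul_geometric_of_norm_lt_one p (by
        rw [Real.norm_of_nonneg (by positivity), div_lt_one hρ0]
        exact hρ)
    exact (summable_nat_add_iff 1).2 h1
  refine ⟨∑' j, f j + 1, by have : 0 ≤ ∑' j, f j := tsum_nonneg hf0; linarith, fun n => ?_⟩
  have h1 : ∀ j ∈ Finset.range n, growthRate ρ p (n - 1 - j) * growthRate ρ p j ^ 2 ≤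
      f (n - 1 - j) * growthRate ρ p n ^ 2 := by
    intro j hj
    obtain ⟨i, rfl⟩ := Nat.exists_eq_add_of_lt (Finset.mem_range.1 hj)
    have h2 : j + i + 1 - 1 - j = i := by omega
    rw [h2]
    have h3 : f i * growthRate ρ p (j + i + 1) ^ 2 =
        (ρ * ρ ^ i * (i + 1) ^ p * ρ ^ j * ρ ^ j) * ((((j + i + 1 : ℕ) : ℝ) + 1) ^ p) ^ 2 := by
      simp only [f, growthRate, one_div, inv_pow]
      push_cast
      field_simp
      ring
    rw [h3]
    have h4 : growthRate ρ p i * growthRate ρ p j ^ 2 =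
        (1 * ρ ^ i * (i + 1) ^ p * ρ ^ j * ρ ^ j) * (((j : ℝ) + 1) ^ p) ^ 2 := by
      unfold growthRate
      ring
    rw [h4]
    gcongr
    linarith [Nat.cast_nonneg (α := ℝ) i]
  refine (Finset.sum_le_sum h1).trans ?_
  rw [← Finset.sum_mul, Finset.sum_range_reflect f n]
  refine mul_le_mul_of_nonneg_right ?_ (by positivity)
  linarith [hf.sum_le_tsum (Finset.range n) fun j _ => hf0 j]

variable {E : Type*} [NormedAddCommGroup E] [NormedSpace ℝ E]

/-- Discrete variation of constants: the error made at step j is propagated by the remaining powers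
of `T`. -/
theorem iterate_sub_pow_apply (T : E →L[ℝ] E) (c : E → E) (v : E) (n : ℕ) :
    c^[n] v - (T ^ n) v =
      ∑ j ∈ Finset.range n, (T ^ (n - 1 - j)) (c (c^[j] v) - T (c^[j] v)) := by
  induction n with
  | zero => simp
  | succ n ih =>
    have h1 : ∑ j ∈ Finset.range n, (T ^ (n + 1 - 1 - j)) (c (c^[j] v) - T (c^[j] v)) =
        T (c^[n] v - (T ^ n) v) := by
      rw [ih, map_sum]
      refine Finset.sum_congr rfl fun j hj => ?_
      have := Finset.mem_range.1 hj
      rw [show n + 1 - 1 - j = (n - 1 - j) + 1 by omega, pow_succ']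
      rfl
    rw [Finset.sum_range_succ, h1, Nat.add_sub_cancel, Nat.sub_self, pow_zero,
      Function.iterate_succ_apply', pow_succ', map_sub]
    simp

/-- The iterates of a map that is tangent to `T` to second order at the fixed point `0` stay close
to the powers of `T`, as long as they stay close to `0`. -/
theorem exists_iterate_bound {ρ : ℝ} (hρ : 1 < ρ) {p : ℕ} {T : E →L[ℝ] E} {C : ℝ} (hC : 1 ≤ C)
    (hT : ∀ n, ‖T ^ n‖ ≤ C * growthRate ρ p n) {c : E → E} {R C₁ : ℝ} (hR : 0 < R) (hC₁ : 0 ≤ C₁)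
    (hc : ∀ w, ‖w‖ ≤ R → ‖c w - T w‖ ≤ C₁ * ‖w‖ ^ 2) :
    ∃ δ₀ C₂ : ℝ, 0 < δ₀ ∧ 0 ≤ C₂ ∧ ∀ (n : ℕ) (r : ℝ) (v : E), growthRate ρ p n * r ≤ δ₀ → ‖v‖ ≤ r →
      (∀ j ≤ n, ‖c^[j] v‖ ≤ 2 * C * (growthRate ρ p j * r) ∧ ‖c^[j] v‖ ≤ R) ∧
      ‖c^[n] v - (T ^ n) v‖ ≤ C₂ * (growthRate ρ p n * r) ^ 2 := by
  obtain ⟨K, hK, hKs⟩ := exists_sum_growthRate_le hρ p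
  set C₂ := C * C₁ * (2 * C) ^ 2 * K
  have hC₂ : 0 ≤ C₂ := by positivity
  -- The first bound keeps the iterates in the ball of radius `R`. The second makes the accumulated
  -- error at most the linear bound C · growth · r, which closes the induction with constant 2C.
  refine ⟨min (R / (2 * C)) (C / (C₂ + 1)), C₂, by positivity, hC₂, fun n r v hn hv => ?_⟩
  have hr : 0 ≤ r := (norm_nonneg v).trans hv
  have hτ := fun j => growthRate_pos (show 0 < ρ by linarith) p j
  have hsmall : ∀ j ≤ n, growthRate ρ p j * r ≤ min (R / (2 * C)) (C / (C₂ + 1)) := fun j hj =>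
    (mul_le_mul_of_nonneg_right (growthRate_mono hρ.le p hj) hr).trans hn
  have hsmall1 : ∀ j ≤ n, 2 * C * (growthRate ρ p j * r) ≤ R := fun j hj => by
    have := (hsmall j hj).trans (min_le_left _ _)
    rw [le_div_iff₀ (by positivity)] at this
    linarith
  have hsmall2 : ∀ j ≤ n, C₂ * (growthRate ρ p j * r) ≤ C := fun j hj => by
    have h1 := (hsmall j hj).trans (min_le_right _ _)
    rw [le_div_iff₀ (by positivity)] at h1
    have h2 := mul_nonneg (hτ j).le hr
    nlinarith
  have herr : ∀ m ≤ n, (∀ j < m, ‖c^[j] v‖ ≤ 2 * C * (growthRate ρ p j * r)) →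
      ‖c^[m] v - (T ^ m) v‖ ≤ C₂ * (growthRate ρ p m * r) ^ 2 := by
    intro m hm hj
    rw [iterate_sub_pow_apply]
    refine (norm_sum_le _ _).trans ?_
    have h1 : ∀ j ∈ Finset.range m, ‖(T ^ (m - 1 - j)) (c (c^[j] v) - T (c^[j] v))‖ ≤
        (C * C₁ * (2 * C) ^ 2 * r ^ 2) *
          (growthRate ρ p (m - 1 - j) * growthRate ρ p j ^ 2) := fun j hjm => by
      have hjm' := Finset.mem_range.1 hjm
      have h2 := hj j hjm'
      have h3 := hc _ (h2.trans (hsmall1 j (by omega)))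
      refine ((T ^ (m - 1 - j)).le_opNorm _).trans ?_
      refine (mul_le_mul (hT _) (h3.trans (mul_le_mul_of_nonneg_left
        (pow_le_pow_left₀ (norm_nonneg _) h2 2) hC₁)) (norm_nonneg _)
        (mul_nonneg (by linarith) (hτ _).le)).trans (le_of_eq ?_)
      ring
    refine (Finset.sum_le_sum h1).trans ?_
    rw [← Finset.mul_sum]
    refine (mul_le_mul_of_nonneg_left (hKs m) (by positivity)).trans (le_of_eq ?_)
    ring
  have hmain : ∀ m ≤ n, ‖c^[m] v‖ ≤ 2 * C * (growthRate ρ p m * r) := by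
    intro m
    induction m using Nat.strong_induction_on with
    | _ m ih =>
      intro hm
      have h1 := herr m hm fun j hj => ih j hj (by omega)
      have h2 := hsmall2 m hm
      have h0 := mul_nonneg (hτ m).le hr
      have h3 : ‖(T ^ m) v‖ ≤ C * (growthRate ρ p m * r) := by
        rw [← mul_assoc]
        exact ((T ^ m).le_opNorm v).trans (mul_le_mul (hT m) hv (norm_nonneg _)
          (mul_nonneg (by linarith) (hτ m).le))
      have h4 := norm_le_norm_sub_add (c^[m] v) ((T ^ m) v)
      nlinarith
  exact ⟨fun j hj => ⟨hmain j hj, (hmain j hj).trans (hsmall1 j hj)⟩,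
    herr n le_rfl fun j hj => hmain j hj.le⟩

end Iteration

end NondenseOrbits


namespace NondenseOrbits

open Set Filter

/-! ### Centred coordinates and the smooth action on the quotient. -/

section Charts

set_option linter.unusedSectionVars false

variable {E : Type*} [NormedAddCommGroup E] [NormedSpace ℝ E]
  {E' : Type*} [NormedAddCommGroup E'] [NormedSpace ℝ E']
  {M : Type*} [TopologicalSpace M] [ChartedSpace E M]
  {M' : Type*} [TopologicalSpace M'] [ChartedSpace E' M']

variable (E) in
/-- The inverse of the preferred chart at `x`, translated so that it maps `0` to `x`. -/
noncomputable def centeredParam (x : M) (w : E) : M := (chartAt E x).symm (chartAt E x x + w)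

theorem centeredParam_zero (x : M) : centeredParam E x 0 = x := by
  rw [centeredParam, add_zero, (chartAt E x).left_inv (mem_chart_source E x)]

theorem contMDiffAt_centeredParam {n : ℕ∞ω} [IsManifold 𝓘(ℝ, E) n M] (x : M) :
    ContMDiffAt 𝓘(ℝ, E) 𝓘(ℝ, E) n (centeredParam E x) 0 := by
  have h1 : ContMDiffAt 𝓘(ℝ, E) 𝓘(ℝ, E) n (chartAt E x).symm (chartAt E x x + 0) :=
    (contMDiffOn_chart_symm (x := x)).contMDiffAt ((chartAt E x).open_target.mem_nhds (by
      rw [add_zero]; exact mem_chart_target E x))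
  have h2 : ContMDiffAt 𝓘(ℝ, E) 𝓘(ℝ, E) n (fun w : E => chartAt E x x + w) 0 :=
    (contDiffAt_const.add contDiffAt_id).contMDiffAt
  exact h1.comp (0 : E) h2

theorem contMDiffAt_chartAt {n : ℕ∞ω} [IsManifold 𝓘(ℝ, E) n M] (x : M) :
    ContMDiffAt 𝓘(ℝ, E) 𝓘(ℝ, E) n (chartAt E x) x :=
  (contMDiffOn_chart (x := x)).contMDiffAt ((chartAt E x).open_source.mem_nhds
    (mem_chart_source E x))

theorem eventually_chartAt_centeredParam (x : M) :
    ∀ᶠ w in 𝓝 (0 : E), chartAt E x (centeredParam E x w) - chartAt E x x = w := by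
  have h1 : ∀ᶠ w in 𝓝 (0 : E), chartAt E x x + w ∈ (chartAt E x).target := by
    have : ContinuousAt (fun w : E => chartAt E x x + w) 0 := by fun_prop
    exact this.eventually_mem ((chartAt E x).open_target.mem_nhds (by
      rw [add_zero]; exact mem_chart_target E x))
  filter_upwards [h1] with w hw
  rw [centeredParam, (chartAt E x).right_inv hw, add_sub_cancel_left]

theorem eventually_centeredParam_chartAt (x : M) :
    ∀ᶠ y in 𝓝 x, centeredParam E x (chartAt E x y - chartAt E x x) = y := by
  filter_upwards [(chartAt E x).open_source.mem_nhds (mem_chart_source E x)] with y hy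
  rw [centeredParam, add_sub_cancel, (chartAt E x).left_inv hy]

/-- The manifold derivative is by definition the derivative in the preferred charts; centring is a
translation. The separate `y` and `A` avoid casts between tangent spaces. -/
theorem hasFDerivAt_chartAt_comp_centeredParam {f : M → M'} {x : M} {y : M'} (hxy : f x = y)
    (hf : MDifferentiableAt 𝓘(ℝ, E) 𝓘(ℝ, E') f x) {A : E →L[ℝ] E'}
    (hA : A = mfderiv 𝓘(ℝ, E) 𝓘(ℝ, E') f x) :
    HasFDerivAt (fun w => chartAt E' y (f (centeredParam E x w))) A 0 := by
  subst hxy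
  have h1 : HasFDerivWithinAt (fun v => chartAt E' (f x) (f ((chartAt E x).symm v)))
      A (range 𝓘(ℝ, E)) (chartAt E x x) := by
    rw [hA]
    exact hf.hasMFDerivAt.2
  rw [ModelWithCorners.range_eq_univ, hasFDerivWithinAt_univ] at h1
  have h2 : HasFDerivAt (fun w : E => chartAt E x x + w) (ContinuousLinearMap.id ℝ E) 0 :=
    (hasFDerivAt_id (0 : E)).const_add _
  have h3 : HasFDerivAt (fun v => chartAt E' (f x) (f ((chartAt E x).symm v)))
      A (chartAt E x x + 0) := by
    rw [add_zero]
    exact h1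
  exact h3.comp (0 : E) h2

end Charts

section Quotient

variable {E : Type*} [NormedAddCommGroup E] [NormedSpace ℝ E]
  {G : Type*} [TopologicalSpace G] [ChartedSpace E G] [Group G] [LieGroup 𝓘(ℝ, E) ∞ G]
  {Γ : Subgroup G} [DiscreteTopology Γ]

theorem contMDiff_mk : ContMDiff 𝓘(ℝ, E) 𝓘(ℝ, E) ∞ (QuotientGroup.mk : G → G ⧸ Γ) := by
  intro a
  set hf := isLocalHomeomorph_mk E Γ
  set b : G := (QuotientGroup.mk_surjective (s := Γ)).hasRightInverse.choose (a : G ⧸ Γ)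
  have hb : (b : G ⧸ Γ) = a := (QuotientGroup.mk_surjective (s := Γ)).hasRightInverse.choose_spec _
  have hmem : (a : G ⧸ Γ) ∈ (hf.localInverseAt b).source := by
    rw [← hb]
    exact hf.apply_self_mem_localInverseAt_source
  obtain ⟨γ, hγ⟩ := localInverse_eventuallyEq (E := E) Γ b a hmem
  refine contMDiffAt_iff_target.2 ⟨hf.continuous.continuousAt, ?_⟩
  have h1 : (fun y : G => chartAt E b (y * γ)) =ᶠ[𝓝 a]
      extChartAt 𝓘(ℝ, E) (a : G ⧸ Γ) ∘ QuotientGroup.mk :=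
    hγ.mono fun y hy => (congrArg (chartAt E b) hy).symm
  refine ContMDiffAt.congr_of_eventuallyEq ?_ h1.symm
  have hab : a * γ = b := by
    rw [← hγ.self_of_nhds, ← hb]
    exact hf.localInverseAt_apply_self
  have h2 : ContMDiffAt 𝓘(ℝ, E) 𝓘(ℝ, E) ∞ (chartAt E b) (a * γ) := by
    rw [hab]
    exact contMDiffAt_chartAt b
  exact h2.comp a (contMDiffAt_mul_right (a := γ))

variable (E) in
theorem exists_section (x : G ⧸ Γ) : ∃ s : G ⧸ Γ → G, ContMDiffAt 𝓘(ℝ, E) 𝓘(ℝ, E) ∞ s x ∧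
    (∀ᶠ y in 𝓝 x, (s y : G ⧸ Γ) = y) ∧ ∀ᶠ a : G in 𝓝 (s x), s (a : G ⧸ Γ) = a := by
  set hf := isLocalHomeomorph_mk E Γ
  set b : G := (QuotientGroup.mk_surjective (s := Γ)).hasRightInverse.choose x
  have hb : (b : G ⧸ Γ) = x := (QuotientGroup.mk_surjective (s := Γ)).hasRightInverse.choose_spec _
  have hmem : x ∈ (hf.localInverseAt b).source := by
    have := hf.apply_self_mem_localInverseAt_source (x := b)
    rwa [hb] at this
  have hx : hf.localInverseAt b x = b := by
    have := hf.localInverseAt_apply_self (x := b)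
    rwa [hb] at this
  refine ⟨hf.localInverseAt b, ?_, ?_, ?_⟩
  · have h1 : ContMDiffAt 𝓘(ℝ, E) 𝓘(ℝ, E) ∞ (chartAt E b).symm (chartAt E x x) :=
      (contMDiffOn_chart_symm (x := b)).contMDiffAt ((chartAt E b).open_target.mem_nhds (by
        change chartAt E b (hf.localInverseAt b x) ∈ _
        rw [hx]
        exact mem_chart_target E b))
    refine (h1.comp x (contMDiffAt_chartAt x)).congr_of_eventuallyEq ?_
    filter_upwards [(chartAt E x).open_source.mem_nhds (mem_chart_source E x)] with y hy
    exact ((chartAt E b).left_inv hy.2).symm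
  · filter_upwards [(hf.localInverseAt b).open_source.mem_nhds hmem] with y hy
    exact hf.apply_localInverseAt_of_mem hy
  · filter_upwards [(hf.localInverseAt b).open_target.mem_nhds
      ((hf.localInverseAt b).map_source hmem)] with a ha
    have := (hf.localInverseAt b).right_inv ha
    rwa [hf.localInverseAt_symm] at this

/-- Lift the point to the group by a smooth local section, multiply there, and project back. -/
theorem contMDiffAt_smul {F : Type*} [NormedAddCommGroup F] [NormedSpace ℝ F] {H : Type*}
    [TopologicalSpace H] {I : ModelWithCorners ℝ F H} {M : Type*} [TopologicalSpace M]
    [ChartedSpace H M] {n : ℕ∞ω} (hn : n ≤ ∞) {α : M → G} {ζ : M → G ⧸ Γ} {m : M}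
    (hα : ContMDiffAt I 𝓘(ℝ, E) n α m) (hζ : ContMDiffAt I 𝓘(ℝ, E) n ζ m) :
    ContMDiffAt I 𝓘(ℝ, E) n (fun p => α p • ζ p) m := by
  have : LieGroup 𝓘(ℝ, E) n G := LieGroup.of_le hn
  obtain ⟨s, hs, hs1, -⟩ := exists_section E (ζ m)
  have h1 : ContMDiffAt I 𝓘(ℝ, E) n (fun p => (α p * s (ζ p) : G)) m :=
    hα.mul ((hs.of_le hn).comp m hζ)
  have h2 := ((contMDiff_mk (E := E) (Γ := Γ)).of_le hn).contMDiffAt.comp m h1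
  refine h2.congr_of_eventuallyEq ?_
  filter_upwards [hζ.continuousAt.eventually hs1] with p hp
  conv_lhs => rw [← hp]
  rfl

end Quotient

/-! ### Displacement of nearby points by group elements. -/

section Displacement

variable {E : Type*} [NormedAddCommGroup E] [NormedSpace ℝ E]
  {G : Type*} [TopologicalSpace G] [ChartedSpace E G] [Group G] [LieGroup 𝓘(ℝ, E) ∞ G]
  {Γ : Subgroup G} [DiscreteTopology Γ]

/-- In the coordinates given by a translated chart, nearby points differ by the action of a group
element whose coordinates depend on the points in a strictly differentiable way. -/
theorem exists_displacement (b : G) {φ : OpenPartialHomeomorph (G ⧸ Γ) E}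
    (hφ : φ ∈ IsManifold.maximalAtlas 𝓘(ℝ, E) 1 (G ⧸ Γ)) {u : E} (hu : u ∈ φ.target) :
    ∃ A B : E →L[ℝ] E, (∀ w, A (B w) = w) ∧ ∀ η : ℝ, 0 < η → ∃ O ∈ 𝓝 u, ∀ u₁ ∈ O, ∀ u₂ ∈ O,
      ∃ v : E, centeredParam E (1 : G) v • (b • φ.symm u₁) = b • φ.symm u₂ ∧
        ‖v - A (u₂ - u₁)‖ ≤ η * ‖u₂ - u₁‖ := by
  have := topologicalGroup_of_lieGroup 𝓘(ℝ, E) ∞ (G := G)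
  have : LieGroup 𝓘(ℝ, E) 1 G := LieGroup.of_le (n := ∞) (by simp)
  have : IsManifold 𝓘(ℝ, E) 1 (G ⧸ Γ) := IsManifold.of_le (n := ∞) (by simp)
  set κ := centeredParam E (1 : G)
  set ζ : E → G ⧸ Γ := fun u => b • φ.symm u with hζdef
  have hζ : ContMDiffAt 𝓘(ℝ, E) 𝓘(ℝ, E) 1 ζ u :=
    contMDiffAt_smul (by simp) contMDiffAt_const
      ((contMDiffOn_symm_of_mem_maximalAtlas hφ).contMDiffAt (φ.open_target.mem_nhds hu))
  obtain ⟨s, hs, hs1, hs2⟩ := exists_section E (ζ u)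
  have hl : ContMDiffAt 𝓘(ℝ, E) 𝓘(ℝ, E) 1 (fun p => s (ζ p)) u :=
    (hs.of_le (by simp)).comp u hζ
  -- The logarithm-like coordinate of the element carrying the second point to the first. It
  -- vanishes on the diagonal, so strict differentiability at `(u, u)` leaves only the partial
  -- derivative in the first variable.
  let v : E × E → E := fun p => chartAt E (1 : G) (s (ζ p.1) * (s (ζ p.2))⁻¹) -
    chartAt E (1 : G) 1
  have hmul : ContMDiffAt 𝓘(ℝ, E × E) 𝓘(ℝ, E) 1
      (fun p : E × E => s (ζ p.1) * (s (ζ p.2))⁻¹) (u, u) := by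
    have h1 : ContMDiffAt 𝓘(ℝ, E × E) 𝓘(ℝ, E) 1 (fun p : E × E => s (ζ p.1)) (u, u) :=
      ContMDiffAt.comp (u, u) (g := fun p => s (ζ p)) hl contDiff_fst.contMDiff.contMDiffAt
    have h2 : ContMDiffAt 𝓘(ℝ, E × E) 𝓘(ℝ, E) 1 (fun p : E × E => s (ζ p.2)) (u, u) :=
      ContMDiffAt.comp (u, u) (g := fun p => s (ζ p)) hl contDiff_snd.contMDiff.contMDiffAt
    exact h1.mul h2.inv
  have hone : s (ζ u) * (s (ζ u))⁻¹ = 1 := mul_inv_cancel _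
  have hv : ContDiffAt ℝ 1 v (u, u) := by
    have h1 : ContMDiffAt 𝓘(ℝ, E) 𝓘(ℝ, E) 1 (chartAt E (1 : G)) (s (ζ u) * (s (ζ u))⁻¹) := by
      rw [hone]
      exact contMDiffAt_chartAt 1
    exact (contMDiffAt_iff_contDiffAt.1 (h1.comp (u, u) hmul)).sub contDiffAt_const
  have hvs := hv.hasStrictFDerivAt (by simp)
  set D := fderiv ℝ v (u, u)
  have hdiag : ∀ p, v (p, p) = 0 := fun p => by simp only [v, mul_inv_cancel, sub_self]
  let ξ : E → E := fun w => φ (b⁻¹ • (κ w • ζ u))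
  have hξ0 : b⁻¹ • (κ 0 • ζ u) = φ.symm u := by
    simp only [κ, hζdef, centeredParam_zero, one_smul, inv_smul_smul]
  have hκ : ContMDiffAt 𝓘(ℝ, E) 𝓘(ℝ, E) 1 κ 0 := contMDiffAt_centeredParam 1
  have hcurve : ContMDiffAt 𝓘(ℝ, E) 𝓘(ℝ, E) 1 (fun w => b⁻¹ • (κ w • ζ u)) 0 :=
    contMDiffAt_smul (by simp) contMDiffAt_const
      (contMDiffAt_smul (by simp) hκ contMDiffAt_const)
  have hsrc : φ.symm u ∈ φ.source := φ.map_target hu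
  have hξ : ContDiffAt ℝ 1 ξ 0 := by
    have h1 : ContMDiffAt 𝓘(ℝ, E) 𝓘(ℝ, E) 1 φ (b⁻¹ • (κ 0 • ζ u)) := by
      rw [hξ0]
      exact (contMDiffOn_of_mem_maximalAtlas hφ).contMDiffAt (φ.open_source.mem_nhds hsrc)
    exact contMDiffAt_iff_contDiffAt.1 (h1.comp (0 : E) hcurve)
  have hξu : ξ 0 = u := by
    simp only [ξ, hξ0]
    exact φ.right_inv hu
  -- Differentiating this identity gives the right inverse `B`, namely the derivative of ξ.
  have hid : (fun w => v (ξ w, u)) =ᶠ[𝓝 0] id := by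
    have h1 : ∀ᶠ w in 𝓝 (0 : E), b⁻¹ • (κ w • ζ u) ∈ φ.source :=
      hcurve.continuousAt.eventually_mem (φ.open_source.mem_nhds (by rw [hξ0]; exact hsrc))
    have h2 : ∀ᶠ w in 𝓝 (0 : E), s ((κ w * s (ζ u) : G) : G ⧸ Γ) = κ w * s (ζ u) := by
      have h3 : Tendsto (fun w => κ w * s (ζ u)) (𝓝 0) (𝓝 (κ 0 * s (ζ u))) :=
        hκ.continuousAt.mul continuousAt_const
      simp only [κ, centeredParam_zero, one_mul] at h3
      exact h3.eventually hs2
    filter_upwards [h1, h2, eventually_chartAt_centeredParam (E := E) (1 : G)] with w h1 h2 h3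
    have h4 : ζ (ξ w) = κ w • ζ u := by
      simp only [hζdef, ξ]
      rw [φ.left_inv h1, smul_inv_smul]
    have h5 : κ w • ζ u = ((κ w * s (ζ u) : G) : G ⧸ Γ) := by
      conv_lhs => rw [← hs1.self_of_nhds]
      rfl
    simp only [v, h4]
    rw [h5, h2, mul_inv_cancel_right]
    exact h3
  refine ⟨D.comp (ContinuousLinearMap.inl ℝ E E), fderiv ℝ ξ 0, fun w => ?_, fun η hη => ?_⟩
  · have h1 : HasFDerivAt (fun w => (ξ w, u)) ((fderiv ℝ ξ 0).prod 0) 0 :=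
      (hξ.differentiableAt (by simp)).hasFDerivAt.prodMk (hasFDerivAt_const u 0)
    have h2 : HasFDerivAt v D (ξ 0, u) := by
      rw [hξu]
      exact hvs.hasFDerivAt
    have h3 := (h2.comp (0 : E) h1).congr_of_eventuallyEq hid.symm
    have h4 := congrArg (fun L => L w) (h3.unique (hasFDerivAt_id (0 : E)))
    simpa using h4
  · have h1 := hvs.isLittleO.def hη
    have h2 : ∀ᶠ p : E × E in 𝓝 (u, u), κ (v p) = s (ζ p.1) * (s (ζ p.2))⁻¹ := by
      refine hmul.continuousAt.eventually (p := fun a => κ (chartAt E (1 : G) a -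
        chartAt E (1 : G) 1) = a) ?_
      simp only [hone]
      exact eventually_centeredParam_chartAt 1
    have h3 : ∀ᶠ p in 𝓝 u, (s (ζ p) : G ⧸ Γ) = ζ p := hζ.continuousAt.eventually hs1
    obtain ⟨O₁, hO₁, h1'⟩ := (eventually_prod_self_iff (la := 𝓝 u)
      (r := fun p q => κ (v (p, q)) = s (ζ p) * (s (ζ q))⁻¹)).1 (by rwa [← nhds_prod_eq])
    have h4' : ∀ᶠ p : E × E in 𝓝 (u, u), ‖v (p.1, p.2) - v (p.2, p.2) -
        D ((p.1, p.2) - (p.2, p.2))‖ ≤ η * ‖(p.1, p.2) - (p.2, p.2)‖ := by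
      have h4 : ContinuousAt (fun p : E × E => ((p.1, p.2), (p.2, p.2))) (u, u) := by fun_prop
      exact h4.eventually h1
    obtain ⟨O₂, hO₂, h2'⟩ := (eventually_prod_self_iff (la := 𝓝 u)
      (r := fun p q => ‖v (p, q) - v (q, q) - D ((p, q) - (q, q))‖ ≤ η * ‖(p, q) - (q, q)‖)).1
      (by rwa [← nhds_prod_eq])
    refine ⟨_, inter_mem (inter_mem hO₁ hO₂) h3, fun u₁ hu₁ u₂ hu₂ => ⟨v (u₂, u₁), ?_, ?_⟩⟩
    · have h5 : b • φ.symm u₁ = ((s (ζ u₁) : G) : G ⧸ Γ) := hu₁.2.symm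
      have h6 : b • φ.symm u₂ = ((s (ζ u₂) : G) : G ⧸ Γ) := hu₂.2.symm
      rw [h1' u₂ hu₂.1.1 u₁ hu₁.1.1, h5, h6]
      change ((s (ζ u₂) * (s (ζ u₁))⁻¹ * s (ζ u₁) : G) : G ⧸ Γ) = _
      rw [inv_mul_cancel_right]
    · have h4 := h2' u₂ hu₂.1.2 u₁ hu₁.1.2
      simpa [hdiag, Prod.norm_def] using h4

end Displacement

end NondenseOrbits


namespace NondenseOrbits

open Set Filter Metric

/-! ### Conjugation in coordinates and uniform linearization of functions. -/

section Conjugation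

variable {E : Type*} [NormedAddCommGroup E] [NormedSpace ℝ E]

/-- The derivative of `c` differs from `T` by O(‖x‖); apply the mean value inequality on the ball of
radius ‖w‖. -/
theorem exists_quadratic_bound {c : E → E} {T : E →L[ℝ] E} (hc : ContDiffAt ℝ 2 c 0)
    (hT : HasFDerivAt c T 0) (h0 : c 0 = 0) :
    ∃ R C : ℝ, 0 < R ∧ 0 ≤ C ∧ ∀ w, ‖w‖ ≤ R → ‖c w - T w‖ ≤ C * ‖w‖ ^ 2 := by
  have h1 : ContDiffAt ℝ 1 (fderiv ℝ c) 0 := hc.fderiv_right (by norm_num)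
  obtain ⟨C, hC⟩ := (h1.differentiableAt (by simp)).isBigO_sub.bound
  have h2 : ∀ᶠ w in 𝓝 (0 : E), DifferentiableAt ℝ c w :=
    (hc.eventually (by simp)).mono fun w hw => hw.differentiableAt (by simp)
  obtain ⟨R, hR, hRb⟩ := Metric.nhds_basis_closedBall.eventually_iff.1 (hC.and h2)
  refine ⟨R, max C 0, hR, le_max_right _ _, fun w hw => ?_⟩
  have h3 : ∀ x ∈ closedBall (0 : E) ‖w‖, x ∈ closedBall (0 : E) R := fun x hx =>
    closedBall_subset_closedBall hw hx
  have h4 := Convex.norm_image_sub_le_of_norm_fderiv_le' (𝕜 := ℝ) (f := c) (φ := T)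
    (C := max C 0 * ‖w‖) (s := closedBall 0 ‖w‖) (x := 0) (y := w)
    (fun x hx => (hRb (h3 x hx)).2) (fun x hx => ?_) (convex_closedBall _ _)
    (mem_closedBall_self (norm_nonneg _)) (by simp)
  · rw [h0, sub_zero, sub_zero] at h4
    rwa [pow_two, ← mul_assoc]
  · have h5 := (hRb (h3 x hx)).1
    rw [hT.fderiv, sub_zero] at h5
    rw [mem_closedBall_zero_iff] at hx
    exact h5.trans (mul_le_mul (le_max_left _ _) hx (norm_nonneg _) (le_max_right _ _))

variable {G : Type*} [TopologicalSpace G] [ChartedSpace E G] [Group G] [LieGroup 𝓘(ℝ, E) ∞ G]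

/-- Conjugation by `a`, in the coordinates given by the preferred chart at `1`. -/
theorem exists_conj_bound (a : G) (T : E →L[ℝ] E) (hT : (T : E →ₗ[ℝ] E) = Ad a) :
    ∃ (c : E → E) (R C : ℝ), 0 < R ∧ 0 ≤ C ∧ ∀ w, ‖w‖ ≤ R →
      centeredParam E (1 : G) (c w) = a * centeredParam E (1 : G) w * a⁻¹ ∧
      ‖c w - T w‖ ≤ C * ‖w‖ ^ 2 := by
  have := topologicalGroup_of_lieGroup 𝓘(ℝ, E) ∞ (G := G)
  set κ := centeredParam E (1 : G)
  have hκ0 : κ 0 = 1 := centeredParam_zero 1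
  have hone : a * κ 0 * a⁻¹ = 1 := by rw [hκ0, mul_one, mul_inv_cancel]
  have hconj : ContMDiff 𝓘(ℝ, E) 𝓘(ℝ, E) ∞ fun h : G => a * h * a⁻¹ :=
    (contMDiff_mul_left (a := a)).mul contMDiff_const
  have hcomp : ContMDiffAt 𝓘(ℝ, E) 𝓘(ℝ, E) ∞ (fun w => a * κ w * a⁻¹) 0 :=
    hconj.contMDiffAt.comp (0 : E) (contMDiffAt_centeredParam 1)
  let c : E → E := fun w => chartAt E (1 : G) (a * κ w * a⁻¹) - chartAt E (1 : G) 1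
  have hc : ContDiffAt ℝ ∞ c 0 := by
    have h1 : ContMDiffAt 𝓘(ℝ, E) 𝓘(ℝ, E) ∞ (chartAt E (1 : G)) (a * κ 0 * a⁻¹) := by
      rw [hone]
      exact contMDiffAt_chartAt 1
    exact (contMDiffAt_iff_contDiffAt.1 (h1.comp (0 : E) hcomp)).sub contDiffAt_const
  have hcT : HasFDerivAt c T 0 := by
    have h1 : T = mfderiv 𝓘(ℝ, E) 𝓘(ℝ, E) (fun h : G => a * h * a⁻¹) 1 := by
      ext w
      exact congrArg (fun L : E →ₗ[ℝ] E => L w) hT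
    exact (hasFDerivAt_chartAt_comp_centeredParam (f := fun h : G => a * h * a⁻¹) (x := 1)
      (y := 1) (by simp) (hconj.mdifferentiable (by simp) 1) h1).sub_const _
  have hc0 : c 0 = 0 := by simp only [c, hone, sub_self]
  obtain ⟨R, C, hR, hC, hb⟩ := exists_quadratic_bound (hc.of_le (WithTop.coe_le_coe.2 (le_top : (2 : ℕ∞) ≤ ⊤))) hcT hc0
  have hev : ∀ᶠ w in 𝓝 (0 : E), κ (c w) = a * κ w * a⁻¹ := by
    have h1 := hcomp.continuousAt.tendsto
    rw [hone] at h1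
    exact h1.eventually (eventually_centeredParam_chartAt (E := E) (1 : G))
  obtain ⟨R', hR', hb'⟩ := Metric.nhds_basis_closedBall.eventually_iff.1 hev
  exact ⟨c, min R R', C, lt_min hR hR', hC, fun w hw =>
    ⟨hb' (mem_closedBall_zero_iff.2 (hw.trans (min_le_right _ _))),
      hb w (hw.trans (min_le_left _ _))⟩⟩

end Conjugation

section Linearization

variable {E : Type*} [NormedAddCommGroup E] [NormedSpace ℝ E] [FiniteDimensional ℝ E]
  {G : Type*} [TopologicalSpace G] [ChartedSpace E G] [Group G] [LieGroup 𝓘(ℝ, E) ∞ G]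
  {Γ : Subgroup G} [DiscreteTopology Γ]

/-- A `C¹` function `f` near `z` has the derivative `ℓ y` along the action of the group at `y`,
uniformly for `y` in a compact neighborhood of `z`. -/
theorem exists_linearization {f : G ⧸ Γ → ℝ} {z : G ⧸ Γ}
    (hf : ContMDiffAt 𝓘(ℝ, E) 𝓘(ℝ, ℝ) 1 f z) {ε : ℝ} (hε : 0 < ε) :
    ∃ K : Set (G ⧸ Γ), IsCompact K ∧ K ∈ 𝓝 z ∧ ∃ ℓ : G ⧸ Γ → E →L[ℝ] ℝ,
      (∀ y ∈ K, ContMDiffAt 𝓘(ℝ, E) 𝓘(ℝ, ℝ) 1 f y ∧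
        HasFDerivAt (fun w => f (centeredParam E (1 : G) w • y)) (ℓ y) 0 ∧ ‖ℓ y - ℓ z‖ < ε) ∧
      ∀ η : ℝ, 0 < η → ∀ᶠ w in 𝓝 (0 : E), ∀ y ∈ K,
        |f (centeredParam E (1 : G) w • y) - f y - ℓ y w| ≤ η * ‖w‖ := by
  have : LieGroup 𝓘(ℝ, E) 1 G := LieGroup.of_le (n := ∞) (by simp)
  have : IsManifold 𝓘(ℝ, E) 1 (G ⧸ Γ) := IsManifold.of_le (n := ∞) (by simp)
  have : ProperSpace E := FiniteDimensional.proper_real E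
  set κ := centeredParam E (1 : G)
  have hκ0 : κ 0 = 1 := centeredParam_zero 1
  set χ := chartAt E z
  have hz : z ∈ χ.source := mem_chart_source E z
  -- Displacement and base point are treated jointly: `F` is C¹ in both, and compactness in the
  -- second variable makes the linearization uniform.
  let F : E × E → ℝ := fun p => f (κ p.1 • χ.symm p.2)
  have hF : ContDiffAt ℝ 1 F (0, χ z) := by
    have h1 : ContMDiffAt 𝓘(ℝ, E × E) 𝓘(ℝ, E) 1 (fun p : E × E => κ p.1) (0, χ z) :=
      ContMDiffAt.comp (0, χ z) (g := κ) (contMDiffAt_centeredParam 1)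
        contDiff_fst.contMDiff.contMDiffAt
    have h2 : ContMDiffAt 𝓘(ℝ, E × E) 𝓘(ℝ, E) 1 (fun p : E × E => χ.symm p.2) (0, χ z) :=
      ContMDiffAt.comp (0, χ z) (g := χ.symm) ((contMDiffOn_chart_symm (x := z)).contMDiffAt
        (χ.open_target.mem_nhds (χ.map_source hz))) contDiff_snd.contMDiff.contMDiffAt
    have h3 : ContMDiffAt 𝓘(ℝ, E) 𝓘(ℝ, ℝ) 1 f (κ 0 • χ.symm (χ z)) := by
      rw [hκ0, one_smul, χ.left_inv hz]
      exact hf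
    exact contMDiffAt_iff_contDiffAt.1 (h3.comp (0, χ z) (contMDiffAt_smul (by simp) h1 h2))
  let ℓ' : E → E →L[ℝ] ℝ := fun q => (fderiv ℝ F (0, q)).comp (ContinuousLinearMap.inl ℝ E E)
  have hcont : ∀ q, ContDiffAt ℝ 1 F (0, q) → ContinuousAt ℓ' q := fun q hq => by
    have h1 : ContinuousAt (fderiv ℝ F) (0, q) :=
      (hq.fderiv_right (m := 0) (by norm_num)).continuousAt
    have h2 : ContinuousAt (fun q : E => ((0 : E), q)) q := by fun_prop
    have h3 : ContinuousAt (fun q => fderiv ℝ F (0, q)) q :=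
      ContinuousAt.comp (f := fun q : E => ((0 : E), q)) h1 h2
    exact h3.clm_comp continuousAt_const
  have hpair : ContinuousAt (fun q : E => ((0 : E), q)) (χ z) := by fun_prop
  have hev1 : ∀ᶠ q in 𝓝 (χ z), ContDiffAt ℝ 1 F (0, q) :=
    hpair.eventually (hF.eventually (by simp))
  have hev2 : ∀ᶠ q in 𝓝 (χ z), ‖ℓ' q - ℓ' (χ z)‖ < ε := by
    have h1 := (hcont _ hF).eventually (Metric.ball_mem_nhds _ hε)
    exact h1.mono fun q hq => by rwa [← dist_eq_norm]
  have hev3 : ∀ᶠ q in 𝓝 (χ z), ContMDiffAt 𝓘(ℝ, E) 𝓘(ℝ, ℝ) 1 f (χ.symm q) := by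
    have h1 : ContinuousAt χ.symm (χ z) := χ.continuousAt_symm (χ.map_source hz)
    have h2 : ∀ᶠ y in 𝓝 (χ.symm (χ z)), ContMDiffAt 𝓘(ℝ, E) 𝓘(ℝ, ℝ) 1 f y := by
      rw [χ.left_inv hz]
      exact (contMDiffAt_iff_contMDiffAt_nhds (by simp)).1 hf
    exact h1.eventually h2
  obtain ⟨r, hr, hrb⟩ := Metric.nhds_basis_closedBall.eventually_iff.1
    (((hev1.and hev2).and hev3).and (χ.open_target.mem_nhds (χ.map_source hz)))
  have hχ : ∀ q ∈ closedBall (χ z) r, χ (χ.symm q) = q := fun q hq => χ.right_inv (hrb hq).2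
  refine ⟨χ.symm '' closedBall (χ z) r, ?_, ?_, fun y => ℓ' (χ y), ?_, fun η hη => ?_⟩
  · exact (isCompact_closedBall _ _).image_of_continuousOn
      (χ.continuousOn_symm.mono fun q hq => (hrb hq).2)
  · filter_upwards [χ.open_source.mem_nhds hz,
      (χ.continuousAt hz).eventually (closedBall_mem_nhds _ hr)] with y hy hyr
    exact ⟨χ y, hyr, χ.left_inv hy⟩
  · rintro _ ⟨q, hq, rfl⟩
    obtain ⟨⟨⟨h1, h2⟩, h3⟩, h4⟩ := hrb hq
    simp only [hχ q hq]
    refine ⟨h3, ?_, h2⟩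
    have h5 : HasFDerivAt (fun w : E => (w, q)) (ContinuousLinearMap.inl ℝ E E) 0 :=
      hasFDerivAt_prodMk_left 0 q
    exact (h1.differentiableAt (by simp)).hasFDerivAt.comp (0 : E) h5
  · have h1 : ∀ q ∈ closedBall (χ z) r, ∀ᶠ p : E × E in 𝓝 (0, q),
        |F (p.1, p.2) - F (0, p.2) - ℓ' p.2 p.1| ≤ η * ‖p.1‖ := by
      intro q hq
      have h2 := (hrb hq).1.1.1
      have h3 := (h2.hasStrictFDerivAt (by simp)).isLittleO.def (half_pos hη)
      have h4 : ContinuousAt (fun p : E × E => ((p.1, p.2), ((0 : E), p.2))) (0, q) := by fun_prop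
      have h5 : ∀ᶠ p : E × E in 𝓝 (0, q), ‖ℓ' p.2 - ℓ' q‖ < η / 2 := by
        have h6 : ContinuousAt (fun p : E × E => ℓ' p.2) (0, q) :=
          ContinuousAt.comp (g := ℓ') (f := Prod.snd) (x := ((0 : E), q)) (hcont q h2) continuousAt_snd
        exact (h6.eventually (Metric.ball_mem_nhds _ (half_pos hη))).mono fun p hp => by
          rwa [← dist_eq_norm]
      filter_upwards [h4.eventually h3, h5] with p hp hp'
      have h7 : (p.1, p.2) - ((0 : E), p.2) = (p.1, 0) :=
        Prod.ext (by simp) (by simp)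
      simp only [h7] at hp
      have h8 : ‖((p.1, 0) : E × E)‖ = ‖p.1‖ := by simp [Prod.norm_def]
      rw [h8] at hp
      have h9 : |(ℓ' p.2 - ℓ' q) p.1| ≤ η / 2 * ‖p.1‖ :=
        ((ℓ' p.2 - ℓ' q).le_opNorm p.1).trans (mul_le_mul_of_nonneg_right hp'.le (norm_nonneg _))
      have h10 : ℓ' q p.1 = fderiv ℝ F (0, q) (p.1, 0) := rfl
      rw [Real.norm_eq_abs, ← h10] at hp
      have h11 : F (p.1, p.2) - F (0, p.2) - ℓ' p.2 p.1 =
          (F (p.1, p.2) - F (0, p.2) - ℓ' q p.1) - (ℓ' p.2 - ℓ' q) p.1 := by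
        rw [_root_.sub_apply]
        ring
      rw [h11]
      refine (abs_sub _ _).trans ?_
      linarith
    have h2 := (isCompact_closedBall (χ z) r).eventually_forall_of_forall_eventually
      (P := fun w q => |F (w, q) - F (0, q) - ℓ' q w| ≤ η * ‖w‖) h1
    filter_upwards [h2] with w hw
    rintro _ ⟨q, hq, rfl⟩
    have h3 := hw q hq
    simp only [F, hκ0, one_smul] at h3
    simpa only [hχ q hq] using h3

end Linearization

/-! ### Winning against a hypersurface and against its preimages under powers. -/

section Winning

variable {E : Type*} [NormedAddCommGroup E] [InnerProductSpace ℝ E] [FiniteDimensional ℝ E]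

theorem exists_slab_of_functional {L : E →L[ℝ] ℝ} (hL : L ≠ 0) {A : Set E} {x₁ : E} {θ : ℝ}
    (h : ∀ x ∈ A, |L (x - x₁)| ≤ θ * ‖L‖) :
    ∃ e : E, ‖e‖ = 1 ∧ ∃ t : ℝ, ∀ x ∈ A, |inner ℝ e x - t| ≤ θ := by
  have hL0 : 0 < ‖L‖ := norm_pos_iff.2 hL
  set g := (InnerProductSpace.toDual ℝ E).symm L with hg
  have hgL : ∀ x, inner ℝ g x = L x := fun x => InnerProductSpace.toDual_symm_apply
  have hgn : ‖g‖ = ‖L‖ := LinearIsometryEquiv.norm_map _ _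
  refine ⟨(‖L‖⁻¹ : ℝ) • g, ?_, inner ℝ ((‖L‖⁻¹ : ℝ) • g) x₁, fun x hx => ?_⟩
  · rw [norm_smul, norm_inv, norm_norm, hgn, inv_mul_cancel₀ hL0.ne']
  · rw [← inner_sub_right, real_inner_smul_left, hgL, abs_mul, abs_inv, abs_norm,
      inv_mul_le_iff₀ hL0, mul_comm]
    exact h x hx

variable {G : Type*} [TopologicalSpace G] [ChartedSpace E G] [Group G] [LieGroup 𝓘(ℝ, E) ∞ G]
  {Γ : Subgroup G} [DiscreteTopology Γ]

/-- The complement of a hypersurface is winning. -/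
theorem isShrinkHAWOn_compl_hypersurface [Nontrivial E] {f : G ⧸ Γ → ℝ} {K : Set (G ⧸ Γ)}
    (hK : IsClosed K) {ℓ : G ⧸ Γ → E →L[ℝ] ℝ}
    (hf : ∀ y ∈ K, ContMDiffAt 𝓘(ℝ, E) 𝓘(ℝ, ℝ) 1 f y ∧
      HasFDerivAt (fun w => f (centeredParam E (1 : G) w • y)) (ℓ y) 0 ∧ ℓ y ≠ 0) (b : G)
    {φ : OpenPartialHomeomorph (G ⧸ Γ) E}
    (hφ : φ ∈ IsManifold.maximalAtlas 𝓘(ℝ, E) 1 (G ⧸ Γ)) {β : ℝ} (hβ : 0 < β) (hβ' : β < 1 / 3) :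
    IsShrinkHAWOn β {u | ¬ (b • φ.symm u ∈ K ∧ f (b • φ.symm u) = 0)} φ.target := by
  have : LieGroup 𝓘(ℝ, E) 1 G := LieGroup.of_le (n := ∞) (by simp)
  obtain ⟨k, hk⟩ := exists_isShrinkHAWOn_of_slabs E hβ hβ' one_lt_two
  set D : Set E := {u | b • φ.symm u ∈ K ∧ f (b • φ.symm u) = 0}
  refine IsShrinkHAWOn.of_local hβ fun u hu => ?_
  have hζ : ContMDiffAt 𝓘(ℝ, E) 𝓘(ℝ, E) 1 (fun u => b • φ.symm u) u :=
    contMDiffAt_smul (by simp) contMDiffAt_const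
      ((contMDiffOn_symm_of_mem_maximalAtlas hφ).contMDiffAt (φ.open_target.mem_nhds hu))
  have hθ : ∀ r : ℝ, 0 < r → 0 < β / 4 * (β ^ k * r) := fun r hr => by positivity
  suffices h : ∃ O ∈ 𝓝 u, ∀ u' r, 0 < r → closedBall u' r ⊆ O → ∃ e : E, ‖e‖ = 1 ∧ ∃ t : ℝ,
      ∀ x ∈ D ∩ closedBall u' r, |inner ℝ e x - t| ≤ β / 4 * (β ^ k * r) by
    obtain ⟨O, hO, h⟩ := h
    -- A constant family with an artificial growth rate: eventual avoidance of it is avoidance of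
    -- `D`.
    refine ⟨O, hO, (hk O (fun _ => D) (fun n => 2 ^ n) 1 1 0 one_pos one_pos (fun n => by positivity)
      (fun n => (pow_succ' (2 : ℝ) n).ge)
      fun u' r n hr _ hsub _ _ _ => h u' r hr hsub).mono fun x _ hx => ?_⟩
    exact (Eventually.exists (f := (atTop : Filter ℕ)) hx).choose_spec
  by_cases hmem : b • φ.symm u ∈ K
  · obtain ⟨hfy, hfd, hne⟩ := hf _ hmem
    have hF : ContDiffAt ℝ 1 (fun u => f (b • φ.symm u)) u :=
      contMDiffAt_iff_contDiffAt.1 (hfy.comp u hζ)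
    set F := fun u => f (b • φ.symm u)
    have hF' := hF.hasStrictFDerivAt (by simp)
    set L := fderiv ℝ F u
    obtain ⟨A, B, hAB, hdisp⟩ := exists_displacement (E := E) b hφ hu
    -- Composing `F` with the coordinate curve of the group action recovers `f` along that action,
    -- whose derivative is `ℓ`.
    have hL : L ≠ 0 := by
      intro hL0
      apply hne
      have hsrc : φ.symm u ∈ φ.source := φ.map_target hu
      set κ := centeredParam E (1 : G)
      have hκ0 : κ 0 = 1 := centeredParam_zero 1
      have h0 : b⁻¹ • (κ 0 • (b • φ.symm u)) = φ.symm u := by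
        rw [hκ0, one_smul, inv_smul_smul]
      have hcurve : ContMDiffAt 𝓘(ℝ, E) 𝓘(ℝ, E) 1 (fun w => b⁻¹ • (κ w • (b • φ.symm u))) 0 :=
        contMDiffAt_smul (by simp) contMDiffAt_const
          (contMDiffAt_smul (by simp) (contMDiffAt_centeredParam 1) contMDiffAt_const)
      have h1 : ContMDiffAt 𝓘(ℝ, E) 𝓘(ℝ, E) 1 φ (b⁻¹ • (κ 0 • (b • φ.symm u))) := by
        rw [h0]
        exact (contMDiffOn_of_mem_maximalAtlas hφ).contMDiffAt (φ.open_source.mem_nhds hsrc)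
      have h2 : ContDiffAt ℝ 1 (fun w => φ (b⁻¹ • (κ w • (b • φ.symm u)))) 0 :=
        contMDiffAt_iff_contDiffAt.1 (h1.comp (0 : E) hcurve)
      have h3 : HasFDerivAt F L (φ (b⁻¹ • (κ 0 • (b • φ.symm u)))) := by
        rw [h0, φ.right_inv hu]
        exact hF'.hasFDerivAt
      have h4 := h3.comp (0 : E) (h2.differentiableAt (by simp)).hasFDerivAt
      have h5 : (F ∘ fun w => φ (b⁻¹ • (κ w • (b • φ.symm u)))) =ᶠ[𝓝 0]
          fun w => f (κ w • (b • φ.symm u)) := by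
        have h6 : ∀ᶠ w in 𝓝 (0 : E), b⁻¹ • (κ w • (b • φ.symm u)) ∈ φ.source :=
          hcurve.continuousAt.eventually_mem (φ.open_source.mem_nhds (by rw [h0]; exact hsrc))
        filter_upwards [h6] with w hw
        simp only [F, Function.comp_apply]
        rw [φ.left_inv hw, smul_inv_smul]
      have h7 := (h4.congr_of_eventuallyEq h5.symm).unique hfd
      rw [← h7, hL0, ContinuousLinearMap.zero_comp]
    have hLn : 0 < ‖L‖ := norm_pos_iff.2 hL
    have h1 := hF'.isLittleO.def (c := β / 4 * β ^ k * ‖L‖ / 2) (by positivity)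
    obtain ⟨O, hO, hOb⟩ := (eventually_prod_self_iff (la := 𝓝 u) (r := fun p q =>
      ‖F p - F q - L (p - q)‖ ≤ β / 4 * β ^ k * ‖L‖ / 2 * ‖p - q‖)).1 (by rwa [← nhds_prod_eq])
    refine ⟨O, hO, fun u' r hr hsub => ?_⟩
    rcases (D ∩ closedBall u' r).eq_empty_or_nonempty with hemp | ⟨x₁, hx₁, hx₁'⟩
    · obtain ⟨e, he⟩ := exists_norm_eq E (zero_le_one (α := ℝ))
      exact ⟨e, he, 0, by simp [hemp]⟩
    · refine exists_slab_of_functional hL (x₁ := x₁) fun x hx => ?_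
      have h2 := hOb x (hsub hx.2) x₁ (hsub hx₁')
      have h3 : ‖x - x₁‖ ≤ 2 * r := by
        rw [← dist_eq_norm]
        have := dist_triangle_right x x₁ u'
        have := mem_closedBall.1 hx.2
        have := mem_closedBall.1 hx₁'
        linarith
      have h4 : F x = 0 := hx.1.2
      have h5 : F x₁ = 0 := hx₁.2
      rw [h4, h5, sub_zero, zero_sub, norm_neg, Real.norm_eq_abs] at h2
      refine h2.trans ((mul_le_mul_of_nonneg_left h3 (by positivity)).trans (le_of_eq ?_))
      ring
  · have h1 : ∀ᶠ u' in 𝓝 u, b • φ.symm u' ∈ Kᶜ :=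
      hζ.continuousAt.eventually_mem (hK.isOpen_compl.mem_nhds hmem)
    refine ⟨_, h1, fun u' r hr hsub => ?_⟩
    obtain ⟨e, he⟩ := exists_norm_eq E (zero_le_one (α := ℝ))
    exact ⟨e, he, 0, fun x hx => absurd hx.1.1 (hsub hx.2)⟩

end Winning

end NondenseOrbits


namespace NondenseOrbits

open Set Filter Metric

section Winning

set_option linter.unusedSectionVars false

variable {E : Type*} [NormedAddCommGroup E] [InnerProductSpace ℝ E] [FiniteDimensional ℝ E]
  {G : Type*} [TopologicalSpace G] [ChartedSpace E G] [Group G] [LieGroup 𝓘(ℝ, E) ∞ G]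
  {Γ : Subgroup G} [DiscreteTopology Γ]

/-- The map `c` represents conjugation only near 0, so each intermediate iterate must remain within
`R`. -/
theorem pow_smul_centeredParam_smul {a : G} {c : E → E} {R : ℝ}
    (hc : ∀ w, ‖w‖ ≤ R → centeredParam E (1 : G) (c w) = a * centeredParam E (1 : G) w * a⁻¹)
    {v : E} {n : ℕ} (hv : ∀ j ≤ n, ‖c^[j] v‖ ≤ R) (x : G ⧸ Γ) :
    a ^ n • (centeredParam E (1 : G) v • x) = centeredParam E (1 : G) (c^[n] v) • (a ^ n • x) := by
  have h1 : ∀ j ≤ n, centeredParam E (1 : G) (c^[j] v) =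
      a ^ j * centeredParam E (1 : G) v * (a ^ j)⁻¹ := by
    intro j hj
    induction j with
    | zero => simp
    | succ j ih =>
      rw [Function.iterate_succ_apply', hc _ (hv j (by omega)), ih (by omega), pow_succ']
      group
  rw [h1 n le_rfl, smul_smul, smul_smul, inv_mul_cancel_right]

/-- Error budget for the slab estimate: the width of the target, the linearization of `f`, the
nonlinearity of conjugation and that of the chart each take at most a quarter of s · X. -/
theorem sum_error_le {s C a X Λ C₂ γ η r ε : ℝ} (hC : 0 < C) (ha : 0 < a) (hX : 0 < X)
    (hγ : γ * r = X) (hε : 2 * ε ≤ s * X / 4) (hs : X * (4 * (Λ * C₂ * a ^ 2 + 1)) ≤ s)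
    (hη : η * (8 * Λ * C) ≤ s) :
    2 * ε + s / (8 * C * a) * (2 * C * (X * a)) + Λ * (C₂ * (X * a) ^ 2) +
      Λ * (C * γ * (η * (2 * r))) ≤ s * X := by
  have s1 : s / (8 * C * a) * (2 * C * (X * a)) = s * X / 4 := by
    field_simp
    ring
  have s2 := mul_le_mul_of_nonneg_right hs hX.le
  have s3 := mul_le_mul_of_nonneg_right hη hX.le
  have s4 : Λ * (C * γ * (η * (2 * r))) = η * (8 * Λ * C) * X / 4 := by
    rw [← hγ]
    ring
  have s5 := mul_pos hX hX
  rw [s1, s4]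
  linarith

set_option maxHeartbeats 1000000 in
/-- The points whose orbit under the powers of `a` eventually avoids a neighborhood of a
hypersurface transversal to the maximally expanded directions form a winning set. -/
theorem isShrinkHAWOn_eventually_avoid [Nontrivial E] {a : G} {T : E →L[ℝ] E}
    (hTa : (T : E →ₗ[ℝ] E) = Ad a) {ρ : ℝ} (hρ : 1 < ρ) {p : ℕ} {C : ℝ} (hC : 1 ≤ C)
    (hT : ∀ n, ‖T ^ n‖ ≤ C * growthRate ρ p n) {f : G ⧸ Γ → ℝ} {K : Set (G ⧸ Γ)}
    {ℓ : G ⧸ Γ → E →L[ℝ] ℝ} {Λ : ℝ} (hΛ : 0 < Λ) (hℓ : ∀ y ∈ K, ‖ℓ y‖ ≤ Λ)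
    (hlin : ∀ η : ℝ, 0 < η → ∀ᶠ w in 𝓝 (0 : E), ∀ y ∈ K,
        |f (centeredParam E (1 : G) w • y) - f y - ℓ y w| ≤ η * ‖w‖)
    {c₀ : ℝ} (hc₀ : 0 < c₀)
    (hlow : ∀ᶠ n in atTop, ∀ y ∈ K, c₀ * growthRate ρ p n ≤ ‖(ℓ y).comp (T ^ n)‖) (b : G)
    {φ : OpenPartialHomeomorph (G ⧸ Γ) E}
    (hφ : φ ∈ IsManifold.maximalAtlas 𝓘(ℝ, E) 1 (G ⧸ Γ)) {β : ℝ} (hβ : 0 < β) (hβ' : β < 1 / 3) :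
    IsShrinkHAWOn β {u | ∃ ε : ℝ, 0 < ε ∧ ∀ᶠ n in atTop, ¬ (a ^ n • (b • φ.symm u) ∈ K ∧
      |f (a ^ n • (b • φ.symm u))| < ε)} φ.target := by
  obtain ⟨k, hk⟩ := exists_isShrinkHAWOn_of_slabs E hβ hβ' hρ
  refine IsShrinkHAWOn.of_local hβ fun u hu => ?_
  obtain ⟨c, R, C₁, hR, hC₁, hc⟩ := exists_conj_bound a T hTa
  obtain ⟨δ₀, C₂, hδ₀, hC₂, hiter⟩ := exists_iterate_bound hρ hC hT hR hC₁ fun w hw => (hc w hw).2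
  obtain ⟨A, B, hAB, hdisp⟩ := exists_displacement (E := E) b hφ hu
  obtain ⟨n₀, hn₀⟩ := eventually_atTop.1 hlow
  have hC0 : 0 < C := by linarith
  -- `A` has the right inverse `B`, so composing with `A` loses at most the factor ‖B‖ + 1.
  set c₁ := c₀ / (‖B‖ + 1) with hc₁
  have hc₁0 : 0 < c₁ := by positivity
  have hlowA : ∀ n, n₀ ≤ n → ∀ y ∈ K,
      c₁ * growthRate ρ p n ≤ ‖((ℓ y).comp (T ^ n)).comp A‖ := fun n hn y hy => by
    have h1 := hn₀ n hn y hy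
    have h2 : ‖(ℓ y).comp (T ^ n)‖ ≤ ‖((ℓ y).comp (T ^ n)).comp A‖ * (‖B‖ + 1) := by
      have h3 : (ℓ y).comp (T ^ n) = (((ℓ y).comp (T ^ n)).comp A).comp B := by
        ext w
        simp only [ContinuousLinearMap.comp_apply, hAB]
      calc ‖(ℓ y).comp (T ^ n)‖ = ‖(((ℓ y).comp (T ^ n)).comp A).comp B‖ := by rw [← h3]
        _ ≤ ‖((ℓ y).comp (T ^ n)).comp A‖ * ‖B‖ := ContinuousLinearMap.opNorm_comp_le _ _
        _ ≤ _ := mul_le_mul_of_nonneg_left (by linarith) (norm_nonneg _)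
    rw [hc₁, div_mul_eq_mul_div, div_le_iff₀ (by positivity)]
    exact h1.trans h2
  set θ := β / 4 * β ^ k with hθ
  have hθ0 : 0 < θ := by positivity
  set a₁ := 2 * (‖A‖ + 1) with ha₁
  have ha₁0 : 0 < a₁ := by positivity
  obtain ⟨δ₁, hδ₁, hlin'⟩ := Metric.nhds_basis_closedBall.eventually_iff.1
    (hlin (θ * c₁ / (8 * C * a₁)) (by positivity))
  set δ := min (δ₀ / a₁) (min (δ₁ / (2 * C * a₁)) (θ * c₁ / (4 * (Λ * C₂ * a₁ ^ 2 + 1)))) with hδ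
  have hδ0 : 0 < δ := by positivity
  have hδa : δ * a₁ ≤ δ₀ := (le_div_iff₀ ha₁0).1 (min_le_left _ _)
  have hδb : δ * (2 * C * a₁) ≤ δ₁ :=
    (le_div_iff₀ (by positivity)).1 ((min_le_right _ _).trans (min_le_left _ _))
  have hδc : δ * (4 * (Λ * C₂ * a₁ ^ 2 + 1)) ≤ θ * c₁ :=
    (le_div_iff₀ (by positivity)).1 ((min_le_right _ _).trans (min_le_right _ _))
  set η := min 1 (θ * c₁ / (8 * Λ * C)) with hη
  have hη0 : 0 < η := by positivity
  have hη1 : η ≤ 1 := min_le_left _ _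
  have hηb : η * (8 * Λ * C) ≤ θ * c₁ := (le_div_iff₀ (by positivity)).1 (min_le_right _ _)
  -- Chosen after δ: the lower end β^k δ of the window guarantees that 2ε is at most a quarter of θ
  -- c₁ X.
  set ε := θ * c₁ * (β ^ k * δ) / 8 with hε
  have hε0 : 0 < ε := by positivity
  obtain ⟨O, hO, hOd⟩ := hdisp η hη0
  set D : ℕ → Set E := fun n => {u | a ^ n • (b • φ.symm u) ∈ K ∧
    |f (a ^ n • (b • φ.symm u))| < ε} with hD
  refine ⟨O, hO, (hk O D (growthRate ρ p) δ 1 n₀ hδ0 one_pos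
    (growthRate_pos (by linarith) p) (mul_growthRate_le (by linarith) p)
    fun u' r n hr _ hsub hn hw1 hw2 => ?_).mono fun x _ hx => ⟨ε, hε0, hx⟩⟩
  rcases (D n ∩ closedBall u' r).eq_empty_or_nonempty with hemp | ⟨x₁, hx₁, hx₁'⟩
  · obtain ⟨e, he⟩ := exists_norm_eq E (zero_le_one (α := ℝ))
    exact ⟨e, he, 0, by simp [hemp]⟩
  set y := a ^ n • (b • φ.symm x₁) with hy
  set X := growthRate ρ p n * r with hX
  have hX0 : 0 < X := mul_pos (growthRate_pos (by linarith) p n) hr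
  have hL := hlowA n hn y hx₁.1
  have hLne : ((ℓ y).comp (T ^ n)).comp A ≠ 0 := norm_pos_iff.1
    ((mul_pos hc₁0 (growthRate_pos (by linarith) p n)).trans_le hL)
  refine exists_slab_of_functional hLne (x₁ := x₁) fun x hx => ?_
  obtain ⟨v, hv, hvA⟩ := hOd x₁ (hsub hx₁') x (hsub hx.2)
  have hdist : ‖x - x₁‖ ≤ 2 * r := by
    rw [← dist_eq_norm]
    have := dist_triangle_right x x₁ u'
    have := mem_closedBall.1 hx.2
    have := mem_closedBall.1 hx₁'
    linarith
  have hvA' : ‖v - A (x - x₁)‖ ≤ η * (2 * r) :=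
    hvA.trans (mul_le_mul_of_nonneg_left hdist hη0.le)
  have hvn : ‖v‖ ≤ a₁ * r := by
    have h1 := norm_le_norm_sub_add v (A (x - x₁))
    have h2 : ‖A (x - x₁)‖ ≤ ‖A‖ * (2 * r) :=
      (A.le_opNorm _).trans (mul_le_mul_of_nonneg_left hdist (norm_nonneg _))
    rw [ha₁]
    nlinarith
  have hXa : growthRate ρ p n * (a₁ * r) = X * a₁ := by rw [hX]; ring
  obtain ⟨hit1, hit2⟩ := hiter n (a₁ * r) v (by
    rw [hXa]
    exact (mul_le_mul_of_nonneg_right hw2 ha₁0.le).trans hδa) hvn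
  rw [hXa] at hit2
  have hit3 := (hit1 n le_rfl).1
  rw [hXa] at hit3
  -- Both endpoints have |f| < ε, so this displacement changes `f` by less than 2ε; it is linearly
  -- ℓ_y(T^n A(x - x₁)) up to the errors below.
  have hmove : a ^ n • (b • φ.symm x) = centeredParam E (1 : G) (c^[n] v) • y := by
    rw [← hv, pow_smul_centeredParam_smul (fun w hw => (hc w hw).1) fun j hj => (hit1 j hj).2]
  have hlinv := hlin' (mem_closedBall_zero_iff.2 (show ‖c^[n] v‖ ≤ δ₁ by
    refine (hit3.trans (le_of_eq ?_)).trans ((mul_le_mul_of_nonneg_right hw2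
      (by positivity : 0 ≤ 2 * C * a₁)).trans hδb)
    ring)) y hx₁.1
  rw [← hmove] at hlinv
  have hf1 : |f y| < ε := hx₁.2
  have hf2 : |f (a ^ n • (b • φ.symm x))| < ε := hx.1.2
  have e1 : |ℓ y (c^[n] v)| ≤ 2 * ε + θ * c₁ / (8 * C * a₁) * (2 * C * (X * a₁)) := by
    have h1 := hlinv.trans (mul_le_mul_of_nonneg_left hit3 (by positivity))
    have h2 : ℓ y (c^[n] v) = (f (a ^ n • (b • φ.symm x)) - f y) -
      (f (a ^ n • (b • φ.symm x)) - f y - ℓ y (c^[n] v)) := by ring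
    rw [h2]
    refine (abs_sub _ _).trans ?_
    have h3 := abs_sub (f (a ^ n • (b • φ.symm x))) (f y)
    linarith
  have e2 : |ℓ y (c^[n] v - (T ^ n) v)| ≤ Λ * (C₂ * (X * a₁) ^ 2) :=
    ((ℓ y).le_opNorm _).trans (mul_le_mul (hℓ y hx₁.1) hit2 (norm_nonneg _) hΛ.le)
  have e3 : |ℓ y ((T ^ n) (v - A (x - x₁)))| ≤ Λ * (C * growthRate ρ p n * (η * (2 * r))) := by
    refine ((ℓ y).le_opNorm _).trans (mul_le_mul (hℓ y hx₁.1) ?_ (norm_nonneg _) hΛ.le)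
    exact ((T ^ n).le_opNorm _).trans (mul_le_mul (hT n) hvA' (norm_nonneg _)
      (mul_nonneg hC0.le (growthRate_pos (by linarith) p n).le))
  have e4 : ((ℓ y).comp (T ^ n)).comp A (x - x₁) = ℓ y (c^[n] v) - ℓ y (c^[n] v - (T ^ n) v) -
      ℓ y ((T ^ n) (v - A (x - x₁))) := by
    simp only [ContinuousLinearMap.comp_apply, map_sub]
    ring
  have e5 : |((ℓ y).comp (T ^ n)).comp A (x - x₁)| ≤ θ * c₁ * X := by
    rw [e4]
    refine (abs_sub _ _).trans ((add_le_add (abs_sub _ _) le_rfl).trans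
      ((add_le_add (add_le_add e1 e2) e3).trans ?_))
    refine sum_error_le hC0 ha₁0 hX0 hX.symm ?_
      ((mul_le_mul_of_nonneg_right hw2 (by positivity)).trans hδc) hηb
    have := mul_le_mul_of_nonneg_left hw1.le (mul_pos hθ0 hc₁0).le
    rw [hε]
    linarith
  refine e5.trans ?_
  have h1 : θ * c₁ * X = θ * r * (c₁ * growthRate ρ p n) := by rw [hX]; ring
  have h2 : β / 4 * (β ^ k * r) = θ * r := by rw [hθ]; ring
  rw [h1, h2]
  exact mul_le_mul_of_nonneg_left hL (by positivity)

end Winning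

end NondenseOrbits


namespace NondenseOrbits

open Set Filter

/-! ### Hypersurfaces containing the submanifold and its short flow translates. -/

section FlowBox

/-- An immersed submanifold of Euclidean space lies, locally, in the zero set of a function with a
prescribed derivative vanishing on its tangent space. -/
theorem exists_defining_function {W E : Type*} [NormedAddCommGroup W] [NormedSpace ℝ W]
    [FiniteDimensional ℝ W] [NormedAddCommGroup E] [NormedSpace ℝ E] [FiniteDimensional ℝ E]
    {Ψ : W → E} {p : W} {D : W →L[ℝ] E} (hΨ : ContDiffAt ℝ 1 Ψ p) (hD : HasFDerivAt Ψ D p)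
    (hinj : Function.Injective D) {μ : E →L[ℝ] ℝ} (hμ : ∀ w, μ (D w) = 0) :
    ∃ F : E → ℝ, ContDiffAt ℝ 1 F (Ψ p) ∧ HasFDerivAt F μ (Ψ p) ∧ ∀ᶠ q in 𝓝 p, F (Ψ q) = 0 := by
  obtain ⟨Q, hQ⟩ := Submodule.exists_isCompl (LinearMap.range D.toLinearMap)
  let A : (W × Q) →L[ℝ] E := D.comp (ContinuousLinearMap.fst ℝ W Q) +
    Q.subtypeL.comp (ContinuousLinearMap.snd ℝ W Q)
  have hA : ∀ w q, A (w, q) = D w + q := fun w q => rfl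
  have hAinj : Function.Injective A := by
    refine (injective_iff_map_eq_zero A).2 ?_
    rintro ⟨w, q⟩ h
    rw [hA] at h
    have h1 : (q : E) ∈ LinearMap.range D.toLinearMap :=
      ⟨-w, by rw [ContinuousLinearMap.coe_coe, map_neg]; exact neg_eq_of_add_eq_zero_right h⟩
    have h2 : (q : E) = 0 := Submodule.disjoint_def.1 hQ.disjoint _ h1 q.2
    rw [h2, add_zero] at h
    exact Prod.ext ((injective_iff_map_eq_zero D).1 hinj w h) (Subtype.ext h2)
  have hAsurj : Function.Surjective A := fun e => by
    obtain ⟨_, ⟨w, rfl⟩, q, hq, rfl⟩ := Submodule.mem_sup.1 (hQ.sup_eq_top ▸ Submodule.mem_top (x := e))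
    exact ⟨(w, ⟨q, hq⟩), rfl⟩
  let A' : (W × Q) ≃L[ℝ] E :=
    (LinearEquiv.ofBijective A.toLinearMap ⟨hAinj, hAsurj⟩).toContinuousLinearEquiv
  -- Thickening by a complement of the tangent space gives a local diffeomorphism. The function `F`
  -- applies μ to the transversal coordinate, and has derivative μ because μ vanishes on the tangent
  -- space.
  let Θ : W × Q → E := fun x => Ψ x.1 + x.2
  have hΘ : ContDiffAt ℝ 1 Θ (p, 0) :=
    (ContDiffAt.comp (p, (0 : Q)) hΨ contDiff_fst.contDiffAt).add
      (Q.subtypeL.contDiff.comp contDiff_snd).contDiffAt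
  have hΘA : HasFDerivAt Θ (A' : (W × Q) →L[ℝ] E) (p, 0) := by
    have h1 : (A' : (W × Q) →L[ℝ] E) = A := rfl
    rw [h1]
    exact (HasFDerivAt.comp (p, (0 : Q)) hD hasFDerivAt_fst).add
      (Q.subtypeL.hasFDerivAt.comp (p, (0 : Q)) hasFDerivAt_snd)
  have hΘp : Θ (p, 0) = Ψ p := by simp [Θ]
  have hstrict := hΘ.hasStrictFDerivAt' hΘA one_ne_zero
  let θ := hΘ.localInverse hΘA one_ne_zero
  have hθ : ContDiffAt ℝ 1 θ (Ψ p) := hΘp ▸ hΘ.to_localInverse hΘA one_ne_zero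
  have hθA : HasFDerivAt θ (A'.symm : E →L[ℝ] W × Q) (Ψ p) :=
    hΘp ▸ hstrict.to_localInverse.hasFDerivAt
  let μ' : (W × Q) →L[ℝ] ℝ := (μ.comp Q.subtypeL).comp (ContinuousLinearMap.snd ℝ W Q)
  refine ⟨fun e => μ' (θ e), μ'.contDiff.contDiffAt.comp _ hθ, ?_, ?_⟩
  · have h1 := μ'.hasFDerivAt.comp _ hθA
    have h2 : μ'.comp (A'.symm : E →L[ℝ] W × Q) = μ := by
      ext e
      obtain ⟨x, rfl⟩ := A'.surjective e
      have h3 : A' x = D x.1 + x.2 := rfl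
      rw [ContinuousLinearMap.comp_apply, ContinuousLinearEquiv.coe_coe,
        ContinuousLinearEquiv.symm_apply_apply, h3, map_add, hμ, zero_add]
      rfl
    rwa [h2] at h1
  · have h1 : ContinuousAt (fun q : W => (q, (0 : Q))) p := by fun_prop
    filter_upwards [h1.eventually hstrict.eventually_left_inverse] with q hq
    have h2 : Θ (q, 0) = Ψ q := by simp [Θ]
    rw [h2] at hq
    have h3 : θ (Ψ q) = (q, 0) := hq
    rw [h3]
    simp [μ']

variable {E : Type*} [NormedAddCommGroup E] [NormedSpace ℝ E]
  {E' : Type*} [NormedAddCommGroup E'] [NormedSpace ℝ E']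
  {M : Type*} [TopologicalSpace M] [ChartedSpace E M]
  {N : Type*} [TopologicalSpace N] [ChartedSpace E' N]

/-- In immersion charts the map is a linear inclusion; projecting to the first factor gives a
differentiable local left inverse, and the chain rule applies. -/
theorem mfderiv_injective_of_isImmersionAt {ι : N → M} {y : N}
    (h : Manifold.IsImmersionAt 𝓘(ℝ, E') 𝓘(ℝ, E) 1 ι y) :
    Function.Injective (mfderiv 𝓘(ℝ, E') 𝓘(ℝ, E) ι y) := by
  let P : E →L[ℝ] E' :=
    (ContinuousLinearMap.fst ℝ E' h.complement).comp (h.equiv.symm : E →L[ℝ] E' × h.complement)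
  let L : M → N := fun x => h.domChart.symm (P (h.codChart x))
  have hP : ∀ x ∈ h.domChart.source, P (h.codChart (ι x)) = h.domChart x := fun x hx => by
    have h1 := h.writtenInCharts (show h.domChart x ∈ (h.domChart.extend 𝓘(ℝ, E')).target by
      rw [OpenPartialHomeomorph.extend_target_eq_image_source]
      exact ⟨x, hx, rfl⟩)
    simp only [Function.comp_apply, OpenPartialHomeomorph.extend_coe,
      OpenPartialHomeomorph.extend_coe_symm, modelWithCornersSelf_coe, id,
      modelWithCornersSelf_coe_symm, h.domChart.left_inv hx] at h1
    rw [h1]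
    simp [P]
  have hL : (fun x => L (ι x)) =ᶠ[𝓝 y] id := by
    filter_upwards [h.domChart.open_source.mem_nhds h.mem_domChart_source] with x hx
    simp only [L, hP x hx, h.domChart.left_inv hx, id]
  have h1 : MDifferentiableAt 𝓘(ℝ, E) 𝓘(ℝ, E) h.codChart (ι y) :=
    ((contMDiffOn_of_mem_maximalAtlas h.codChart_mem_maximalAtlas).contMDiffAt
      (h.codChart.open_source.mem_nhds h.mem_codChart_source)).mdifferentiableAt one_ne_zero
  have h2 : MDifferentiableAt 𝓘(ℝ, E') 𝓘(ℝ, E') h.domChart.symm (P (h.codChart (ι y))) := by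
    rw [hP y h.mem_domChart_source]
    exact ((contMDiffOn_symm_of_mem_maximalAtlas h.domChart_mem_maximalAtlas).contMDiffAt
      (h.domChart.open_target.mem_nhds (h.domChart.map_source h.mem_domChart_source))
      ).mdifferentiableAt one_ne_zero
  have h3 : MDifferentiableAt 𝓘(ℝ, E) 𝓘(ℝ, E') L (ι y) :=
    h2.comp (ι y) ((P.differentiableAt.mdifferentiableAt).comp (ι y) h1)
  have h4 := mfderiv_comp y h3 (h.contMDiffAt.mdifferentiableAt one_ne_zero)
  have h5 : mfderiv 𝓘(ℝ, E') 𝓘(ℝ, E') (L ∘ ι) y = ContinuousLinearMap.id ℝ E' :=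
    hL.mfderiv_eq.trans mfderiv_id
  rw [h5] at h4
  intro v w hvw
  have h6 := fun v : E' => congrArg (fun T : E' →L[ℝ] E' => T v) h4
  have h7 := (h6 v).trans ((congrArg (mfderiv 𝓘(ℝ, E) 𝓘(ℝ, E') L (ι y)) hvw).trans (h6 w).symm)
  exact h7

end FlowBox

section Flow

variable {E : Type*} [NormedAddCommGroup E] [NormedSpace ℝ E] [FiniteDimensional ℝ E]
  {G : Type*} [TopologicalSpace G] [ChartedSpace E G] [Group G] [LieGroup 𝓘(ℝ, E) ∞ G]
  {Γ : Subgroup G} [DiscreteTopology Γ]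
  {E' : Type*} [NormedAddCommGroup E'] [NormedSpace ℝ E']
  {N : Type*} [TopologicalSpace N] [ChartedSpace E' N] [IsManifold 𝓘(ℝ, E') 1 N]

/-- Near `ι y`, the union of the translates of the immersed submanifold by a one-parameter subgroup
transversal to it lies in the zero set of a function with a prescribed derivative. -/
theorem exists_flow_invariant_function {g : ℝ → G} (hg : ContMDiff 𝓘(ℝ, ℝ) 𝓘(ℝ, E) ∞ g)
    (hg0 : g 0 = 1) {ι : N → G ⧸ Γ} {y : N} (h : Manifold.IsImmersionAt 𝓘(ℝ, E') 𝓘(ℝ, E) 1 ι y)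
    {A : E →L[ℝ] E} (hA : A = mfderiv 𝓘(ℝ, E) 𝓘(ℝ, E) (fun h : G => h • ι y) 1)
    {B : E' →L[ℝ] E} (hB : B = mfderiv 𝓘(ℝ, E') 𝓘(ℝ, E) ι y)
    {v : E} (hv : v = (mfderiv 𝓘(ℝ, ℝ) 𝓘(ℝ, E) g 0 : ℝ →L[ℝ] _) (1 : ℝ))
    (hvB : A v ∉ LinearMap.range B.toLinearMap)
    {μ : E →L[ℝ] ℝ} (hμB : ∀ w, μ (B w) = 0) (hμv : μ (A v) = 0) :
    ∃ f : G ⧸ Γ → ℝ, ContMDiffAt 𝓘(ℝ, E) 𝓘(ℝ, ℝ) 1 f (ι y) ∧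
      HasFDerivAt (fun w => f (centeredParam E (1 : G) w • ι y)) (μ.comp A) 0 ∧
      ∀ᶠ p : N × ℝ in 𝓝 (y, 0), f (g p.2 • ι p.1) = 0 := by
  have : LieGroup 𝓘(ℝ, E) 1 G := LieGroup.of_le (n := ∞) (by simp)
  have : IsManifold 𝓘(ℝ, E) 1 (G ⧸ Γ) := IsManifold.of_le (n := ∞) (by simp)
  have hBinj : Function.Injective B := hB ▸ mfderiv_injective_of_isImmersionAt h
  have : FiniteDimensional ℝ E' := FiniteDimensional.of_injective B.toLinearMap hBinj
  set z := ι y with hz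
  have horb : ContMDiffAt 𝓘(ℝ, E) 𝓘(ℝ, E) 1 (fun h : G => h • z) 1 :=
    contMDiffAt_smul (by simp) contMDiffAt_id contMDiffAt_const
  have horb0 : (1 : G) • z = z := one_smul _ _
  have hι0 : g 0 • ι (centeredParam E' y 0) = z := by rw [hg0, one_smul, centeredParam_zero]
  -- Its derivative is (w, s) ↦ B w + s • A v, injective because `A v` is not tangent to the
  -- submanifold.
  let Ψ : E' × ℝ → E := fun p => chartAt E z (g p.2 • ι (centeredParam E' y p.1))
  have hΨ : ContDiffAt ℝ 1 Ψ (0, 0) := by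
    have h1 : ContMDiffAt 𝓘(ℝ, E' × ℝ) 𝓘(ℝ, E) 1 (fun p : E' × ℝ => g p.2) (0, 0) :=
      ContMDiffAt.comp (0, 0) (g := g) (hg.of_le (by simp)).contMDiffAt
        contDiff_snd.contMDiff.contMDiffAt
    have h2 : ContMDiffAt 𝓘(ℝ, E' × ℝ) 𝓘(ℝ, E') 1
        (fun p : E' × ℝ => centeredParam E' y p.1) (0, 0) :=
      ContMDiffAt.comp (0, 0) (g := centeredParam E' y) (contMDiffAt_centeredParam y)
        contDiff_fst.contMDiff.contMDiffAt
    have h3 : ContMDiffAt 𝓘(ℝ, E' × ℝ) 𝓘(ℝ, E) 1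
        (fun p : E' × ℝ => ι (centeredParam E' y p.1)) (0, 0) := by
      refine ContMDiffAt.comp (0, 0) (g := ι) ?_ h2
      rw [centeredParam_zero]
      exact h.contMDiffAt
    have h4 : ContMDiffAt 𝓘(ℝ, E) 𝓘(ℝ, E) 1 (chartAt E z) (g 0 • ι (centeredParam E' y 0)) := by
      rw [hι0]
      exact contMDiffAt_chartAt z
    exact contMDiffAt_iff_contDiffAt.1
      (ContMDiffAt.comp (0, 0) (g := chartAt E z) h4 (contMDiffAt_smul (by simp) h1 h3))
  have hΨ0 : Ψ (0, 0) = chartAt E z z := congrArg (chartAt E z) hι0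
  have hDB : HasFDerivAt (fun w => Ψ (w, 0)) B 0 := by
    simp only [Ψ, hg0, one_smul]
    exact hasFDerivAt_chartAt_comp_centeredParam hz.symm
      (h.contMDiffAt.mdifferentiableAt one_ne_zero) hB
  have hDv : HasFDerivAt (fun s => Ψ (0, s)) (A.comp ((ContinuousLinearMap.id ℝ ℝ).smulRight v))
      0 := by
    simp only [Ψ, centeredParam_zero]
    have h1 := mfderiv_comp (I := 𝓘(ℝ, ℝ)) (I' := 𝓘(ℝ, E)) (I'' := 𝓘(ℝ, E)) (0 : ℝ)
      (g := fun h : G => h • z) (f := g)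
      (by rw [hg0]; exact horb.mdifferentiableAt one_ne_zero)
      (hg.contMDiffAt.mdifferentiableAt (by simp))
    have h2 : MDifferentiableAt 𝓘(ℝ, ℝ) 𝓘(ℝ, E) (fun s => g s • z) 0 :=
      (contMDiffAt_smul (n := 1) (by simp) (hg.of_le (by simp)).contMDiffAt
        contMDiffAt_const).mdifferentiableAt one_ne_zero
    have h3 : A.comp ((ContinuousLinearMap.id ℝ ℝ).smulRight v) =
        mfderiv 𝓘(ℝ, ℝ) 𝓘(ℝ, E) (fun s => g s • z) 0 := by
      refine ContinuousLinearMap.ext_ring ?_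
      have h4 : ∀ a : G, a = 1 → A v = (mfderiv 𝓘(ℝ, E) 𝓘(ℝ, E) (fun h : G => h • z) a :
          E →L[ℝ] E) v := by
        rintro _ rfl
        exact congrArg (fun T : E →L[ℝ] E => T v) hA
      have h5 := congrArg (fun T : ℝ →L[ℝ] E => T 1) h1
      rw [ContinuousLinearMap.comp_apply, ContinuousLinearMap.smulRight_apply,
        ContinuousLinearMap.id_apply, one_smul, h4 _ hg0, hv]
      exact h5.symm
    have h4 := hasFDerivAt_chartAt_comp_centeredParam (f := fun s : ℝ => g s • z) (x := (0 : ℝ))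
      (y := z) (by rw [hg0, one_smul]) h2 h3
    have h5 : centeredParam ℝ (0 : ℝ) = id := funext fun s => zero_add s
    rw [h5] at h4
    exact h4
  obtain ⟨D, hD⟩ := hΨ.differentiableAt one_ne_zero
  have hD1 : ∀ w s, D (w, s) = B w + s • A v := fun w s => by
    have h1 : D.comp (ContinuousLinearMap.inl ℝ E' ℝ) = B :=
      (HasFDerivAt.comp (g := Ψ) (f := fun w => (w, (0 : ℝ))) (0 : E') hD
        (hasFDerivAt_prodMk_left (0 : E') (0 : ℝ))).unique hDB
    have h2 : D.comp (ContinuousLinearMap.inr ℝ E' ℝ) =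
        A.comp ((ContinuousLinearMap.id ℝ ℝ).smulRight v) :=
      (HasFDerivAt.comp (g := Ψ) (f := fun s => ((0 : E'), s)) (0 : ℝ) hD
        (hasFDerivAt_prodMk_right (0 : E') (0 : ℝ))).unique hDv
    have h3 : D (w, s) = D (w, 0) + D (0, s) := by rw [← map_add]; simp
    have h4 : D (0, s) = A (s • v) := congrArg (fun T : ℝ →L[ℝ] E => T s) h2
    rw [h3, h4, map_smul, ← h1]
    rfl
  have hDinj : Function.Injective D := by
    refine (injective_iff_map_eq_zero D).2 ?_
    rintro ⟨w, s⟩ hws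
    rw [hD1] at hws
    have hs : s = 0 := by
      by_contra hs
      refine hvB ⟨-(s⁻¹ • w), ?_⟩
      rw [ContinuousLinearMap.coe_coe, map_neg, map_smul, eq_neg_of_add_eq_zero_left hws, smul_neg,
        neg_neg, smul_smul, inv_mul_cancel₀ hs, one_smul]
    rw [hs, zero_smul, add_zero] at hws
    rw [hs, (injective_iff_map_eq_zero B).1 hBinj w hws]
    rfl
  obtain ⟨F, hF, hFμ, hF0⟩ := exists_defining_function hΨ hD hDinj (μ := μ) fun p => by
    rw [hD1, map_add, hμB, map_smul, hμv, smul_zero, add_zero]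
  rw [hΨ0] at hF hFμ
  refine ⟨fun x => F (chartAt E z x), hF.contMDiffAt.comp z (contMDiffAt_chartAt z), ?_, ?_⟩
  · have h1 := hasFDerivAt_chartAt_comp_centeredParam (f := fun h : G => h • z) horb0
      (horb.mdifferentiableAt one_ne_zero) hA
    have h2 : HasFDerivAt F μ (chartAt E z (centeredParam E (1 : G) 0 • z)) := by
      rwa [centeredParam_zero, one_smul]
    exact h2.comp (0 : E) h1
  · have h1 : Tendsto (fun p : N × ℝ => (chartAt E' y p.1 - chartAt E' y y, p.2)) (𝓝 (y, 0))
        (𝓝 ((0 : E'), (0 : ℝ))) := by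
      have h2 : ContinuousAt (fun p : N × ℝ => (chartAt E' y p.1 - chartAt E' y y, p.2)) (y, 0) := by
        have h3 : ContinuousAt (fun p : N × ℝ => chartAt E' y p.1) (y, 0) :=
          ContinuousAt.comp (f := Prod.fst) (x := (y, (0 : ℝ)))
            ((chartAt E' y).continuousAt (mem_chart_source E' y)) continuousAt_fst
        exact (h3.sub continuousAt_const).prodMk continuousAt_snd
      simpa [ContinuousAt] using h2
    filter_upwards [h1.eventually hF0, (continuous_fst.tendsto (y, (0 : ℝ))).eventually
      (eventually_centeredParam_chartAt (E := E') y)] with p hp hp'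
    simpa only [Ψ, hp'] using hp

end Flow

end NondenseOrbits


namespace NondenseOrbits

open Set Filter

/-! ### From transversality to winning hypersurfaces. -/

section Transversal

variable {E : Type*} [NormedAddCommGroup E] [NormedSpace ℝ E]
  {G : Type*} [TopologicalSpace G] [ChartedSpace E G] [Group G] [LieGroup 𝓘(ℝ, E) ∞ G]
  {Γ : Subgroup G} [DiscreteTopology Γ]
  {E' : Type*} [NormedAddCommGroup E'] [NormedSpace ℝ E']
  {N : Type*} [TopologicalSpace N] [ChartedSpace E' N]

theorem IsTransversal.nontrivial [Nonempty N] {𝔣 𝔥 : Submodule ℝ (GroupLieAlgebra 𝓘(ℝ, E) G)}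
    {ι : N → G ⧸ Γ} (hZ : IsTransversal (E' := E') 𝔣 𝔥 ι) : Nontrivial E := by
  by_contra h
  have hE : Subsingleton E := not_nontrivial_iff_subsingleton.1 h
  refine hZ.left (Classical.arbitrary N) fun v _ => ?_
  have hv : v = 0 := hE.elim v 0
  rw [hv]
  exact Submodule.zero_mem _

variable [FiniteDimensional ℝ E]

theorem IsTransversal.velocity_notMem {g : ℝ → G} {a : G} {ι : N → G ⧸ Γ}
    (hZ : IsTransversal (E' := E') (flowLieAlgebra E g) (maxHorosphericalLieAlgebra E a) ι) (y : N)
    {A : E →L[ℝ] E} (hA : A = mfderiv 𝓘(ℝ, E) 𝓘(ℝ, E) (fun h : G => h • ι y) 1)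
    {B : E' →L[ℝ] E} (hB : B = mfderiv 𝓘(ℝ, E') 𝓘(ℝ, E) ι y)
    {v : E} (hv : v = (mfderiv 𝓘(ℝ, ℝ) 𝓘(ℝ, E) g 0 : ℝ →L[ℝ] _) (1 : ℝ)) :
    A v ∉ LinearMap.range B.toLinearMap := by
  intro h
  refine hZ.left y ?_
  rintro _ ⟨_, ⟨s, rfl⟩, rfl⟩
  let γ : ℝ →L[ℝ] E := mfderiv 𝓘(ℝ, ℝ) 𝓘(ℝ, E) g 0
  have h1 : A (γ s) ∈ LinearMap.range B.toLinearMap := by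
    have h2 : γ s = s • v := by
      rw [show v = γ 1 from hv, ← map_smul, smul_eq_mul, mul_one]
    rw [h2, map_smul]
    exact Submodule.smul_mem _ _ h
  rw [hA, hB] at h1
  exact h1

/-- Transversality at `ι y` provides a functional that vanishes on the tangent spaces of the
submanifold and of the flow, but not on the maximally expanded directions. -/
theorem IsTransversal.exists_functional {g : ℝ → G} {a : G} {ι : N → G ⧸ Γ}
    (hZ : IsTransversal (E' := E') (flowLieAlgebra E g) (maxHorosphericalLieAlgebra E a) ι) (y : N)
    {A : E →L[ℝ] E} (hA : A = mfderiv 𝓘(ℝ, E) 𝓘(ℝ, E) (fun h : G => h • ι y) 1)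
    {B : E' →L[ℝ] E} (hB : B = mfderiv 𝓘(ℝ, E') 𝓘(ℝ, E) ι y)
    {v : E} (hv : v = (mfderiv 𝓘(ℝ, ℝ) 𝓘(ℝ, E) g 0 : ℝ →L[ℝ] _) (1 : ℝ))
    {T : E →ₗ[ℝ] E} (hT : T = Ad a) :
    1 < specRadius T ∧ ∃ μ : E →L[ℝ] ℝ, (∀ w, μ (B w) = 0) ∧ μ (A v) = 0 ∧
      ∃ u, μ (A (Polynomial.aeval T (topPolynomial T) u)) ≠ 0 := by
  let 𝔪 : Submodule ℝ E := maxExpanding T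
  have h𝔪 : ¬ 𝔪.map A.toLinearMap ≤
      LinearMap.range B.toLinearMap ⊔ Submodule.span ℝ {A v} := by
    intro h
    refine hZ.right y fun w hw => ?_
    have h1 : w ∈ 𝔪.map A.toLinearMap := by
      obtain ⟨u, hu, rfl⟩ := hw
      refine ⟨u, ?_, by rw [hA]; rfl⟩
      change u ∈ maxExpanding T
      rw [hT]
      exact hu
    obtain ⟨b, hb, c, hc, rfl⟩ := Submodule.mem_sup.1 (h h1)
    refine Submodule.add_mem_sup (by rw [hB] at hb; exact hb) ?_
    obtain ⟨s, rfl⟩ := Submodule.mem_span_singleton.1 hc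
    refine ⟨(mfderiv 𝓘(ℝ, ℝ) 𝓘(ℝ, E) g 0 : ℝ →L[ℝ] _) s, ⟨s, rfl⟩, ?_⟩
    let γ : ℝ →L[ℝ] E := mfderiv 𝓘(ℝ, ℝ) 𝓘(ℝ, E) g 0
    have h2 : A (γ s) = s • A v := by
      rw [show v = γ 1 from hv, ← map_smul, ← map_smul, smul_eq_mul, mul_one]
    rw [hA] at h2 ⊢
    exact h2
  have hρ : 1 < specRadius T := by
    by_contra hρ
    refine h𝔪 ?_
    have h1 : 𝔪 = ⊥ := by
      simp only [𝔪, maxExpanding, if_pos (not_lt.1 hρ)]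
    rw [h1, Submodule.map_bot]
    exact bot_le
  have h𝔪' : 𝔪 = LinearMap.range (Polynomial.aeval T (topPolynomial T)) := by
    simp only [𝔪, maxExpanding, if_neg (not_le.2 hρ)]
  refine ⟨hρ, ?_⟩
  obtain ⟨_, ⟨_, hm, rfl⟩, hnot⟩ := SetLike.not_le_iff_exists.1 h𝔪
  rw [h𝔪'] at hm
  obtain ⟨u, rfl⟩ := hm
  obtain ⟨μ, hμ, hle⟩ := Submodule.exists_le_ker_of_notMem hnot
  refine ⟨LinearMap.toContinuousLinearMap μ, fun w => ?_, ?_, u, hμ⟩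
  · exact hle (Submodule.mem_sup_left ⟨w, rfl⟩)
  · exact hle (Submodule.mem_sup_right (Submodule.mem_span_singleton_self _))

end Transversal

section Local

variable {E : Type*} [NormedAddCommGroup E] [InnerProductSpace ℝ E] [FiniteDimensional ℝ E]
  {G : Type*} [TopologicalSpace G] [T2Space G] [ChartedSpace E G] [Group G]
  [LieGroup 𝓘(ℝ, E) ∞ G]
  {Γ : Subgroup G} [DiscreteTopology Γ]
  {E' : Type*} [NormedAddCommGroup E'] [NormedSpace ℝ E']
  {N : Type*} [TopologicalSpace N] [ChartedSpace E' N] [IsManifold 𝓘(ℝ, E') 1 N]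

theorem t2Space_quotient (E : Type*) [NormedAddCommGroup E] [NormedSpace ℝ E]
    {G : Type*} [TopologicalSpace G] [T2Space G] [ChartedSpace E G] [Group G]
    [LieGroup 𝓘(ℝ, E) ∞ G] (Γ : Subgroup G) [DiscreteTopology Γ] : T2Space (G ⧸ Γ) := by
  have := topologicalGroup_of_lieGroup 𝓘(ℝ, E) ∞ (G := G)
  have : IsClosed (Γ : Set G) := Subgroup.isClosed_of_discrete
  infer_instance

/-- Near each point of a transversal submanifold there is a hypersurface that contains the nearby
translates of the submanifold under the flow, and that can be avoided by a winning strategy. -/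
theorem IsTransversal.exists_winning_hypersurface [Nontrivial E] {g : ℝ → G}
    (hg : ContMDiff 𝓘(ℝ, ℝ) 𝓘(ℝ, E) ∞ g) (hg0 : g 0 = 1) {a : G} {ι : N → G ⧸ Γ}
    (hZ : IsTransversal (E' := E') (flowLieAlgebra E g) (maxHorosphericalLieAlgebra E a) ι) {y : N}
    (h : Manifold.IsImmersionAt 𝓘(ℝ, E') 𝓘(ℝ, E) 1 ι y) :
    ∃ (f : G ⧸ Γ → ℝ) (K : Set (G ⧸ Γ)), K ∈ 𝓝 (ι y) ∧ (∀ x ∈ K, ContinuousAt f x) ∧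
      (∀ᶠ p : N × ℝ in 𝓝 (y, 0), f (g p.2 • ι p.1) = 0) ∧
      ∀ (b : G), ∀ φ ∈ IsManifold.maximalAtlas 𝓘(ℝ, E) 1 (G ⧸ Γ), ∀ β : ℝ, 0 < β → β < 1 / 3 →
        IsShrinkHAWOn β {u | ¬ (b • φ.symm u ∈ K ∧ f (b • φ.symm u) = 0)} φ.target ∧
        IsShrinkHAWOn β {u | ∃ ε : ℝ, 0 < ε ∧ ∀ᶠ n in atTop, ¬ (a ^ n • (b • φ.symm u) ∈ K ∧
          |f (a ^ n • (b • φ.symm u))| < ε)} φ.target := by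
  have := t2Space_quotient E Γ
  let A : E →L[ℝ] E := mfderiv 𝓘(ℝ, E) 𝓘(ℝ, E) (fun h : G => h • ι y) 1
  let B : E' →L[ℝ] E := mfderiv 𝓘(ℝ, E') 𝓘(ℝ, E) ι y
  let v : E := (mfderiv 𝓘(ℝ, ℝ) 𝓘(ℝ, E) g 0 : ℝ →L[ℝ] _) (1 : ℝ)
  let T' : E →ₗ[ℝ] E := Ad a
  let T : E →L[ℝ] E := LinearMap.toContinuousLinearMap T'
  obtain ⟨hρ, μ, hμB, hμv, u, hu⟩ := hZ.exists_functional y (A := A) rfl (B := B) rfl (v := v) rfl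
    (T := T') rfl
  obtain ⟨f, hf, hfμ, hf0⟩ := exists_flow_invariant_function hg hg0 h (A := A) rfl (B := B) rfl
    (v := v) rfl (hZ.velocity_notMem y rfl rfl rfl) hμB hμv
  have hTT' : (T : E →ₗ[ℝ] E) = T' := rfl
  set ρ := specRadius T'
  set p := topExponent T' - 1
  have hρ0 : 0 < ρ := one_pos.trans hρ
  obtain ⟨C, hC, hCT⟩ := exists_norm_pow_le T hTT' hρ0
  obtain ⟨c, hc, hcT⟩ := exists_le_norm_comp_pow T hTT' hρ0 (ℓ := μ.comp A) (v := u) hu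
  -- This tolerance makes `ℓ` vary so little on `K` that the lower growth bound at the centre
  -- survives with half its constant.
  obtain ⟨K, hKc, hKz, ℓ, hℓ, hlin⟩ := exists_linearization hf (ε := c / (2 * C)) (by positivity)
  have hℓz : ℓ (ι y) = μ.comp A := (hℓ _ (mem_of_mem_nhds hKz)).2.1.unique hfμ
  have hlow : ∀ᶠ n in atTop, ∀ x ∈ K, c / 2 * growthRate ρ p n ≤ ‖(ℓ x).comp (T ^ n)‖ := by
    filter_upwards [hcT] with n hn x hx
    have h1 : ‖(ℓ (ι y) - ℓ x).comp (T ^ n)‖ ≤ c / (2 * C) * (C * growthRate ρ p n) :=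
      (ContinuousLinearMap.opNorm_comp_le _ _).trans (mul_le_mul
        ((norm_sub_rev _ _).trans_le (hℓ x hx).2.2.le) (hCT n) (norm_nonneg _) (by positivity))
    have h2 : c / (2 * C) * (C * growthRate ρ p n) = c / 2 * growthRate ρ p n := by
      field_simp
    have h3 : (μ.comp A).comp (T ^ n) =
        (ℓ (ι y) - ℓ x).comp (T ^ n) + (ℓ x).comp (T ^ n) := by
      rw [hℓz, ← ContinuousLinearMap.add_comp, sub_add_cancel]
    have h4 := norm_add_le ((ℓ (ι y) - ℓ x).comp (T ^ n)) ((ℓ x).comp (T ^ n))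
    rw [← h3] at h4
    linarith
  have hne : ∀ x ∈ K, ℓ x ≠ 0 := fun x hx h0 => by
    obtain ⟨n, hn⟩ := hlow.exists
    have h1 := hn x hx
    rw [h0, ContinuousLinearMap.zero_comp, norm_zero] at h1
    exact absurd h1 (not_le.2 (mul_pos (half_pos hc) (growthRate_pos hρ0 p n)))
  refine ⟨f, K, hKz, fun x hx => (hℓ x hx).1.continuousAt, hf0, fun b φ hφ β hβ hβ' => ⟨?_, ?_⟩⟩
  · exact isShrinkHAWOn_compl_hypersurface hKc.isClosed
      (fun x hx => ⟨(hℓ x hx).1, (hℓ x hx).2.1, hne x hx⟩) b hφ hβ hβ'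
  · refine isShrinkHAWOn_eventually_avoid (T := T) (ρ := ρ) (p := p) (C := max C 1) (ℓ := ℓ)
      (Λ := ‖ℓ (ι y)‖ + c / (2 * C)) (c₀ := c / 2) rfl hρ (le_max_right _ _) (fun n => ?_)
      (by positivity) (fun x hx => ?_) hlin (half_pos hc) hlow b hφ hβ hβ'
    · exact (hCT n).trans (mul_le_mul_of_nonneg_right (le_max_left _ _) (growthRate_pos hρ0 p n).le)
    · have h1 := norm_le_norm_add_norm_sub' (ℓ x) (ℓ (ι y))
      exact h1.trans (add_le_add le_rfl ((hℓ x hx).2.2.le))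

end Local

/-! ### From continuous to discrete time. -/

section Recurrence

variable {G X : Type*} [TopologicalSpace G] [Group G] [TopologicalSpace X] [T2Space X]
  [MulAction G X] [ContinuousSMul G X]

/-- A point `x` whose orbit under the powers of `g 1` eventually stays away from a piece of
hypersurface, and never meets it, cannot have a limit point of its forward orbit in the part of the
hypersurface foliated by the flow. -/
theorem notMem_closure_of_eventually_avoid {g : ℝ → G} (hg : Continuous g)
    (hgadd : ∀ s t : ℝ, g (s + t) = g s * g t) {f : X → ℝ} {K : Set X}
    (hf : ∀ x ∈ K, ContinuousAt f x) {z : X} {δ : ℝ} (hδ : 0 < δ)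
    (hz : ∀ s : ℝ, |s| < δ → K ∈ 𝓝 (g s • z) ∧ f (g s • z) = 0) {x : X}
    (h1 : ∀ (q : ℚ) (n : ℕ), ¬ ((g 1 ^ n * g (-q)) • x ∈ K ∧ f ((g 1 ^ n * g (-q)) • x) = 0))
    (h2 : ∀ q : ℚ, ∃ ε : ℝ, 0 < ε ∧ ∀ᶠ n in atTop, ¬ (g 1 ^ n • (g (-q) • x) ∈ K ∧
      |f (g 1 ^ n • (g (-q) • x))| < ε)) :
    z ∉ closure ((fun t : ℝ => g t • x) '' Ici 0) := by
  intro hcl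
  have hg0 : g 0 = 1 := by
    have := hgadd 0 0
    rwa [add_zero, left_eq_mul] at this
  have hpow : ∀ n : ℕ, g 1 ^ n = g n := fun n => by
    induction n with
    | zero => rw [pow_zero, Nat.cast_zero, hg0]
    | succ n ih => rw [pow_succ, ih, Nat.cast_succ, hgadd]
  rw [mem_closure_iff_clusterPt, ← map_principal] at hcl
  obtain ⟨U, hU, hUz⟩ := mapClusterPt_iff_ultrafilter.1 hcl
  have hU0 : ∀ᶠ t : ℝ in U, 0 ≤ t := le_principal_iff.1 hU
  -- Along an ultrafilter of times with orbit points tending to `z`, the rounding defect ⌈t⌉ - t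
  -- also converges.
  obtain ⟨σ, -, hσ⟩ := (isCompact_Icc (a := (0 : ℝ)) (b := 1)).ultrafilter_le_nhds
    (U.map fun t => (⌈t⌉₊ : ℝ) - t) (le_principal_iff.2 (by
      refine mem_map.2 (Filter.mem_of_superset hU0 fun t (ht : 0 ≤ t) => ?_)
      exact ⟨sub_nonneg.2 (Nat.le_ceil t), by linarith [Nat.ceil_lt_add_one ht]⟩))
  have hσ' : Tendsto (fun t : ℝ => (⌈t⌉₊ : ℝ) - t) U (𝓝 σ) := hσ
  obtain ⟨q, hq⟩ : ∃ q : ℚ, |σ - q| < δ := by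
    obtain ⟨q, hq1, hq2⟩ := exists_rat_btwn (show σ - δ < σ by linarith)
    exact ⟨q, abs_lt.2 ⟨by linarith, by linarith⟩⟩
  obtain ⟨hK, hf0⟩ := hz (σ - q) hq
  -- A rational `q` near σ keeps the limit on the flow piece around `z`, while leaving only
  -- countably many starting points g(-q) • x.
  have hlim : Tendsto (fun t : ℝ => g 1 ^ ⌈t⌉₊ • (g (-q) • x)) U (𝓝 (g (σ - q) • z)) := by
    have h3 : Tendsto (fun t : ℝ => g ((⌈t⌉₊ : ℝ) - t - q)) U (𝓝 (g (σ - q))) :=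
      (hg.tendsto _).comp (hσ'.sub_const _)
    refine (h3.smul hUz).congr fun t => ?_
    rw [smul_smul, smul_smul, hpow, ← hgadd, ← hgadd]
    congr 2
    ring
  obtain ⟨ε, hε, hev⟩ := h2 q
  obtain ⟨n₀, hn₀⟩ := eventually_atTop.1 hev
  have hlt : ∀ᶠ t : ℝ in U, ⌈t⌉₊ < n₀ := by
    have h3 : Tendsto f (𝓝 (g (σ - q) • z)) (𝓝 0) := hf0 ▸ hf _ (mem_of_mem_nhds hK)
    filter_upwards [hlim.eventually hK, (h3.comp hlim).eventually (Metric.ball_mem_nhds _ hε)]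
      with t ht ht'
    by_contra hle
    refine hn₀ _ (not_lt.1 hle) ⟨ht, ?_⟩
    simpa using ht'
  -- Bounded integer times are constant along an ultrafilter, so the limit is an actual orbit point,
  -- excluded by `h1`.
  obtain ⟨m, -, hm⟩ := (Ultrafilter.finite_biUnion_mem_iff (f := U)
    (s := fun m : ℕ => {t : ℝ | ⌈t⌉₊ = m}) (finite_Iio n₀)).1 (by
      filter_upwards [hlt] with t ht
      exact mem_biUnion ht rfl)
  have hconst : g 1 ^ m • (g (-q) • x) = g (σ - q) • z := by
    refine tendsto_nhds_unique (tendsto_const_nhds.congr' ?_) hlim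
    filter_upwards [hm] with t ht
    rw [show ⌈t⌉₊ = m from ht]
  refine h1 q m ?_
  rw [mul_smul, hconst]
  exact ⟨mem_of_mem_nhds hK, hf0⟩

end Recurrence

end NondenseOrbits

theorem theoremA2
    {E : Type*} [NormedAddCommGroup E] [InnerProductSpace ℝ E] [FiniteDimensional ℝ E]
    {G : Type*} [TopologicalSpace G] [T2Space G] [SecondCountableTopology G]
    [ChartedSpace E G] [Group G] [LieGroup 𝓘(ℝ, E) ∞ G]
    (Γ : Subgroup G) [DiscreteTopology Γ]
    (g : ℝ → G) (hg : ContMDiff 𝓘(ℝ, ℝ) 𝓘(ℝ, E) ∞ g) (hgadd : ∀ s t : ℝ, g (s + t) = g s * g t)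
    {E' : Type*} [NormedAddCommGroup E'] [NormedSpace ℝ E']
    {N : Type*} [TopologicalSpace N] [ChartedSpace E' N] [IsManifold 𝓘(ℝ, E') 1 N] [Nonempty N]
    (ι : N → G ⧸ Γ) (hι : Manifold.IsSmoothEmbedding 𝓘(ℝ, E') 𝓘(ℝ, E) 1 ι)
    (hZ : IsTransversal (E' := E') (flowLieAlgebra E g) (maxHorosphericalLieAlgebra E (g 1)) ι) :
    IsHAW E (exceptionalSet g (Set.range ι)) := by
  have := topologicalGroup_of_lieGroup 𝓘(ℝ, E) ∞ (G := G)
  have := t2Space_quotient E Γ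
  have : Nontrivial E := hZ.nontrivial
  have : SecondCountableTopology N := hι.isEmbedding.secondCountableTopology
  have hg0 : g 0 = 1 := by
    have := hgadd 0 0
    rwa [add_zero, left_eq_mul] at this
  choose f K hK hfK hf0 hwin using fun y =>
    hZ.exists_winning_hypersurface hg hg0 (hι.isImmersion.isImmersionAt y)
  have hcover : ∀ y : N, ∃ O ∈ 𝓝 y, ∃ δ : ℝ, 0 < δ ∧ ∀ y' ∈ O, ∀ s : ℝ, |s| < δ →
      K y ∈ 𝓝 (g s • ι y') ∧ f y (g s • ι y') = 0 := fun y => by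
    have h1 : Filter.Tendsto (fun p : N × ℝ => g p.2 • ι p.1) (𝓝 (y, 0)) (𝓝 (ι y)) := by
      have h2 : Continuous fun p : N × ℝ => g p.2 • ι p.1 :=
        (hg.continuous.comp continuous_snd).smul (hι.isEmbedding.continuous.comp continuous_fst)
      have h3 := h2.tendsto (y, 0)
      simpa only [hg0, one_smul] using h3
    have h2 := (h1.eventually (eventually_mem_nhds_iff.2 (hK y))).and (hf0 y)
    rw [nhds_prod_eq] at h2
    obtain ⟨O, hO, S, hS, hOS⟩ := Filter.mem_prod_iff.1 h2
    obtain ⟨δ, hδ, hδS⟩ := Metric.mem_nhds_iff.1 hS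
    exact ⟨O, hO, δ, hδ, fun y' hy' s hs =>
      hOS (show (y', s) ∈ O ×ˢ S from ⟨hy', hδS (by simpa using hs)⟩)⟩
  choose O hO δ hδ hOδ using hcover
  obtain ⟨C, hC, hCO⟩ := TopologicalSpace.countable_cover_nhds hO
  have hCne : C.Nonempty := by
    obtain ⟨y, hy, -⟩ := Set.mem_iUnion₂.1 (hCO.symm ▸ Set.mem_univ (Classical.arbitrary N))
    exact ⟨y, hy⟩
  have := hC.to_subtype
  have := hCne.to_subtype
  obtain ⟨e, he⟩ := exists_surjective_nat (C × ℚ × Option ℕ)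
  intro φ hφ β hβ hβ'
  -- Here `none` encodes eventual avoidance of a neighborhood, and `some n` missing the hypersurface
  -- itself at the single time n.
  let S : C × ℚ × Option ℕ → Set E
    | (y, q, some n) => {u | ¬ ((g 1 ^ n * g (-q)) • φ.symm u ∈ K y ∧
        f y ((g 1 ^ n * g (-q)) • φ.symm u) = 0)}
    | (y, q, none) => {u | ∃ ε : ℝ, 0 < ε ∧ ∀ᶠ n in Filter.atTop,
        ¬ (g 1 ^ n • (g (-q) • φ.symm u) ∈ K y ∧ |f y (g 1 ^ n • (g (-q) • φ.symm u))| < ε)}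
  have hS : ∀ i, ∀ β : ℝ, 0 < β → β < 1 / 3 → IsShrinkHAWOn β (S i) φ.target := by
    rintro ⟨y, q, _ | n⟩ β hβ hβ'
    · exact (hwin y (g (-q)) φ hφ β hβ hβ').2
    · exact (hwin y (g 1 ^ n * g (-q)) φ hφ β hβ hβ').1
  refine IsShrinkHAWOn.isBetaHAWOn ?_ hβ hβ'
  refine (IsShrinkHAWOn.iInter (S := fun j => S (e j)) (fun j => hS (e j)) hβ hβ').mono
    fun u hu huS => ⟨φ.symm u, ⟨?_, φ.map_target hu⟩, φ.right_inv hu⟩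
  have huS' : ∀ i, u ∈ S i := fun i => by
    obtain ⟨j, rfl⟩ := he i
    exact Set.mem_iInter.1 huS j
  refine Set.eq_empty_of_forall_notMem ?_
  rintro _ ⟨hcl, y', rfl⟩
  obtain ⟨y, hy, hy'⟩ := Set.mem_iUnion₂.1 (hCO.symm ▸ Set.mem_univ y')
  exact notMem_closure_of_eventually_avoid hg.continuous hgadd (hfK y) (hδ y) (hOδ y y' hy')
    (fun q n => huS' (⟨y, hy⟩, q, some n)) (fun q => huS' (⟨y, hy⟩, q, none)) hcl
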